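/- There is an absolute constant $C>0$ such that for every fixed integer $d\ge 2$ there is a polynomial-time algorithm with the following property. The input is an ultrametric $D$ on a set $X$ of $n\ge 2$ points with rational distances, given as the table of all pairwise distances written in binary; that is, $D(x,y)\ge 0$, $D(x,y)=0$ iff $x=y$, $D(x,y)=D(y,x)$, and $D(x,z)\le\max\{D(x,y),D(y,z)\}$ for all $x,y,z\in X$. The output is an injective map $f:X\to\mathbb R^d$ with rational coordinates such that $$\operatorname{dist}(f)\ \le\ C\,\sqrt d\,\bigl(1+\log_2\Delta\bigr)^3\cdot \mathrm{OPT}_d(D).$$ Here the distortion of an injective map $g:X\to\mathbb R^d$ is $$\operatorname{dist}(g)=\max_{x\ne y}\frac{\|g(x)-g(y)\|_2}{D(x,y)}\cdot\max_{x\ne y}\frac{D(x,y)}{\|g(x)-g(y)\|_2},$$ $\mathrm{OPT}_d(D)=\inf_g \operatorname{dist}(g)$ over all injective $g:X\to\mathbb R^d$, and $\Delta=\max_{x,y}D(x,y)/\min_{x\neq y}D(x,y)$ is the spread of $D$. For each fixed $d$, the running time, measured as bit cost on a random access machine, is bounded by a polynomial (which may depend on $d$) in the total binary length of the input. -/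

import Mathlib

/-! ### Finite ultrametrics, distortion and spread -/

/-- `D` is an ultrametric on the `n`-point set `Fin n`, with rational distances. -/
structure IsUltrametric {n : ℕ} (D : Fin n → Fin n → ℚ) : Prop where
  nonneg : ∀ x y, 0 ≤ D x y
  eq_zero_iff : ∀ x y, D x y = 0 ↔ x = y
  symm : ∀ x y, D x y = D y x
  ultra : ∀ x y z, D x z ≤ max (D x y) (D y z)

/-- Distortion of an (injective) map `f` of the metric `D` into Euclidean `d`-space:
`max (‖f x - f y‖ / D x y) * max (D x y / ‖f x - f y‖)`. The diagonal pairs contribute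
`0 / 0 = 0` to both maxima, that is, nothing. -/
noncomputable def distortion {n d : ℕ} (D : Fin n → Fin n → ℚ)
    (f : Fin n → EuclideanSpace ℝ (Fin d)) : ℝ :=
  (⨆ p : Fin n × Fin n, dist (f p.1) (f p.2) / (D p.1 p.2 : ℝ)) *
    (⨆ p : Fin n × Fin n, (D p.1 p.2 : ℝ) / dist (f p.1) (f p.2))

/-- The optimal distortion of an embedding (an injective map) of `D` into Euclidean `d`-space. -/
noncomputable def optDistortion {n : ℕ} (d : ℕ) (D : Fin n → Fin n → ℚ) : ℝ :=
  ⨅ f : {f : Fin n → EuclideanSpace ℝ (Fin d) // Function.Injective f}, distortion D f.1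

/-- The spread of `D`: its diameter divided by its smallest distance between distinct points. -/
noncomputable def spread {n : ℕ} (D : Fin n → Fin n → ℚ) : ℝ :=
  (⨆ p : Fin n × Fin n, (D p.1 p.2 : ℝ)) /
    (⨅ p : {p : Fin n × Fin n // p.1 ≠ p.2}, (D p.1.1 p.1.2 : ℝ))

/-! ### A random access machine over the rationals with bit cost

Programs are while-programs. The memory consists of arrays, indexed by natural numbers, of cells
that are indexed by natural numbers and hold rational numbers. Every operation is charged
the binary length of its result (and its operands are charged where they are evaluated), so that
running times agree, up to a polynomial, with those of Turing machines. -/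

namespace BitRAM

/-- The binary length of a rational number (numerator and denominator in lowest terms). -/
def bitSize (q : ℚ) : ℕ := 1 + Nat.size q.num.natAbs + Nat.size q.den

/-- `s k a` is the content of cell `a` of array `k`. -/
abbrev Store := ℕ → ℕ → ℚ

/-- `s.set k a q` writes `q` to cell `a` of array `k`. -/
def Store.set (s : Store) (k a : ℕ) (q : ℚ) : Store :=
  fun k' a' => if k' = k ∧ a' = a then q else s k' a'

/-- Arithmetic expressions. `load k e` reads the cell of array `k` whose index is the value
of `e` (rounded down to a natural number). -/
inductive Expr where
  | const (q : ℚ)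
  | load (k : ℕ) (e : Expr)
  | add (e₁ e₂ : Expr)
  | sub (e₁ e₂ : Expr)
  | mul (e₁ e₂ : Expr)
  | div (e₁ e₂ : Expr)
  | floor (e : Expr)

/-- The value of an expression; division by zero yields zero. -/
def Expr.eval (s : Store) : Expr → ℚ
  | .const q => q
  | .load k e => s k ⌊e.eval s⌋₊
  | .add e₁ e₂ => e₁.eval s + e₂.eval s
  | .sub e₁ e₂ => e₁.eval s - e₂.eval s
  | .mul e₁ e₂ => e₁.eval s * e₂.eval s
  | .div e₁ e₂ => e₁.eval s / e₂.eval s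
  | .floor e => (⌊e.eval s⌋ : ℚ)

/-- The time needed to evaluate an expression: the total binary length of the values of all
its subexpressions. -/
def Expr.cost (s : Store) : Expr → ℕ
  | .const q => bitSize q
  | .load k e => e.cost s + bitSize (Expr.eval s (.load k e))
  | .add e₁ e₂ => e₁.cost s + e₂.cost s + bitSize (Expr.eval s (.add e₁ e₂))
  | .sub e₁ e₂ => e₁.cost s + e₂.cost s + bitSize (Expr.eval s (.sub e₁ e₂))
  | .mul e₁ e₂ => e₁.cost s + e₂.cost s + bitSize (Expr.eval s (.mul e₁ e₂))
  | .div e₁ e₂ => e₁.cost s + e₂.cost s + bitSize (Expr.eval s (.div e₁ e₂))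
  | .floor e => e.cost s + bitSize (Expr.eval s (.floor e))

/-- Programs. `store k i e` writes the value of `e` to the cell of array `k` whose index is
the value of `i`; the tests of `ifLt` and `whileLt` are `e₁ < e₂`. -/
inductive Program where
  | skip
  | store (k : ℕ) (i e : Expr)
  | seq (c₁ c₂ : Program)
  | ifLt (e₁ e₂ : Expr) (c₁ c₂ : Program)
  | whileLt (e₁ e₂ : Expr) (c : Program)

/-- `Runs c s t s'`: started on the memory `s`, the program `c` halts after time `t` with
memory `s'`. -/
inductive Runs : Program → Store → ℕ → Store → Prop
  | skip (s : Store) : Runs .skip s 1 s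
  | store (k : ℕ) (i e : Expr) (s : Store) :
      Runs (.store k i e) s (i.cost s + e.cost s + 1) (s.set k ⌊i.eval s⌋₊ (e.eval s))
  | seq (c₁ c₂ : Program) (s s₁ s₂ : Store) (t₁ t₂ : ℕ) :
      Runs c₁ s t₁ s₁ → Runs c₂ s₁ t₂ s₂ → Runs (.seq c₁ c₂) s (t₁ + t₂) s₂
  | if_true (e₁ e₂ : Expr) (c₁ c₂ : Program) (s s' : Store) (t : ℕ) :
      e₁.eval s < e₂.eval s → Runs c₁ s t s' →
      Runs (.ifLt e₁ e₂ c₁ c₂) s (e₁.cost s + e₂.cost s + 1 + t) s'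
  | if_false (e₁ e₂ : Expr) (c₁ c₂ : Program) (s s' : Store) (t : ℕ) :
      ¬ e₁.eval s < e₂.eval s → Runs c₂ s t s' →
      Runs (.ifLt e₁ e₂ c₁ c₂) s (e₁.cost s + e₂.cost s + 1 + t) s'
  | while_true (e₁ e₂ : Expr) (c : Program) (s s₁ s₂ : Store) (t₁ t₂ : ℕ) :
      e₁.eval s < e₂.eval s → Runs c s t₁ s₁ → Runs (.whileLt e₁ e₂ c) s₁ t₂ s₂ →
      Runs (.whileLt e₁ e₂ c) s (e₁.cost s + e₂.cost s + 1 + t₁ + t₂) s₂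
  | while_false (e₁ e₂ : Expr) (c : Program) (s : Store) :
      ¬ e₁.eval s < e₂.eval s →
      Runs (.whileLt e₁ e₂ c) s (e₁.cost s + e₂.cost s + 1) s

/-- The initial memory on the input `D`: cell `0` of array `0` holds `n`, cell `i * n + j` of
array `1` holds `D i j`, and all other cells hold `0`. -/
def inputStore {n : ℕ} (D : Fin n → Fin n → ℚ) : Store := fun k a =>
  if k = 0 ∧ a = 0 then (n : ℚ)
  else if k = 1 then
    if h : a < n * n then
      D ⟨a / n, Nat.div_lt_of_lt_mul h⟩
        ⟨a % n, Nat.mod_lt a (Nat.pos_of_ne_zero (by rintro rfl; simp at h))⟩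
    else 0
  else 0

/-- The length of the input: `n` and the table of all distances, written in binary. -/
def inputSize {n : ℕ} (D : Fin n → Fin n → ℚ) : ℕ :=
  bitSize n + ∑ i, ∑ j, bitSize (D i j)

/-- The map `Fin n → ℝ^d` read off the final memory: the `j`-th coordinate of the image of the
point `i` is in cell `i * d + j` of array `2`. -/
noncomputable def outputMap (n d : ℕ) (s : Store) : Fin n → EuclideanSpace ℝ (Fin d) :=
  fun i => WithLp.toLp 2 fun j : Fin d => ((s 2 ((i : ℕ) * d + (j : ℕ)) : ℚ) : ℝ)

end BitRAM

/-! Enumerate the points so that each is followed by a nearest one among those still to come. In an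
ultrametric, the distance of two points is then exactly the largest successive distance between them
in this chain (`NearestChain.step_le`, `NearestChain.exists_le_step`). Rounding the successive
distances to powers of two times the least one, `δ`, gives levels `i k` between `1` and `h ≤ 1 +
log₂ Δ`, and the highest level between two points determines their distance up to a factor 2.

The chain is laid out along the integers, which are cut into nested blocks of lengths `β ^ j` with
`β = 2 ^ d`, and the line is folded into `ℤ ^ d` in Z-order: every `d`-th binary digit goes to the
same coordinate. A block of length `β ^ j` becomes a cube of side `2 ^ j`. It is therefore enough
that a step of level `i` enters a new block of length `β ^ (i - 1)`, and that points joined by steps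
of level at most `I` share a block of length `P * β ^ I`, where `P = β ^ p` is a stretch factor.
Different cubes may still touch; `spacedPosition` opens gaps at all scales, so that points of
different cubes of side `2 ^ j` are at least `2 ^ j` apart, at the price of a factor `h` in the
expansion.

To keep stretches inside blocks, `sweep` jumps over a block boundary that is too close ahead. The
length lost is paid for by the boundaries crossed (`sweep_cost`). Hence a stretch of level `I` takes
up less than the `4 * h`-th part of a block of length `P * β ^ I`, provided that `P` is large
compared with the total length of its cells (`NearestChain.Spacious`).

The least such `p` is comparable with the optimum. Let `g` have expansion `a` and contraction `b`.
The points of level `j` in a stretch of level `I` are mapped to points that are `2 ^ (j - 1) * δ /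
b` apart in a ball of radius `a * 2 ^ I * δ`; comparing volumes at each of the `h` levels bounds the
cell lengths of the stretch (`NearestChain.sum_pow_le`). Taking `d`-th roots yields `2 ^ p ≤ 40 * h
^ 2 * (a * b)` (`NearestChain.stretch_le`). The embedding has distortion at most `4 * √d * h * 2 ^
p`, whence the constant 160 and the third power of the logarithm.

For the running time, `Exec B` is a program logic in which all cells have at most `B` bits and every
loop has at most `B` rounds. The time is then a polynomial in `B` read off the program text, and a
`B` quadratic in the input length suffices. -/

namespace BitRAM

/-! ### Binary lengths -/

theorem size_mul_le (a b : ℕ) : Nat.size (a * b) ≤ Nat.size a + Nat.size b := by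
  rw [Nat.size_le, pow_add]
  exact Nat.mul_lt_mul'' (Nat.lt_size_self a) (Nat.lt_size_self b)

theorem size_add_le (a b : ℕ) : Nat.size (a + b) ≤ Nat.size a + Nat.size b + 1 := by
  rw [Nat.size_le]
  have ha := Nat.lt_size_self a
  have hb := Nat.lt_size_self b
  have h1 : 2 ^ a.size ≤ 2 ^ (a.size + b.size) := Nat.pow_le_pow_right (by norm_num) (by omega)
  have h2 : 2 ^ b.size ≤ 2 ^ (a.size + b.size) := Nat.pow_le_pow_right (by norm_num) (by omega)
  rw [pow_succ]
  omega

/-- Reduction to lowest terms only shrinks numerator and denominator, so any representation as a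
fraction bounds the length. The bounds for products, inverses and sums follow from this. -/
theorem bitSize_div_int_le (a b : ℤ) (hb : b ≠ 0) :
    bitSize ((a : ℚ) / b) ≤ 1 + Nat.size a.natAbs + Nat.size b.natAbs := by
  rcases eq_or_ne a 0 with rfl | ha
  · have : 1 ≤ Nat.size b.natAbs := Nat.size_pos.2 (by omega)
    simp only [bitSize, Int.cast_zero, zero_div, Rat.num_zero, Rat.den_zero, Nat.size_one]
    simp
    omega
  rw [bitSize, ← Rat.divInt_eq_div]
  have h1 : (Rat.divInt a b).num.natAbs ≤ a.natAbs :=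
    Nat.le_of_dvd (by omega) (Int.natAbs_dvd_natAbs.2 (Rat.num_dvd a hb))
  have h2 : (Rat.divInt a b).den ≤ b.natAbs :=
    Nat.le_of_dvd (by omega) (by
      have := Int.natAbs_dvd_natAbs.2 (Rat.den_dvd a b)
      simpa using this)
  have := Nat.size_le_size h1
  have := Nat.size_le_size h2
  omega

theorem bitSize_mul_le (p q : ℚ) : bitSize (p * q) ≤ bitSize p + bitSize q := by
  have h : p * q = ((p.num * q.num : ℤ) : ℚ) / ((p.den * q.den : ℤ) : ℚ) := by
    conv_lhs => rw [← Rat.num_div_den p, ← Rat.num_div_den q]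
    push_cast
    rw [div_mul_div_comm]
  have := bitSize_div_int_le (p.num * q.num) (p.den * q.den) (by positivity)
  rw [← h, Int.natAbs_mul, Int.natAbs_mul] at this
  have h1 := size_mul_le p.num.natAbs q.num.natAbs
  have h2 := size_mul_le p.den q.den
  simp only [Int.natAbs_natCast] at this
  unfold bitSize at *
  omega

theorem bitSize_inv (p : ℚ) : bitSize p⁻¹ ≤ bitSize p := by
  rcases eq_or_ne p 0 with rfl | hp
  · simp
  have h : p⁻¹ = ((p.den : ℤ) : ℚ) / ((p.num : ℤ) : ℚ) := by
    conv_lhs => rw [← Rat.num_div_den p]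
    simp
  have := bitSize_div_int_le p.den p.num (by simpa using hp)
  rw [← h] at this
  simp only [Int.natAbs_natCast] at this
  unfold bitSize at *
  omega

theorem bitSize_div_le (p q : ℚ) : bitSize (p / q) ≤ bitSize p + bitSize q := by
  rw [div_eq_mul_inv]
  exact (bitSize_mul_le _ _).trans (Nat.add_le_add_left (bitSize_inv q) _)

theorem bitSize_add_le (p q : ℚ) : bitSize (p + q) ≤ 2 * (bitSize p + bitSize q) := by
  have h : p + q = ((p.num * q.den + q.num * p.den : ℤ) : ℚ) / ((p.den * q.den : ℤ) : ℚ) := by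
    conv_lhs => rw [← Rat.num_div_den p, ← Rat.num_div_den q]
    push_cast
    field_simp
  have := bitSize_div_int_le (p.num * q.den + q.num * p.den) (p.den * q.den) (by positivity)
  rw [← h] at this
  have h1 := size_mul_le p.num.natAbs q.den
  have h2 := size_mul_le p.den q.den
  have h3 := size_mul_le q.num.natAbs p.den
  have h4 := size_add_le (p.num.natAbs * q.den) (q.num.natAbs * p.den)
  have h5 := Nat.size_le_size (Int.natAbs_add_le (p.num * q.den) (q.num * p.den))
  simp only [Int.natAbs_natCast, Int.natAbs_mul] at this h5
  unfold bitSize at *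
  omega

theorem bitSize_neg (p : ℚ) : bitSize (-p) = bitSize p := by
  simp [bitSize]

theorem bitSize_sub_le (p q : ℚ) : bitSize (p - q) ≤ 2 * (bitSize p + bitSize q) := by
  rw [sub_eq_add_neg, ← bitSize_neg q]
  exact bitSize_add_le _ _

theorem bitSize_floor_le (p : ℚ) : bitSize ((⌊p⌋ : ℤ) : ℚ) ≤ bitSize p := by
  have h1 : (⌊p⌋).natAbs ≤ p.num.natAbs := by
    rw [Rat.floor_def']
    exact Int.natAbs_ediv_le_natAbs _ _
  have h2 := Nat.size_le_size h1
  have h3 : 1 ≤ Nat.size p.den := Nat.size_pos.2 p.den_pos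
  simp only [bitSize, Rat.num_intCast, Rat.den_intCast, Nat.size_one]
  omega

theorem bitSize_natCast (m : ℕ) : bitSize (m : ℚ) = Nat.size m + 2 := by
  simp [bitSize]; omega

theorem bitSize_natCast_le {m b : ℕ} (h : m < 2 ^ b) : bitSize (m : ℚ) ≤ b + 2 := by
  rw [bitSize_natCast]
  have := Nat.size_le.2 h
  omega

theorem bitSize_natCast_mono {m k B : ℕ} (h : m ≤ k) (hk : bitSize (k : ℚ) ≤ B) :
    bitSize (m : ℚ) ≤ B := by
  rw [bitSize_natCast] at *
  have := Nat.size_le_size h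
  omega

theorem lt_two_pow_bitSize (q : ℚ) : q < 2 ^ bitSize q := by
  have h1 : q ≤ q.num.natAbs := by
    conv_lhs => rw [← Rat.num_div_den q]
    have h : (q.num : ℚ) ≤ q.num.natAbs := by
      rw [← Int.cast_natCast (R := ℚ)]
      exact Int.cast_le.2 Int.le_natAbs
    rw [div_le_iff₀ (by exact_mod_cast q.den_pos)]
    have hd : (1 : ℚ) ≤ q.den := by exact_mod_cast q.den_pos
    nlinarith [Nat.cast_nonneg (α := ℚ) q.num.natAbs]
  have h2 : q.num.natAbs < 2 ^ bitSize q :=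
    (Nat.lt_size_self _).trans_le (Nat.pow_le_pow_right (by norm_num) (by unfold bitSize; omega))
  exact h1.trans_lt (by exact_mod_cast h2)

/-! ### Running times of programs on memories with short contents -/

/-- All cells hold numbers of binary length at most `B`. -/
def Small (B : ℕ) (s : Store) : Prop := ∀ k a, bitSize (s k a) ≤ B

/-- A bound, in multiples of the binary length of the memory cells, for the cost of an
expression. -/
def Expr.weight : Expr → ℕ
  | .const q => bitSize q
  | .load _ e => e.weight + 1
  | .add e₁ e₂ => 3 * (e₁.weight + e₂.weight)
  | .sub e₁ e₂ => 3 * (e₁.weight + e₂.weight)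
  | .mul e₁ e₂ => 2 * (e₁.weight + e₂.weight)
  | .div e₁ e₂ => 2 * (e₁.weight + e₂.weight)
  | .floor e => 2 * e.weight

theorem Expr.bitSize_eval_le_cost (s : Store) (e : Expr) : bitSize (e.eval s) ≤ e.cost s := by
  cases e <;> simp [Expr.cost, Expr.eval]

/-- A value is never longer than the cost of computing it. As a sum is at most twice as long as its
operands together, and a product at most as long, an operation multiplies the cost by at most 3 or
2. -/
theorem Expr.cost_le_weight {B : ℕ} (hB : 1 ≤ B) {s : Store} (hs : Small B s) (e : Expr) :
    e.cost s ≤ e.weight * B := by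
  induction e with
  | const q => simpa [Expr.cost, Expr.weight] using Nat.le_mul_of_pos_right _ hB
  | load k e ih =>
    simp only [Expr.cost, Expr.weight, Expr.eval]
    have := hs k ⌊e.eval s⌋₊
    linarith
  | add e₁ e₂ h₁ h₂ =>
    have := bitSize_add_le (e₁.eval s) (e₂.eval s)
    have := e₁.bitSize_eval_le_cost s
    have := e₂.bitSize_eval_le_cost s
    simp only [Expr.cost, Expr.weight, Expr.eval]
    linarith
  | sub e₁ e₂ h₁ h₂ =>
    have := bitSize_sub_le (e₁.eval s) (e₂.eval s)
    have := e₁.bitSize_eval_le_cost s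
    have := e₂.bitSize_eval_le_cost s
    simp only [Expr.cost, Expr.weight, Expr.eval]
    linarith
  | mul e₁ e₂ h₁ h₂ =>
    have := bitSize_mul_le (e₁.eval s) (e₂.eval s)
    have := e₁.bitSize_eval_le_cost s
    have := e₂.bitSize_eval_le_cost s
    simp only [Expr.cost, Expr.weight, Expr.eval]
    linarith
  | div e₁ e₂ h₁ h₂ =>
    have := bitSize_div_le (e₁.eval s) (e₂.eval s)
    have := e₁.bitSize_eval_le_cost s
    have := e₂.bitSize_eval_le_cost s
    simp only [Expr.cost, Expr.weight, Expr.eval]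
    linarith
  | floor e ih =>
    have := bitSize_floor_le (e.eval s)
    have := e.bitSize_eval_le_cost s
    simp only [Expr.cost, Expr.weight, Expr.eval]
    linarith

/-- The running time of a program, provided that all memory cells have binary length at most `B`
throughout and every loop ends after at most `B` rounds. -/
def Program.timeBound (B : ℕ) : Program → ℕ
  | .skip => 1
  | .store _ i e => (i.weight + e.weight) * B + 1
  | .seq c₁ c₂ => c₁.timeBound B + c₂.timeBound B
  | .ifLt e₁ e₂ c₁ c₂ => (e₁.weight + e₂.weight) * B + 1 + c₁.timeBound B + c₂.timeBound B
  | .whileLt e₁ e₂ c => (B + 1) * ((e₁.weight + e₂.weight) * B + 1 + c.timeBound B)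

theorem Program.exists_polynomial_timeBound (c : Program) :
    ∃ p : Polynomial ℕ, ∀ B, c.timeBound B = p.eval B := by
  induction c with
  | skip => exact ⟨1, by simp [timeBound]⟩
  | store k i e =>
    exact ⟨Polynomial.C (i.weight + e.weight) * Polynomial.X + 1, by simp [timeBound]⟩
  | seq c₁ c₂ h₁ h₂ =>
    obtain ⟨p, hp⟩ := h₁
    obtain ⟨q, hq⟩ := h₂
    exact ⟨p + q, by simp [timeBound, hp, hq]⟩
  | ifLt e₁ e₂ c₁ c₂ h₁ h₂ =>
    obtain ⟨p, hp⟩ := h₁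
    obtain ⟨q, hq⟩ := h₂
    exact ⟨Polynomial.C (e₁.weight + e₂.weight) * Polynomial.X + 1 + p + q, by
      simp [timeBound, hp, hq]⟩
  | whileLt e₁ e₂ c h =>
    obtain ⟨p, hp⟩ := h
    exact ⟨(Polynomial.X + 1) * (Polynomial.C (e₁.weight + e₂.weight) * Polynomial.X + 1 + p), by
      simp [timeBound, hp]⟩

/-- On the memory `s` (if its cells have binary length at most `B`), the program `c` halts in time
`c.timeBound B`, with a memory that satisfies `Q` and has cells of binary length at most `B`. -/
def Exec (B : ℕ) (c : Program) (s : Store) (Q : Store → Prop) : Prop :=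
  Small B s → ∃ t s', Runs c s t s' ∧ t ≤ c.timeBound B ∧ Small B s' ∧ Q s'

namespace Exec

variable {B : ℕ} {s : Store} {Q R : Store → Prop}

theorem mono {c : Program} (h : Exec B c s Q) (hQ : ∀ s', Q s' → R s') : Exec B c s R := by
  intro hs
  obtain ⟨t, s', h1, h2, h3, h4⟩ := h hs
  exact ⟨t, s', h1, h2, h3, hQ _ h4⟩

theorem skip (h : Q s) : Exec B .skip s Q :=
  fun hs => ⟨1, s, .skip s, le_rfl, hs, h⟩

theorem seq {c₁ c₂ : Program} (h : Exec B c₁ s fun s₁ => Exec B c₂ s₁ Q) :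
    Exec B (.seq c₁ c₂) s Q := by
  intro hs
  obtain ⟨t₁, s₁, h1, h2, h3, h4⟩ := h hs
  obtain ⟨t₂, s₂, g1, g2, g3, g4⟩ := h4 h3
  exact ⟨_, _, .seq _ _ _ _ _ _ _ h1 g1, Nat.add_le_add h2 g2, g3, g4⟩

theorem store (hB : 1 ≤ B) {k : ℕ} {i e : Expr} {a : ℕ} {v : ℚ} (hi : i.eval s = a)
    (he : e.eval s = v) (hv : bitSize v ≤ B) (h : Q (s.set k a v)) :
    Exec B (.store k i e) s Q := by
  intro hs
  refine ⟨_, _, .store k i e s, ?_, ?_, ?_⟩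
  · have := i.cost_le_weight hB hs
    have := e.cost_le_weight hB hs
    simp only [Program.timeBound]
    linarith
  · intro k' a'
    unfold Store.set
    split_ifs
    · rwa [he]
    · exact hs _ _
  · rwa [hi, he, Nat.floor_natCast]

theorem ifLt (hB : 1 ≤ B) {e₁ e₂ : Expr} {c₁ c₂ : Program}
    (h₁ : e₁.eval s < e₂.eval s → Exec B c₁ s Q) (h₂ : e₂.eval s ≤ e₁.eval s → Exec B c₂ s Q) :
    Exec B (.ifLt e₁ e₂ c₁ c₂) s Q := by
  intro hs
  have k1 := e₁.cost_le_weight hB hs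
  have k2 := e₂.cost_le_weight hB hs
  by_cases h : e₁.eval s < e₂.eval s
  · obtain ⟨t, s', g1, g2, g3, g4⟩ := h₁ h hs
    refine ⟨_, _, .if_true _ _ _ _ _ _ _ h g1, ?_, g3, g4⟩
    simp only [Program.timeBound]
    linarith
  · obtain ⟨t, s', g1, g2, g3, g4⟩ := h₂ (not_lt.1 h) hs
    refine ⟨_, _, .if_false _ _ _ _ _ _ _ h g1, ?_, g3, g4⟩
    simp only [Program.timeBound]
    linarith

/-- The rule for loops: `I m` holds after `m` rounds. -/
theorem whileLt (hB : 1 ≤ B) {e₁ e₂ : Expr} {c : Program} (I : ℕ → Store → Prop) (h0 : I 0 s)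
    (hbody : ∀ m s, I m s → e₁.eval s < e₂.eval s → m < B ∧ Exec B c s (I (m + 1)))
    (hpost : ∀ m s, I m s → e₂.eval s ≤ e₁.eval s → Q s) :
    Exec B (.whileLt e₁ e₂ c) s Q := by
  intro hs
  -- Induction on the number `r` of rounds still available. For `r = 0` the guard must fail, since
  -- the body requires `m < B`.
  have key : ∀ r m s, m + r = B → I m s → Small B s → ∃ t s', Runs (.whileLt e₁ e₂ c) s t s' ∧
      t ≤ (r + 1) * ((e₁.weight + e₂.weight) * B + 1 + c.timeBound B) ∧ Small B s' ∧ Q s' := by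
    intro r
    induction r with
    | zero =>
      intro m s hm hI hs
      have k1 := e₁.cost_le_weight hB hs
      have k2 := e₂.cost_le_weight hB hs
      have h : ¬ e₁.eval s < e₂.eval s := fun h => by
        have := (hbody m s hI h).1
        omega
      exact ⟨_, _, .while_false _ _ _ _ h, by linarith, hs, hpost m s hI (not_lt.1 h)⟩
    | succ r ih =>
      intro m s hm hI hs
      have k1 := e₁.cost_le_weight hB hs
      have k2 := e₂.cost_le_weight hB hs
      by_cases h : e₁.eval s < e₂.eval s
      · obtain ⟨t₁, s₁, g1, g2, g3, g4⟩ := (hbody m s hI h).2 hs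
        obtain ⟨t₂, s₂, f1, f2, f3, f4⟩ := ih (m + 1) s₁ (by omega) g4 g3
        refine ⟨_, _, .while_true _ _ _ _ _ _ _ _ h g1 f1, ?_, f3, f4⟩
        linarith
      · refine ⟨_, _, .while_false _ _ _ _ h, ?_, hs, hpost m s hI (not_lt.1 h)⟩
        have : 0 ≤ (r + 1) * ((e₁.weight + e₂.weight) * B + 1 + c.timeBound B) := Nat.zero_le _
        linarith
  exact key B 0 s (by omega) h0 hs

end Exec

end BitRAM

/-! ### Binary digits in interleaved order -/

/-- The number whose binary digits are every `d`-th binary digit of `u`. -/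
def gatherBits (d u : ℕ) : ℕ :=
  if h : u = 0 ∨ d = 0 then 0 else u % 2 + 2 * gatherBits d (u / 2 ^ d)
termination_by u
decreasing_by
  push Not at h
  exact Nat.div_lt_self (by omega) (Nat.one_lt_two_pow h.2)

theorem gatherBits_zero (d : ℕ) : gatherBits d 0 = 0 := by
  rw [gatherBits]; simp

theorem gatherBits_eq {d : ℕ} (hd : d ≠ 0) (u : ℕ) :
    gatherBits d u = u % 2 + 2 * gatherBits d (u / 2 ^ d) := by
  rcases eq_or_ne u 0 with rfl | hu
  · simp [gatherBits_zero]
  · conv_lhs => rw [gatherBits]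
    simp [hu, hd]

theorem gatherBits_le {d : ℕ} (hd : d ≠ 0) (u : ℕ) : gatherBits d u ≤ u := by
  induction u using Nat.strong_induction_on with
  | _ u ih =>
    rcases eq_or_ne u 0 with rfl | hu
    · simp [gatherBits_zero]
    rw [gatherBits_eq hd]
    have h1 := ih (u / 2 ^ d) (Nat.div_lt_self (by omega) (Nat.one_lt_two_pow hd))
    have h2 : u / 2 ^ d ≤ u / 2 :=
      Nat.div_le_div_left (Nat.le_self_pow hd 2) (by norm_num)
    omega

/-- Deleting `j` digits of a coordinate is the same as deleting `d * j` digits of `u`: the cubes of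
side `2 ^ j` are the images of the blocks of length `(2 ^ d) ^ j`. Both directions of the distance
estimate rest on this. -/
theorem gatherBits_div_two_pow {d : ℕ} (hd : d ≠ 0) (a u j : ℕ) :
    gatherBits d (u / 2 ^ a) / 2 ^ j = gatherBits d (u / (2 ^ d) ^ j / 2 ^ a) := by
  induction j with
  | zero => simp
  | succ j ih =>
    rw [pow_succ, ← Nat.div_div_eq_div_mul, ih, gatherBits_eq hd, pow_succ (2 ^ d) j,
      ← Nat.div_div_eq_div_mul, Nat.div_div_eq_div_mul _ (2 ^ a), mul_comm (2 ^ a),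
      ← Nat.div_div_eq_div_mul _ (2 ^ d)]
    omega

/-- Each binary digit of `u` occurs in exactly one coordinate. The induction strips the lowest `d`
digits, which are the last digits of the `d` coordinates. -/
theorem eq_of_gatherBits_eq {d : ℕ} (hd : d ≠ 0) (u v : ℕ)
    (h : ∀ a < d, gatherBits d (u / 2 ^ a) = gatherBits d (v / 2 ^ a)) : u = v := by
  induction u using Nat.strong_induction_on generalizing v with
  | _ u ih =>
    have hlow : u % 2 ^ d = v % 2 ^ d := by
      apply Nat.eq_of_testBit_eq
      intro a
      rw [Nat.testBit_mod_two_pow, Nat.testBit_mod_two_pow]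
      by_cases ha : a < d
      · have h1 := h a ha
        rw [gatherBits_eq hd, gatherBits_eq hd (v / 2 ^ a)] at h1
        have : u / 2 ^ a % 2 = v / 2 ^ a % 2 := by omega
        simp only [Nat.testBit_eq_decide_div_mod_eq, this]
      · simp [ha]
    have hstep : ∀ a < d, gatherBits d (u / 2 ^ d / 2 ^ a) = gatherBits d (v / 2 ^ d / 2 ^ a) := by
      intro a ha
      have h1 := gatherBits_div_two_pow hd a u 1
      have h2 := gatherBits_div_two_pow hd a v 1
      rw [h a ha] at h1
      simp only [pow_one] at h1 h2
      rw [← h1, h2]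
    rcases eq_or_ne u 0 with rfl | hu
    · by_contra hv
      -- A nonzero number has a nonzero digit and hence a nonzero coordinate.
      have hz : ∀ w, w ≠ 0 → ∃ a < d, gatherBits d (w / 2 ^ a) ≠ 0 := by
        intro w
        induction w using Nat.strong_induction_on with
        | _ w ihw =>
          intro hw
          by_cases hm : w % 2 ^ d = 0
          · have hq : w / 2 ^ d ≠ 0 := by
              intro h0
              have := Nat.div_add_mod w (2 ^ d)
              rw [h0, hm] at this
              omega
            obtain ⟨a, ha, hne⟩ := ihw _ (Nat.div_lt_self (by omega) (Nat.one_lt_two_pow hd)) hq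
            refine ⟨a, ha, fun h0 => hne ?_⟩
            have h1 := gatherBits_div_two_pow hd a w 1
            rw [h0] at h1
            simpa using h1.symm
          · obtain ⟨a, hbit⟩ := Nat.exists_testBit_of_ne_zero hm
            rw [Nat.testBit_mod_two_pow] at hbit
            simp only [Bool.and_eq_true, decide_eq_true_eq, Nat.testBit_eq_decide_div_mod_eq]
              at hbit
            refine ⟨a, hbit.1, ?_⟩
            rw [gatherBits_eq hd]
            omega
      obtain ⟨a, ha, hne⟩ := hz v (Ne.symm hv)
      have := h a ha
      rw [Nat.zero_div, gatherBits_zero] at this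
      exact hne this.symm
    · have hq := ih _ (Nat.div_lt_self (by omega) (Nat.one_lt_two_pow hd)) _ hstep
      rw [← Nat.div_add_mod u (2 ^ d), ← Nat.div_add_mod v (2 ^ d), hq, hlow]

/-- The position of the cell `c` of a line after inserting gaps of length `2 ^ j` at the multiples
of `2 ^ j`, for `1 ≤ j < h`. -/
def spacedPosition (h c : ℕ) : ℕ := ∑ j ∈ Finset.range h, 2 ^ j * (c / 2 ^ j)

theorem spacedPosition_le (h c : ℕ) : spacedPosition h c ≤ h * c := by
  refine (Finset.sum_le_card_nsmul _ _ c fun j _ => Nat.mul_div_le c (2 ^ j)).trans ?_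
  simp

/-- All terms of the sum are monotone in the cell, and the `j`-th term alone grows by `2 ^ j`. -/
theorem spacedPosition_add_le {h c c' j : ℕ} (hj : j < h) (hc : c / 2 ^ j < c' / 2 ^ j) :
    spacedPosition h c + 2 ^ j ≤ spacedPosition h c' := by
  have hcc : c ≤ c' := by
    by_contra hlt
    exact absurd (Nat.div_le_div_right (c := 2 ^ j) (le_of_not_ge hlt)) (by omega)
  unfold spacedPosition
  rw [← Finset.add_sum_erase _ _ (Finset.mem_range.2 hj),
    ← Finset.add_sum_erase (Finset.range h) (fun j => 2 ^ j * (c' / 2 ^ j)) (Finset.mem_range.2 hj)]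
  have h1 : 2 ^ j * (c / 2 ^ j) + 2 ^ j ≤ 2 ^ j * (c' / 2 ^ j) := by
    rw [← Nat.mul_succ]
    exact Nat.mul_le_mul_left _ hc
  have h2 : ∑ x ∈ (Finset.range h).erase j, 2 ^ x * (c / 2 ^ x) ≤
      ∑ x ∈ (Finset.range h).erase j, 2 ^ x * (c' / 2 ^ x) :=
    Finset.sum_le_sum fun x _ => Nat.mul_le_mul_left _ (Nat.div_le_div_right hcc)
  omega

/-- Each of the `h` terms varies by at most `2 ^ q` within a cell of length `2 ^ q`; terms with `j ≥
q` do not vary at all. -/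
theorem spacedPosition_le_add {h c c' q : ℕ} (hc : c / 2 ^ q = c' / 2 ^ q) :
    spacedPosition h c ≤ spacedPosition h c' + h * 2 ^ q := by
  have key : ∀ j ∈ Finset.range h, 2 ^ j * (c / 2 ^ j) ≤ 2 ^ j * (c' / 2 ^ j) + 2 ^ q := by
    intro j _
    rcases le_total j q with hjq | hjq
    · have h1 := Nat.mul_div_le c (2 ^ j)
      have h2 := Nat.lt_mul_div_succ c (Nat.two_pow_pos q)
      have h3 : 2 ^ q * (c' / 2 ^ q) ≤ 2 ^ j * (c' / 2 ^ j) := by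
        obtain ⟨e, rfl⟩ := Nat.exists_eq_add_of_le hjq
        rw [pow_add, mul_assoc]
        refine Nat.mul_le_mul_left _ ?_
        rw [← Nat.div_div_eq_div_mul]
        exact Nat.mul_div_le _ _
      rw [hc] at h2
      rw [Nat.mul_succ] at h2
      omega
    · obtain ⟨e, rfl⟩ := Nat.exists_eq_add_of_le hjq
      rw [pow_add, ← Nat.div_div_eq_div_mul, ← Nat.div_div_eq_div_mul, hc]
      exact Nat.le_add_right _ _
  refine (Finset.sum_le_sum key).trans ?_
  rw [Finset.sum_add_distrib]
  simp [spacedPosition]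

/-! ### Placing points along a line, avoiding the boundaries of blocks -/

/-- Advance from `t` to the next multiple of `L`, if that is at distance at most `L / (4 * h)`. -/
def skipBoundary (h L t : ℕ) : ℕ := max t (L * ((4 * h * t + L) / (4 * h * L)))

/-- Skip the boundaries of the blocks of lengths `P * β ^ j` for all `j < i`. -/
def skipBoundaries (β h P : ℕ) : ℕ → ℕ → ℕ
  | 0, t => t
  | j + 1, t => skipBoundary h (P * β ^ j) (skipBoundaries β h P j t)

/-- The places of points along a line, where the `k`-th and the next point are put
into different cells of length `β ^ (i k - 1)`. -/
def sweep (β h P : ℕ) (i : ℕ → ℕ) : ℕ → ℕ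
  | 0 => 0
  | k + 1 => skipBoundaries β h P (i k)
      ((sweep β h P i k / β ^ (i k - 1) + 1) * β ^ (i k - 1))

/-- The block of length `L` around `t` goes on for more than `L / (4 * h)` after `t`. -/
def FitsInBlock (h L t : ℕ) : Prop := (4 * h * t + L) / (4 * h * L) = t / L

theorem le_skipBoundary (h L t : ℕ) : t ≤ skipBoundary h L t := le_max_left _ _

section
variable {β h P : ℕ}

theorem FitsInBlock.of_dvd {L t : ℕ} (hh : 1 ≤ h) (hL : 1 ≤ L) (hd : L ∣ t) :
    FitsInBlock h L t := by
  obtain ⟨q, rfl⟩ := hd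
  unfold FitsInBlock
  rw [Nat.mul_div_cancel_left _ hL, ← mul_assoc, Nat.mul_add_div (by positivity)]
  have : L / (4 * h * L) = 0 := Nat.div_eq_of_lt (by nlinarith)
  omega

/-- Either no boundary is close ahead, or the position is moved onto it and the whole next block is
free. -/
theorem fitsInBlock_skipBoundary {L : ℕ} (hh : 1 ≤ h) (hL : 1 ≤ L) (t : ℕ) :
    FitsInBlock h L (skipBoundary h L t) := by
  unfold skipBoundary
  rcases le_total (L * ((4 * h * t + L) / (4 * h * L))) t with hle | hle
  · rw [max_eq_left hle]
    apply le_antisymm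
    · rw [Nat.le_div_iff_mul_le hL]
      linarith
    · rw [← Nat.mul_div_mul_left t L (show 0 < 4 * h by omega)]
      exact Nat.div_le_div_right (by omega)
  · rw [max_eq_right hle]
    exact .of_dvd hh hL (dvd_mul_right _ _)

/-- Amortization: an advance is at most `L / (4 * h)` and always crosses a multiple of `L`, so the
growth of `L * (t / L)` pays for `4 * h` times the advance. -/
theorem skipBoundary_cost {L : ℕ} (hL : 1 ≤ L) (t : ℕ) :
    4 * h * skipBoundary h L t + L * (t / L) ≤ 4 * h * t + L * (skipBoundary h L t / L) := by
  unfold skipBoundary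
  rcases le_or_gt (L * ((4 * h * t + L) / (4 * h * L))) t with hle | hlt
  · rw [max_eq_left hle]
  · rw [max_eq_right hlt.le, Nat.mul_div_cancel_left _ hL]
    have h1 : t / L < (4 * h * t + L) / (4 * h * L) := by
      rw [Nat.div_lt_iff_lt_mul hL]
      linarith
    have h2 := Nat.mul_div_le (4 * h * t + L) (4 * h * L)
    have h3 := Nat.mul_le_mul_left L h1
    rw [Nat.succ_eq_add_one] at h3
    nlinarith

theorem le_skipBoundaries (i t : ℕ) : t ≤ skipBoundaries β h P i t := by
  induction i with
  | zero => exact le_rfl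
  | succ j ih => exact ih.trans (le_skipBoundary _ _ _)

/-- Boundaries are skipped in order of increasing block length. A later skip lands on a multiple of
a longer block, hence also of every shorter one, and does not spoil what was achieved before. -/
theorem fitsInBlock_skipBoundaries (hβ : 1 ≤ β) (hh : 1 ≤ h) (hP : 1 ≤ P) (t : ℕ) {i j : ℕ}
    (hj : j < i) : FitsInBlock h (P * β ^ j) (skipBoundaries β h P i t) := by
  induction i with
  | zero => omega
  | succ i ih =>
    have hL : ∀ m, 1 ≤ P * β ^ m := fun m => Nat.mul_pos hP (Nat.pow_pos hβ)
    rcases Nat.lt_succ_iff_lt_or_eq.1 hj with hlt | rfl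
    · simp only [skipBoundaries]
      unfold skipBoundary
      rcases le_total (P * β ^ i * ((4 * h * skipBoundaries β h P i t + P * β ^ i) /
        (4 * h * (P * β ^ i)))) (skipBoundaries β h P i t) with hle | hle
      · rw [max_eq_left hle]
        exact ih hlt
      · rw [max_eq_right hle]
        exact .of_dvd hh (hL j) (Dvd.dvd.mul_right (Nat.mul_dvd_mul_left _
          (Nat.pow_dvd_pow _ hlt.le)) _)
    · exact fitsInBlock_skipBoundary hh (hL j) _

theorem skipBoundaries_cost (hβ : 1 ≤ β) (hP : 1 ≤ P) (i t : ℕ) :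
    4 * h * skipBoundaries β h P i t + ∑ j ∈ Finset.range i, P * β ^ j * (t / (P * β ^ j)) ≤
      4 * h * t + ∑ j ∈ Finset.range i, P * β ^ j * (skipBoundaries β h P i t / (P * β ^ j)) := by
  induction i with
  | zero => simp [skipBoundaries]
  | succ i ih =>
    have hL : 1 ≤ P * β ^ i := Nat.mul_pos hP (Nat.pow_pos hβ)
    have h1 := skipBoundary_cost (h := h) hL (skipBoundaries β h P i t)
    rw [Finset.sum_range_succ, Finset.sum_range_succ]
    simp only [skipBoundaries]
    have h2 : ∑ j ∈ Finset.range i, P * β ^ j * (skipBoundaries β h P i t / (P * β ^ j)) ≤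
        ∑ j ∈ Finset.range i, P * β ^ j *
          (skipBoundary h (P * β ^ i) (skipBoundaries β h P i t) / (P * β ^ j)) :=
      Finset.sum_le_sum fun j _ => Nat.mul_le_mul_left _
        (Nat.div_le_div_right (le_skipBoundary _ _ _))
    have h3 : P * β ^ i * (t / (P * β ^ i)) ≤
        P * β ^ i * (skipBoundaries β h P i t / (P * β ^ i)) :=
      Nat.mul_le_mul_left _ (Nat.div_le_div_right (le_skipBoundaries _ _))
    omega

variable {i : ℕ → ℕ}

theorem sweep_div_lt_succ (hβ : 1 ≤ β) (k : ℕ) :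
    sweep β h P i k / β ^ (i k - 1) < sweep β h P i (k + 1) / β ^ (i k - 1) := by
  have hr : 0 < β ^ (i k - 1) := Nat.pow_pos hβ
  rw [sweep, Nat.lt_iff_add_one_le, Nat.le_div_iff_mul_le hr]
  exact le_skipBoundaries _ _

theorem sweep_mono (hβ : 1 ≤ β) : Monotone (sweep β h P i) := by
  refine monotone_nat_of_le_succ fun k => ?_
  by_contra hlt
  exact absurd (sweep_div_lt_succ (h := h) (P := P) (i := i) hβ k)
    (not_lt.2 (Nat.div_le_div_right (le_of_not_ge hlt)))

theorem sweep_div_lt (hβ : 1 ≤ β) {k l m : ℕ} (hkm : k ≤ m) (hml : m < l) :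
    sweep β h P i k / β ^ (i m - 1) < sweep β h P i l / β ^ (i m - 1) :=
  (Nat.div_le_div_right (sweep_mono hβ hkm)).trans_lt
    ((sweep_div_lt_succ hβ m).trans_le (Nat.div_le_div_right (sweep_mono hβ hml)))

/-- The sum of `skipBoundary_cost` over the stretch, telescoped. A step to the next cell advances by
at most the cell length; block lengths that are not skipped at some step only help, because `t / L`
is monotone. -/
theorem sweep_cost (hβ : 1 ≤ β) (hP : 1 ≤ P) {I k l : ℕ} (hkl : k ≤ l)
    (hI : ∀ m, k ≤ m → m < l → i m ≤ I) :
    4 * h * sweep β h P i l +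
        ∑ j ∈ Finset.range I, P * β ^ j * (sweep β h P i k / (P * β ^ j)) ≤
      4 * h * sweep β h P i k + 4 * h * ∑ m ∈ Finset.Ico k l, β ^ (i m - 1) +
        ∑ j ∈ Finset.range I, P * β ^ j * (sweep β h P i l / (P * β ^ j)) := by
  induction l, hkl using Nat.le_induction with
  | base => simp
  | succ l hkl ih =>
    have ih' := ih fun m h1 h2 => hI m h1 (by omega)
    rw [Finset.sum_Ico_succ_top hkl]
    set r := β ^ (i l - 1) with hr
    set u := (sweep β h P i l / r + 1) * r with hu
    have hs : sweep β h P i (l + 1) = skipBoundaries β h P (i l) u := rfl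
    have hul : u ≤ sweep β h P i l + r := by
      have := Nat.div_mul_le_self (sweep β h P i l) r
      rw [hu, add_mul]
      omega
    have hlu : sweep β h P i l ≤ u := by
      have := Nat.lt_div_mul_add (a := sweep β h P i l) (show 0 < r from Nat.pow_pos hβ)
      rw [hu, add_mul]
      omega
    have hc := skipBoundaries_cost (h := h) hβ hP (i l) u
    rw [← hs] at hc
    have hil := hI l hkl (by omega)
    obtain ⟨e, rfl⟩ := Nat.exists_eq_add_of_le hil
    have h1 : ∀ t, ∑ j ∈ Finset.range (i l + e), P * β ^ j * (t / (P * β ^ j)) =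
        ∑ j ∈ Finset.range (i l), P * β ^ j * (t / (P * β ^ j)) +
        ∑ j ∈ Finset.range e, P * β ^ (i l + j) * (t / (P * β ^ (i l + j))) :=
      fun t => Finset.sum_range_add _ _ _
    rw [h1, h1] at ih'
    rw [h1, h1]
    have h2 : ∑ j ∈ Finset.range (i l), P * β ^ j * (sweep β h P i l / (P * β ^ j)) ≤
        ∑ j ∈ Finset.range (i l), P * β ^ j * (u / (P * β ^ j)) :=
      Finset.sum_le_sum fun j _ => Nat.mul_le_mul_left _ (Nat.div_le_div_right hlu)
    have h3 : ∑ j ∈ Finset.range e, P * β ^ (i l + j) * (sweep β h P i l / (P * β ^ (i l + j))) ≤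
        ∑ j ∈ Finset.range e, P * β ^ (i l + j) *
          (sweep β h P i (l + 1) / (P * β ^ (i l + j))) :=
      Finset.sum_le_sum fun j _ => Nat.mul_le_mul_left _
        (Nat.div_le_div_right (sweep_mono hβ (Nat.le_succ l)))
    have h4 : 4 * h * u ≤ 4 * h * sweep β h P i l + 4 * h * r := by
      rw [← mul_add]
      exact Nat.mul_le_mul_left _ hul
    rw [mul_add (4 * h)]
    omega

theorem sum_blocks_le (hβ : 4 ≤ β) (I : ℕ) :
    3 * ∑ j ∈ Finset.range I, P * β ^ j ≤ P * β ^ I := by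
  induction I with
  | zero => simp
  | succ I ih =>
    rw [Finset.sum_range_succ, pow_succ]
    have : P * β ^ I * 4 ≤ P * β ^ I * β := Nat.mul_le_mul_left _ hβ
    rw [← mul_assoc]
    omega

/-- If the line is `P` times as long as needed, a stretch of points of level at most `I` is
shorter than the `4 * h`-th part of a block of length `P * β ^ I`. -/
theorem sweep_lt_add (hβ : 4 ≤ β) (hP : 1 ≤ P) {I k l : ℕ} (hkl : k ≤ l)
    (h1I : 1 ≤ I) (hIh : I ≤ h) (hI : ∀ m, k ≤ m → m < l → i m ≤ I)
    (hsum : 4 * h * ∑ m ∈ Finset.Ico k l, β ^ (i m - 1) ≤ P * β ^ (I - 1)) :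
    4 * h * sweep β h P i l < 4 * h * sweep β h P i k + P * β ^ I := by
  have hc := sweep_cost (β := β) (h := h) (by omega) hP hkl hI
  have hmono := sweep_mono (β := β) (h := h) (P := P) (i := i) (by omega) hkl
  obtain ⟨T, hT⟩ := Nat.exists_eq_add_of_le hmono
  -- A distance `T` crosses at most `T / L + 1` multiples of `L`, which contributes at most `T + L`
  -- for each of the `I` block lengths.
  have hupper : ∑ j ∈ Finset.range I, P * β ^ j * (sweep β h P i l / (P * β ^ j)) ≤
      I * T + ∑ j ∈ Finset.range I, P * β ^ j +
        ∑ j ∈ Finset.range I, P * β ^ j * (sweep β h P i k / (P * β ^ j)) := by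
    have hterm : ∀ j ∈ Finset.range I, P * β ^ j * (sweep β h P i l / (P * β ^ j)) ≤
        T + (P * β ^ j + P * β ^ j * (sweep β h P i k / (P * β ^ j))) := by
      intro j _
      have hL : 0 < P * β ^ j := Nat.mul_pos hP (Nat.pow_pos (by omega))
      have h1 := Nat.mul_div_le (sweep β h P i l) (P * β ^ j)
      have h2 := Nat.lt_mul_div_succ (sweep β h P i k) hL
      rw [Nat.mul_succ] at h2
      omega
    refine (Finset.sum_le_sum hterm).trans ?_
    simp only [Finset.sum_add_distrib, Finset.sum_const, Finset.card_range, smul_eq_mul]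
    omega
  have hgeo := sum_blocks_le (P := P) hβ I
  have hpow : 4 * (P * β ^ (I - 1)) ≤ P * β ^ I := by
    obtain ⟨J, rfl⟩ := Nat.exists_eq_add_of_le h1I
    rw [Nat.add_sub_cancel_left, pow_add, pow_one]
    have := Nat.mul_le_mul_left (P * β ^ J) hβ
    linarith
  have hpos : 0 < P * β ^ I := Nat.mul_pos hP (Nat.pow_pos (by omega))
  -- The crossings give back at most `h * T` of the `4 * h * T`, so `3 * h * T` is at most `1/4 +
  -- 1/3` of the block `P * β ^ I`, and `4 * h * T` at most `7/9` of it.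
  have hIT : I * T ≤ h * T := Nat.mul_le_mul_right _ hIh
  rw [hT] at hc hupper ⊢
  have h1 : 4 * h * (sweep β h P i k + T) = 4 * h * sweep β h P i k + 4 * (h * T) := by ring
  rw [h1] at hc ⊢
  omega

/-- Points that are joined by a stretch of level at most `I` are in the same block of length
`P * β ^ I`. -/
theorem sweep_div_eq (hβ : 4 ≤ β) (hh : 1 ≤ h) (hP : 1 ≤ P) {N I k l : ℕ} (hkl : k ≤ l)
    (hl : l ≤ N) (hsum : ∀ k l, k < l → l ≤ N → ∃ m, k ≤ m ∧ m < l ∧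
      4 * h * ∑ m ∈ Finset.Ico k l, β ^ (i m - 1) ≤ P * β ^ (i m - 1))
    (h1I : 1 ≤ I) (hIh : I ≤ h) (hI : ∀ m, k ≤ m → m < l → i m ≤ I) :
    sweep β h P i k / (P * β ^ I) = sweep β h P i l / (P * β ^ I) := by
  have hL : 1 ≤ P * β ^ I := Nat.mul_pos hP (Nat.pow_pos (by omega))
  -- Go back from `k` until a step of level above `I`, which has cleared the boundaries of blocks of
  -- length `P * β ^ I`, or until the position 0. The bound for the length of the stretch is then
  -- applied from `k₀`.
  have hstart : ∀ k, ∃ k₀ ≤ k, (∀ m, k₀ ≤ m → m < k → i m ≤ I) ∧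
      FitsInBlock h (P * β ^ I) (sweep β h P i k₀) := by
    intro k
    induction k with
    | zero => exact ⟨0, le_rfl, fun m _ hm => by omega, .of_dvd hh hL (dvd_zero _)⟩
    | succ k ih =>
      by_cases hk : i k ≤ I
      · obtain ⟨k₀, h1, h2, h3⟩ := ih
        refine ⟨k₀, by omega, fun m hm hmk => ?_, h3⟩
        rcases Nat.lt_succ_iff_lt_or_eq.1 hmk with h | rfl
        exacts [h2 m hm h, hk]
      · exact ⟨k + 1, le_rfl, fun m _ _ => by omega,
          fitsInBlock_skipBoundaries (by omega) hh hP _ (by omega)⟩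
  obtain ⟨k₀, hk₀, hI₀, hfit⟩ := hstart k
  have hIall : ∀ m, k₀ ≤ m → m < l → i m ≤ I := fun m h1 h2 => by
    rcases lt_or_ge m k with h | h
    exacts [hI₀ m h1 h, hI m h h2]
  have hmono := sweep_mono (β := β) (h := h) (P := P) (i := i) (by omega)
  have hlt : 4 * h * sweep β h P i l < 4 * h * sweep β h P i k₀ + P * β ^ I := by
    rcases eq_or_lt_of_le (hk₀.trans hkl) with rfl | hlt
    · omega
    refine sweep_lt_add hβ hP hlt.le h1I hIh hIall ?_
    obtain ⟨m, h1, h2, h3⟩ := hsum k₀ l hlt hl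
    have h4 := hIall m h1 h2
    exact h3.trans (Nat.mul_le_mul_left _ (Nat.pow_le_pow_right (by omega) (by omega)))
  have h1 : sweep β h P i l / (P * β ^ I) ≤ sweep β h P i k₀ / (P * β ^ I) := by
    rw [← hfit, ← Nat.mul_div_mul_left (sweep β h P i l) (P * β ^ I) (show 0 < 4 * h by omega)]
    exact Nat.div_le_div_right hlt.le
  exact le_antisymm (Nat.div_le_div_right (hmono hkl))
    (h1.trans (Nat.div_le_div_right (hmono hk₀)))

/-- The whole chain is one stretch of level at most `h` that begins at 0, so it stays in the first
block. This bounds the size of the integers in the computation. -/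
theorem sweep_lt (hβ : 4 ≤ β) (hh : 1 ≤ h) (hP : 1 ≤ P) {N l : ℕ} (hl : l ≤ N)
    (hsum : ∀ k l, k < l → l ≤ N → ∃ m, k ≤ m ∧ m < l ∧
      4 * h * ∑ m ∈ Finset.Ico k l, β ^ (i m - 1) ≤ P * β ^ (i m - 1))
    (hI : ∀ m < N, i m ≤ h) : sweep β h P i l < P * β ^ h := by
  have h0 := sweep_div_eq hβ hh hP (Nat.zero_le l) hl hsum hh le_rfl
    fun m _ h2 => hI m (by omega)
  have hL : 0 < P * β ^ h := Nat.mul_pos hP (Nat.pow_pos (by omega))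
  rw [sweep, Nat.zero_div] at h0
  exact (Nat.div_eq_zero_iff_lt hL).1 h0.symm

end

/-! ### Packing in Euclidean space -/

open MeasureTheory in
/-- Points at mutual distance at least `ρ` in a ball of radius `R`: the volume bound. -/
theorem card_mul_pow_le_of_separated {ι : Type*} {d : ℕ} (S : Finset ι)
    (y : ι → EuclideanSpace ℝ (Fin d)) (c : EuclideanSpace ℝ (Fin d)) {ρ R : ℝ} (hρ : 0 < ρ)
    (hR : 0 ≤ R) (hsep : ∀ a ∈ S, ∀ b ∈ S, a ≠ b → ρ ≤ dist (y a) (y b))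
    (hball : ∀ a ∈ S, dist (y a) c ≤ R) :
    (S.card : ℝ) * (ρ / 2) ^ d ≤ (R + ρ / 2) ^ d := by
  have hdisj : (S : Set ι).PairwiseDisjoint fun a => Metric.ball (y a) (ρ / 2) := by
    intro a ha b hb hab
    exact Metric.ball_disjoint_ball (by linarith [hsep a ha b hb hab])
  have hsub : ⋃ a ∈ S, Metric.ball (y a) (ρ / 2) ⊆ Metric.ball c (R + ρ / 2) := by
    refine Set.iUnion₂_subset fun a ha => Metric.ball_subset_ball' ?_
    linarith [hball a ha]
  have hvol := measure_mono (μ := (volume : Measure (EuclideanSpace ℝ (Fin d)))) hsub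
  rw [measure_biUnion_finset hdisj fun a _ => Metric.isOpen_ball.measurableSet] at hvol
  simp only [Measure.addHaar_ball_of_pos volume _ (show 0 < ρ / 2 by positivity),
    Measure.addHaar_ball_of_pos volume _ (show 0 < R + ρ / 2 by positivity),
    Finset.sum_const, finrank_euclideanSpace, Fintype.card_fin, nsmul_eq_mul] at hvol
  have hpos : (volume : Measure (EuclideanSpace ℝ (Fin d))) (Metric.ball 0 1) ≠ 0 :=
    (Metric.measure_ball_pos _ _ one_pos).ne'
  have hfin : (volume : Measure (EuclideanSpace ℝ (Fin d))) (Metric.ball 0 1) ≠ ⊤ :=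
    measure_ball_lt_top.ne
  rw [← mul_assoc, ENNReal.mul_le_mul_iff_left hpos hfin, ← ENNReal.ofReal_natCast,
    ← ENNReal.ofReal_mul (by positivity)] at hvol
  exact (ENNReal.ofReal_le_ofReal_iff (by positivity)).1 hvol

/-! ### Distortion, nearest-neighbour chains and the comparison with the optimum -/

section
variable {n d : ℕ} {D : Fin n → Fin n → ℚ}

theorem IsUltrametric.pos (hD : IsUltrametric D) {x y : Fin n} (h : x ≠ y) : 0 < D x y :=
  lt_of_le_of_ne (hD.nonneg x y) fun h0 => h ((hD.eq_zero_iff x y).1 h0.symm)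

/-- The expansion and the contraction of an injective map. -/
theorem IsUltrametric.exists_expansion_contraction (hD : IsUltrametric D) (hn : 2 ≤ n)
    {g : Fin n → EuclideanSpace ℝ (Fin d)} (hg : Function.Injective g) :
    ∃ a b : ℝ, 0 < a ∧ 0 < b ∧ 1 ≤ a * b ∧ distortion D g = a * b ∧
      (∀ x y, dist (g x) (g y) ≤ a * D x y) ∧ ∀ x y, (D x y : ℝ) ≤ b * dist (g x) (g y) := by
  set a := ⨆ p : Fin n × Fin n, dist (g p.1) (g p.2) / (D p.1 p.2 : ℝ) with ha
  set b := ⨆ p : Fin n × Fin n, (D p.1 p.2 : ℝ) / dist (g p.1) (g p.2) with hb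
  have hDpos : ∀ {x y}, x ≠ y → (0 : ℝ) < D x y := fun h => by exact_mod_cast hD.pos h
  have h1 : ∀ x y, x ≠ y → dist (g x) (g y) / (D x y : ℝ) ≤ a := fun x y _ =>
    le_ciSup (f := fun p : Fin n × Fin n => dist (g p.1) (g p.2) / (D p.1 p.2 : ℝ))
      (Set.finite_range _).bddAbove (x, y)
  have h2 : ∀ x y, x ≠ y → (D x y : ℝ) / dist (g x) (g y) ≤ b := fun x y _ =>
    le_ciSup (f := fun p : Fin n × Fin n => (D p.1 p.2 : ℝ) / dist (g p.1) (g p.2))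
      (Set.finite_range _).bddAbove (x, y)
  have hne : (⟨0, by omega⟩ : Fin n) ≠ ⟨1, by omega⟩ := by simp
  have hx := hDpos hne
  have hy := dist_pos.2 (hg.ne hne)
  have ha0 : 0 < a := (div_pos hy hx).trans_le (h1 _ _ hne)
  have hb0 : 0 < b := (div_pos hx hy).trans_le (h2 _ _ hne)
  refine ⟨a, b, ha0, hb0, ?_, rfl, fun x y => ?_, fun x y => ?_⟩
  · refine le_trans ?_ (mul_le_mul (h1 _ _ hne) (h2 _ _ hne) (div_pos hx hy).le ha0.le)
    rw [div_mul_div_comm, mul_comm, div_self (mul_pos hx hy).ne']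
  · rcases eq_or_ne x y with rfl | hxy
    · simp [(hD.eq_zero_iff x x).2 rfl]
    · exact (div_le_iff₀ (hDpos hxy)).1 (h1 x y hxy)
  · rcases eq_or_ne x y with rfl | hxy
    · simp [(hD.eq_zero_iff x x).2 rfl]
    · exact (div_le_iff₀ (dist_pos.2 (hg.ne hxy))).1 (h2 x y hxy)

theorem distortion_le {f : Fin n → EuclideanSpace ℝ (Fin d)} (hn : 2 ≤ n) {a b : ℝ}
    (ha : 0 ≤ a) (hb : 0 ≤ b)
    (h1 : ∀ x y, x ≠ y → dist (f x) (f y) / (D x y : ℝ) ≤ a)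
    (h2 : ∀ x y, x ≠ y → (D x y : ℝ) / dist (f x) (f y) ≤ b) : distortion D f ≤ a * b := by
  have : Nonempty (Fin n) := ⟨⟨0, by omega⟩⟩
  have k2 : (⨆ p : Fin n × Fin n, (D p.1 p.2 : ℝ) / dist (f p.1) (f p.2)) ≤ b :=
    ciSup_le fun p => by
      by_cases h : p.1 = p.2
      · simpa [h] using hb
      · exact h2 _ _ h
  have k1 : (⨆ p : Fin n × Fin n, dist (f p.1) (f p.2) / (D p.1 p.2 : ℝ)) ≤ a :=
    ciSup_le fun p => by
      by_cases h : p.1 = p.2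
      · simpa [h] using ha
      · exact h1 _ _ h
  unfold distortion
  -- The supremum of the expansions is nonnegative because a diagonal pair contributes 0.
  exact (mul_le_mul_of_nonneg_left k2 (by
    by_contra hneg
    push Not at hneg
    have h0 := le_ciSup (f := fun p : Fin n × Fin n => dist (f p.1) (f p.2) / (D p.1 p.2 : ℝ))
      (Set.finite_range _).bddAbove (⟨0, by omega⟩, ⟨0, by omega⟩)
    simp only [dist_self, zero_div] at h0
    linarith)).trans (mul_le_mul_of_nonneg_right k1 hb)

/-- An enumeration of the points in which every point is followed by a nearest one among those
that come later, together with the binary orders of magnitude of the successive distances, in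
units of the least distance `δ`. -/
structure NearestChain (D : Fin n → Fin n → ℚ) (x : ℕ → Fin n) (i : ℕ → ℕ) (δ : ℚ) (h : ℕ) :
    Prop where
  inj : ∀ k l, k < n → l < n → x k = x l → k = l
  near : ∀ k l, k < l → l < n → D (x k) (x (k + 1)) ≤ D (x k) (x l)
  unit_pos : 0 < δ
  unit_mem : ∃ k, k + 1 < n ∧ D (x k) (x (k + 1)) = δ
  one_le : ∀ k, k + 1 < n → 1 ≤ i k
  le_top : ∀ k, k + 1 < n → i k ≤ h
  top_mem : ∃ k, k + 1 < n ∧ i k = h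
  pow_le : ∀ k, k + 1 < n → 2 ^ (i k - 1) * δ ≤ D (x k) (x (k + 1))
  le_pow : ∀ k, k + 1 < n → D (x k) (x (k + 1)) ≤ 2 ^ i k * δ

namespace NearestChain

variable {x : ℕ → Fin n} {i : ℕ → ℕ} {δ : ℚ} {h : ℕ}

/-- The step from `x m` is at most `D (x m) (x l)` by the choice of a nearest point, and this is at
most `D (x k) (x l)` by the ultrametric inequality through `x k` and induction. -/
theorem dist_le (hc : NearestChain D x i δ h) (hD : IsUltrametric D) {k m l : ℕ} (hkm : k ≤ m)
    (hml : m ≤ l) (hl : l < n) : D (x k) (x m) ≤ D (x k) (x l) := by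
  induction m, hkm using Nat.le_induction with
  | base =>
    rw [(hD.eq_zero_iff _ _).2 rfl]
    exact hD.nonneg _ _
  | succ m hkm ih =>
    have ih' := ih (by omega)
    refine (hD.ultra _ (x m) _).trans (max_le ih' ?_)
    refine (hc.near m l (by omega) hl).trans ((hD.ultra _ (x k) _).trans (max_le ?_ le_rfl))
    rwa [hD.symm]

/-- With `exists_le_step`, which needs only the ultrametric inequality, this identifies a distance
with the maximum of the steps in between. -/
theorem step_le (hc : NearestChain D x i δ h) (hD : IsUltrametric D) {k m l : ℕ} (hkm : k ≤ m)
    (hml : m < l) (hl : l < n) : D (x m) (x (m + 1)) ≤ D (x k) (x l) := by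
  refine (hD.ultra _ (x k) _).trans (max_le ?_ (hc.dist_le hD (by omega) (by omega) hl))
  rw [hD.symm]
  exact hc.dist_le hD hkm hml.le hl

theorem exists_le_step (hD : IsUltrametric D) {k l : ℕ} (hkl : k < l) :
    ∃ m, k ≤ m ∧ m < l ∧ D (x k) (x l) ≤ D (x m) (x (m + 1)) := by
  induction l, hkl using Nat.le_induction with
  | base => exact ⟨k, le_rfl, by omega, le_rfl⟩
  | succ l hkl ih =>
    obtain ⟨m, h1, h2, h3⟩ := ih
    rcases le_max_iff.1 (hD.ultra (x k) (x l) (x (l + 1))) with h | h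
    · exact ⟨m, h1, by omega, h.trans h3⟩
    · exact ⟨l, by omega, by omega, h⟩

theorem exists_level (i : ℕ → ℕ) {k l : ℕ} (hkl : k < l) :
    ∃ m, k ≤ m ∧ m < l ∧ ∀ m', k ≤ m' → m' < l → i m' ≤ i m := by
  obtain ⟨m, hm, hmax⟩ := Finset.exists_max_image (Finset.Ico k l) i ⟨k, by simpa using hkl⟩
  simp only [Finset.mem_Ico] at hm hmax
  exact ⟨m, hm.1, hm.2, fun m' h1 h2 => hmax m' ⟨h1, h2⟩⟩

theorem pow_le_dist (hc : NearestChain D x i δ h) (hD : IsUltrametric D) {k m l : ℕ}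
    (hkm : k ≤ m) (hml : m < l) (hl : l < n) : 2 ^ (i m - 1) * δ ≤ D (x k) (x l) :=
  (hc.pow_le m (by omega)).trans (hc.step_le hD hkm hml hl)

theorem dist_le_pow (hc : NearestChain D x i δ h) (hD : IsUltrametric D) {k l I : ℕ}
    (hkl : k < l) (hl : l < n) (hI : ∀ m, k ≤ m → m < l → i m ≤ I) :
    D (x k) (x l) ≤ 2 ^ I * δ := by
  obtain ⟨m, h1, h2, h3⟩ := exists_le_step (x := x) hD hkl
  refine h3.trans ((hc.le_pow m (by omega)).trans ?_)
  exact mul_le_mul_of_nonneg_right (pow_le_pow_right₀ one_le_two (hI m h1 h2)) hc.unit_pos.le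

theorem one_le_top (hc : NearestChain D x i δ h) : 1 ≤ h := by
  obtain ⟨k, hk, rfl⟩ := hc.top_mem
  exact hc.one_le k hk

theorem surj (hc : NearestChain D x i δ h) (y : Fin n) : ∃ k < n, x k = y := by
  have hinj : Function.Injective fun k : Fin n => x k := fun a b hab =>
    Fin.ext (hc.inj a b a.2 b.2 hab)
  obtain ⟨k, hk⟩ := (Finite.injective_iff_surjective.1 hinj) y
  exact ⟨k, k.2, hk⟩

/-- A step of the top level has length at least `2 ^ (h - 1) * δ`, and `δ` is itself a distance of
distinct points. -/
theorem top_le_spread (hc : NearestChain D x i δ h) (hD : IsUltrametric D) :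
    (h : ℝ) ≤ 1 + Real.logb 2 (spread D) := by
  obtain ⟨k, hk, hkδ⟩ := hc.unit_mem
  obtain ⟨l, hl, hlh⟩ := hc.top_mem
  have hne : x k ≠ x (k + 1) := fun hx => by
    have := hc.inj _ _ (by omega) (by omega) hx
    omega
  have hinf : (⨅ p : {p : Fin n × Fin n // p.1 ≠ p.2}, (D p.1.1 p.1.2 : ℝ)) ≤ δ := by
    have := ciInf_le (f := fun p : {p : Fin n × Fin n // p.1 ≠ p.2} => (D p.1.1 p.1.2 : ℝ))
      (Set.finite_range _).bddBelow ⟨(x k, x (k + 1)), hne⟩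
    simpa [hkδ] using this
  have hpos : 0 < (⨅ p : {p : Fin n × Fin n // p.1 ≠ p.2}, (D p.1.1 p.1.2 : ℝ)) := by
    have : Nonempty {p : Fin n × Fin n // p.1 ≠ p.2} := ⟨⟨(x k, x (k + 1)), hne⟩⟩
    obtain ⟨p, hp⟩ := exists_eq_ciInf_of_finite
      (f := fun p : {p : Fin n × Fin n // p.1 ≠ p.2} => (D p.1.1 p.1.2 : ℝ))
    rw [← hp]
    exact_mod_cast hD.pos p.2
  have hsup : (2 : ℝ) ^ (h - 1) * δ ≤ ⨆ p : Fin n × Fin n, (D p.1 p.2 : ℝ) := by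
    have h1 := le_ciSup (f := fun p : Fin n × Fin n => (D p.1 p.2 : ℝ))
      (Set.finite_range _).bddAbove (x l, x (l + 1))
    refine le_trans ?_ h1
    have := hc.pow_le l hl
    rw [hlh] at this
    exact_mod_cast this
  have hspread : (2 : ℝ) ^ (h - 1) ≤ spread D := by
    rw [spread, le_div_iff₀ hpos]
    refine le_trans (mul_le_mul_of_nonneg_left hinf (by positivity)) hsup
  have h1 := hc.one_le_top
  have hlog := Real.logb_le_logb_of_le one_lt_two (by positivity) hspread
  rw [← Real.rpow_natCast, Real.logb_rpow (by norm_num) (by norm_num), Nat.cast_sub h1] at hlog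
  push_cast at hlog
  linarith

/-- The volume bound for a stretch of the chain. -/
theorem sum_pow_le (hc : NearestChain D x i δ h) (hD : IsUltrametric D)
    {g : Fin n → EuclideanSpace ℝ (Fin d)} {a b : ℝ} (ha : 0 < a) (hb : 0 < b) (hab : 1 ≤ a * b)
    (hga : ∀ x y, dist (g x) (g y) ≤ a * D x y) (hgb : ∀ x y, (D x y : ℝ) ≤ b * dist (g x) (g y))
    {k l m : ℕ} (hml : m < l) (hl : l < n)
    (hmax : ∀ m', k ≤ m' → m' < l → i m' ≤ i m) :
    ((∑ m ∈ Finset.Ico k l, (2 ^ d) ^ (i m - 1) : ℕ) : ℝ) ≤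
      h * ((2 ^ d) ^ (i m - 1) * (5 * (a * b)) ^ d) := by
  have hmaps : ∀ m' ∈ Finset.Ico k l, i m' ∈ Finset.Icc 1 h := by
    intro m' hm'
    rw [Finset.mem_Ico] at hm'
    exact Finset.mem_Icc.2 ⟨hc.one_le m' (by omega), hc.le_top m' (by omega)⟩
  have hδ : (0 : ℝ) < δ := by exact_mod_cast hc.unit_pos
  push_cast
  -- Sort the points of the stretch by level: there are at most `h` levels, and each is bounded
  -- separately by volume.
  rw [← Finset.sum_fiberwise_of_maps_to hmaps]
  have hterm : ∀ j ∈ Finset.Icc 1 h, ∑ m' ∈ Finset.Ico k l with i m' = j,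
      ((2 : ℝ) ^ d) ^ (i m' - 1) ≤ (2 ^ d) ^ (i m - 1) * (5 * (a * b)) ^ d := by
    intro j hj
    set S := {m' ∈ Finset.Ico k l | i m' = j} with hS
    have hmem : ∀ m' ∈ S, k ≤ m' ∧ m' < l ∧ i m' = j := fun m' hm' => by
      simpa [hS, and_assoc] using hm'
    rw [Finset.sum_congr rfl fun m' hm' => by rw [(hmem m' hm').2.2], Finset.sum_const,
      nsmul_eq_mul]
    rcases S.eq_empty_or_nonempty with hempty | ⟨m₀, hm₀⟩
    · rw [hempty]
      simp only [Finset.card_empty, Nat.cast_zero, zero_mul]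
      positivity
    obtain ⟨h1, h2, h3⟩ := hmem m₀ hm₀
    have hji : j ≤ i m := h3 ▸ hmax m₀ h1 h2
    have h1m : 1 ≤ i m := hc.one_le m (by omega)
    have hup : ∀ p ∈ S, ∀ q ∈ S, p < q → (D (x p) (x q) : ℝ) ≤ 2 ^ i m * δ := by
      intro p hp q hq hpq
      obtain ⟨p1, p2, p3⟩ := hmem p hp
      obtain ⟨q1, q2, q3⟩ := hmem q hq
      exact_mod_cast hc.dist_le_pow hD hpq (by omega) fun m' h h' => hmax m' (by omega) (by omega)
    -- Only the level of the earlier point matters: all later points are at least as far away as its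
    -- successor.
    have hlow : ∀ p ∈ S, ∀ q ∈ S, p < q → (2 : ℝ) ^ (j - 1) * δ ≤ D (x p) (x q) := by
      intro p hp q hq hpq
      obtain ⟨p1, p2, p3⟩ := hmem p hp
      obtain ⟨q1, q2, q3⟩ := hmem q hq
      have := hc.pow_le_dist hD (le_refl p) hpq (by omega)
      rw [p3] at this
      exact_mod_cast this
    have hpack := card_mul_pow_le_of_separated S (fun m' => g (x m')) (g (x m₀))
      (ρ := 2 ^ (j - 1) * δ / b) (R := a * (2 ^ i m * δ)) (by positivity) (by positivity) (by
        intro p hp q hq hpq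
        rw [div_le_iff₀' hb]
        rcases lt_or_gt_of_ne hpq with hlt | hlt
        · exact (hlow p hp q hq hlt).trans (hgb _ _)
        · rw [dist_comm]
          exact (hlow q hq p hp hlt).trans (hgb _ _)) (by
        intro p hp
        rcases lt_trichotomy p m₀ with hlt | rfl | hlt
        · exact (hga _ _).trans (mul_le_mul_of_nonneg_left (hup p hp m₀ hm₀ hlt) ha.le)
        · rw [dist_self]
          positivity
        · rw [dist_comm]
          exact (hga _ _).trans (mul_le_mul_of_nonneg_left (hup m₀ hm₀ p hp hlt) ha.le))
    -- Rescaling turns the radius of the small balls into `2 ^ (j - 1)`, so that their volumes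
    -- become the cell lengths.
    have hscale : 0 < (2 * b / δ) ^ d := by positivity
    have h4 := mul_le_mul_of_nonneg_right hpack hscale.le
    rw [mul_assoc, ← mul_pow, ← mul_pow] at h4
    have e1 : 2 ^ (j - 1) * (δ : ℝ) / b / 2 * (2 * b / δ) = 2 ^ (j - 1) := by
      field_simp
    have e2 : (a * (2 ^ i m * δ) + 2 ^ (j - 1) * (δ : ℝ) / b / 2) * (2 * b / δ) =
        4 * (a * b) * 2 ^ (i m - 1) + 2 ^ (j - 1) := by
      have : (2 : ℝ) ^ i m = 2 * 2 ^ (i m - 1) := by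
        rw [← pow_succ']
        congr 1
        omega
      rw [this]
      field_simp
      ring
    rw [e1, e2] at h4
    rw [← pow_mul, mul_comm d, pow_mul]
    refine h4.trans ?_
    rw [← pow_mul 2 d, mul_comm d, pow_mul 2 _ d, ← mul_pow]
    refine pow_le_pow_left₀ (by positivity) ?_ d
    -- The constant 5 is 4 from the large radius plus 1 from the radius of a small ball, using `j ≤
    -- i m` and `1 ≤ a * b`.
    have h5 : (2 : ℝ) ^ (j - 1) ≤ 2 ^ (i m - 1) := pow_le_pow_right₀ one_le_two (by omega)
    have h6 : (2 : ℝ) ^ (i m - 1) ≤ (a * b) * 2 ^ (i m - 1) :=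
      le_mul_of_one_le_left (by positivity) hab
    linarith
  refine (Finset.sum_le_card_nsmul _ _ _ hterm).trans ?_
  simp

/-- The condition on the stretch factor `(2 ^ d) ^ p` under which `sweep` works. -/
def Spacious (d h p n : ℕ) (i : ℕ → ℕ) : Prop := ∀ k l, k < l → l < n → ∃ m, k ≤ m ∧ m < l ∧
  4 * h * ∑ m ∈ Finset.Ico k l, (2 ^ d) ^ (i m - 1) ≤ (2 ^ d) ^ p * (2 ^ d) ^ (i m - 1)

/-- The hypothesis `hp` expresses the minimality of `p`: some stretch does not fit with `p - 1`.
Testing this at a step of highest level and inserting the volume bound, the cell length cancels and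
`((2 : ℝ) ^ (p - 1)) ^ d < 4 * h ^ 2 * (5 * (a * b)) ^ d` remains when `p` is positive. As `4 * h ^
2 ≥ 1`, it may be replaced by its `d`-th power before taking roots, so that the bound does not
depend on `d`. -/
theorem stretch_le (hc : NearestChain D x i δ h) (hD : IsUltrametric D) (hd : 1 ≤ d)
    {g : Fin n → EuclideanSpace ℝ (Fin d)} {a b : ℝ} (ha : 0 < a) (hb : 0 < b) (hab : 1 ≤ a * b)
    (hga : ∀ x y, dist (g x) (g y) ≤ a * D x y) (hgb : ∀ x y, (D x y : ℝ) ≤ b * dist (g x) (g y))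
    {p : ℕ} (hp : ∀ q, p = q + 1 → ¬ Spacious d h q n i) :
    (2 : ℝ) ^ p ≤ 40 * h ^ 2 * (a * b) := by
  have h1 : (1 : ℝ) ≤ h := by exact_mod_cast hc.one_le_top
  cases p with
  | zero => nlinarith
  | succ q =>
    have hq := hp q rfl
    unfold Spacious at hq
    push Not at hq
    obtain ⟨k, l, hkl, hl, hlt⟩ := hq
    obtain ⟨m, hkm, hml, hmax⟩ := exists_level i hkl
    have h2 := hlt m hkm hml
    have h3 := hc.sum_pow_le hD ha hb hab hga hgb hml hl hmax
    have h4 : ((2 : ℝ) ^ d) ^ q * (2 ^ d) ^ (i m - 1) <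
        4 * h * (h * ((2 ^ d) ^ (i m - 1) * (5 * (a * b)) ^ d)) := by
      refine lt_of_lt_of_le ?_ (mul_le_mul_of_nonneg_left h3 (by positivity))
      exact_mod_cast h2
    have h5 : ((2 : ℝ) ^ q) ^ d < (4 * h ^ 2) * (5 * (a * b)) ^ d := by
      have hM : (0 : ℝ) < (2 ^ d) ^ (i m - 1) := by positivity
      rw [← pow_mul, mul_comm q, pow_mul]
      refine lt_of_mul_lt_mul_right (h4.trans_eq ?_) hM.le
      ring
    have h6 : (4 * (h : ℝ) ^ 2) ≤ (4 * h ^ 2) ^ d := le_self_pow₀ (by nlinarith) (by omega)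
    have h7 : ((2 : ℝ) ^ q) ^ d < (4 * h ^ 2 * (5 * (a * b))) ^ d := by
      rw [mul_pow (4 * (h : ℝ) ^ 2)]
      exact h5.trans_le (mul_le_mul_of_nonneg_right h6 (by positivity))
    have h8 := lt_of_pow_lt_pow_left₀ d (by positivity) h7
    rw [pow_succ]
    linarith

/-- The embedding computed from the places of the points on the line. -/
theorem embedding (hc : NearestChain D x i δ h) (hD : IsUltrametric D) (hd : 2 ≤ d) (hn : 2 ≤ n)
    {p : ℕ} (hsp : Spacious d h p n i) (hp : ∀ q, p = q + 1 → ¬ Spacious d h q n i)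
    {f : Fin n → EuclideanSpace ℝ (Fin d)}
    (hf : ∀ k < n, ∀ a : Fin d, f (x k) a = (spacedPosition h
      (gatherBits d (sweep (2 ^ d) h ((2 ^ d) ^ p) i k / 2 ^ (a : ℕ))) : ℕ)) :
    Function.Injective f ∧
      distortion D f ≤ 160 * √d * (1 + Real.logb 2 (spread D)) ^ 3 * optDistortion d D := by
  have hβ : 4 ≤ 2 ^ d := by
    calc 4 = 2 ^ 2 := by norm_num
      _ ≤ 2 ^ d := Nat.pow_le_pow_right (by norm_num) hd
  have hP : 1 ≤ (2 ^ d) ^ p := Nat.one_le_pow _ _ (by positivity)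
  have h1 := hc.one_le_top
  have hδ : (0 : ℝ) < δ := by exact_mod_cast hc.unit_pos
  set t := sweep (2 ^ d) h ((2 ^ d) ^ p) i with ht
  -- A step of highest level `i m` separates the places by a cell boundary at scale `i m - 1`, so
  -- some coordinates lie in different cells of length `2 ^ (i m - 1)`, and the gaps keep them that
  -- far apart.
  have hlow : ∀ k l, k < l → l < n → (D (x k) (x l) : ℝ) ≤ 2 * δ * dist (f (x k)) (f (x l)) := by
    intro k l hkl hl
    obtain ⟨m, hkm, hml, hmax⟩ := exists_level i hkl
    have h1m := hc.one_le m (by omega)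
    have hlt : t k / (2 ^ d) ^ (i m - 1) < t l / (2 ^ d) ^ (i m - 1) :=
      sweep_div_lt (by omega) hkm hml
    have hex : ∃ a < d, gatherBits d (t k / (2 ^ d) ^ (i m - 1) / 2 ^ a) ≠
        gatherBits d (t l / (2 ^ d) ^ (i m - 1) / 2 ^ a) := by
      by_contra hcon
      push Not at hcon
      exact hlt.ne (eq_of_gatherBits_eq (by omega) _ _ hcon)
    obtain ⟨a, had, hne⟩ := hex
    rw [← gatherBits_div_two_pow (by omega), ← gatherBits_div_two_pow (by omega)] at hne
    have hih : i m - 1 < h := by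
      have := hc.le_top m (by omega)
      omega
    have hcoord : (2 : ℝ) ^ (i m - 1) ≤ dist (f (x k) ⟨a, had⟩) (f (x l) ⟨a, had⟩) := by
      rw [Real.dist_eq, hf k (by omega), hf l hl]
      rcases lt_or_gt_of_ne hne with hlt' | hlt'
      · have : (_ : ℝ) ≤ _ := Nat.cast_le.2 (spacedPosition_add_le hih hlt')
        push_cast at this
        rw [abs_sub_comm]
        exact le_trans (by linarith) (le_abs_self _)
      · have : (_ : ℝ) ≤ _ := Nat.cast_le.2 (spacedPosition_add_le hih hlt')
        push_cast at this
        exact le_trans (by linarith) (le_abs_self _)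
    have hdist : dist (f (x k) ⟨a, had⟩) (f (x l) ⟨a, had⟩) ≤ dist (f (x k)) (f (x l)) := by
      rw [dist_eq_norm, dist_eq_norm]
      exact PiLp.norm_apply_le (f (x k) - f (x l)) ⟨a, had⟩
    have hD' : (D (x k) (x l) : ℝ) ≤ 2 ^ i m * δ := by
      exact_mod_cast hc.dist_le_pow hD hkl hl hmax
    have e : (2 : ℝ) ^ i m = 2 * 2 ^ (i m - 1) := by
      rw [← pow_succ']
      congr 1
      omega
    rw [e] at hD'
    nlinarith [hcoord.trans hdist]
  -- The places share a block of length `(2 ^ d) ^ (p + i m)`, so all coordinates share cells of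
  -- length `2 ^ (p + i m)`; spacing costs `h` and the Euclidean norm `√d`.
  have hupp : ∀ k l, k < l → l < n →
      dist (f (x k)) (f (x l)) ≤ 2 * √d * h * 2 ^ p / δ * D (x k) (x l) := by
    intro k l hkl hl
    obtain ⟨m, hkm, hml, hmax⟩ := exists_level i hkl
    have h1m := hc.one_le m (by omega)
    have heq : t k / ((2 ^ d) ^ p * (2 ^ d) ^ i m) = t l / ((2 ^ d) ^ p * (2 ^ d) ^ i m) :=
      sweep_div_eq hβ h1 hP (N := n - 1) hkl.le (by omega)
        (fun k l h1 h2 => hsp k l h1 (by omega)) h1m (hc.le_top m (by omega)) hmax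
    rw [← pow_add] at heq
    have hcoord : ∀ a : Fin d, dist (f (x k) a) (f (x l) a) ≤ h * 2 ^ (p + i m) := by
      intro a
      have hg : gatherBits d (t k / 2 ^ (a : ℕ)) / 2 ^ (p + i m) =
          gatherBits d (t l / 2 ^ (a : ℕ)) / 2 ^ (p + i m) := by
        rw [gatherBits_div_two_pow (by omega), gatherBits_div_two_pow (by omega), heq]
      rw [Real.dist_eq, hf k (by omega), hf l hl, abs_le]
      have u1 : (_ : ℝ) ≤ _ := Nat.cast_le.2 (spacedPosition_le_add (h := h) hg)
      have u2 : (_ : ℝ) ≤ _ := Nat.cast_le.2 (spacedPosition_le_add (h := h) hg.symm)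
      push_cast at u1 u2
      constructor <;> linarith
    have hdist : dist (f (x k)) (f (x l)) ≤ √d * (h * 2 ^ (p + i m)) := by
      rw [EuclideanSpace.dist_eq]
      calc √(∑ a, dist (f (x k) a) (f (x l) a) ^ 2)
          ≤ √(∑ _a : Fin d, ((h : ℝ) * 2 ^ (p + i m)) ^ 2) :=
            Real.sqrt_le_sqrt (Finset.sum_le_sum fun a _ =>
              pow_le_pow_left₀ dist_nonneg (hcoord a) 2)
        _ = √d * (h * 2 ^ (p + i m)) := by
            rw [Finset.sum_const, Finset.card_univ, Fintype.card_fin, nsmul_eq_mul,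
              Real.sqrt_mul (by positivity), Real.sqrt_sq (by positivity)]
    have hD' : (2 : ℝ) ^ (i m - 1) * δ ≤ D (x k) (x l) := by
      exact_mod_cast hc.pow_le_dist hD hkm hml hl
    refine hdist.trans ?_
    have e : (2 : ℝ) ^ (p + i m) = 2 ^ p * (2 * 2 ^ (i m - 1)) := by
      rw [← pow_succ', ← pow_add]
      congr 1
      omega
    rw [e]
    calc √d * (h * (2 ^ p * (2 * 2 ^ (i m - 1))))
        = 2 * √d * h * 2 ^ p / δ * (2 ^ (i m - 1) * δ) := by field_simp
      _ ≤ _ := mul_le_mul_of_nonneg_left hD' (by positivity)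
  have hpair : ∀ y z, y ≠ z → (D y z : ℝ) ≤ 2 * δ * dist (f y) (f z) ∧
      dist (f y) (f z) ≤ 2 * √d * h * 2 ^ p / δ * D y z := by
    intro y z hyz
    obtain ⟨k, hk, rfl⟩ := hc.surj y
    obtain ⟨l, hl, rfl⟩ := hc.surj z
    rcases lt_trichotomy k l with hlt | rfl | hlt
    · exact ⟨hlow k l hlt hl, hupp k l hlt hl⟩
    · exact absurd rfl hyz
    · rw [hD.symm, dist_comm]
      exact ⟨hlow l k hlt hk, hupp l k hlt hk⟩
  have hDpos : ∀ {y z}, y ≠ z → (0 : ℝ) < D y z := fun h => by exact_mod_cast hD.pos h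
  have hfpos : ∀ {y z}, y ≠ z → 0 < dist (f y) (f z) := fun {y z} hyz => by
    by_contra hcon
    have h0 : dist (f y) (f z) = 0 := le_antisymm (not_lt.1 hcon) dist_nonneg
    have := (hpair y z hyz).1
    rw [h0, mul_zero] at this
    exact absurd (hDpos hyz) (not_lt.2 this)
  have hinj : Function.Injective f := fun y z hyz => by
    by_contra hne
    have := hfpos hne
    rw [hyz, dist_self] at this
    exact lt_irrefl _ this
  refine ⟨hinj, ?_⟩
  have hdist : distortion D f ≤ 2 * √d * h * 2 ^ p / δ * (2 * δ) :=
    distortion_le hn (by positivity) (by positivity)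
      (fun y z hyz => (div_le_iff₀ (hDpos hyz)).2 (hpair y z hyz).2)
      (fun y z hyz => (div_le_iff₀ (hfpos hyz)).2 (hpair y z hyz).1)
  have hdist' : distortion D f ≤ 4 * √d * h * 2 ^ p := by
    refine hdist.trans_eq ?_
    field_simp
    ring
  have hH := hc.top_le_spread hD
  have hh0 : (1 : ℝ) ≤ h := by exact_mod_cast h1
  set H := 1 + Real.logb 2 (spread D) with hHdef
  have hd0 : 0 < √(d : ℝ) := Real.sqrt_pos.2 (by positivity)
  have hK : 0 < 160 * √d * H ^ 3 := by
    have : 0 < H := by linarith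
    positivity
  rw [← div_le_iff₀' hK]
  have : Nonempty {f : Fin n → EuclideanSpace ℝ (Fin d) // Function.Injective f} := ⟨⟨f, hinj⟩⟩
  refine le_ciInf fun g => ?_
  obtain ⟨a, b, ha, hb, hab, hgdist, hga, hgb⟩ := hD.exists_expansion_contraction hn g.2
  rw [div_le_iff₀' hK, hgdist]
  have h2p := hc.stretch_le hD (by omega) ha hb hab hga hgb hp
  have hH3 : (h : ℝ) ^ 3 ≤ H ^ 3 := pow_le_pow_left₀ (by positivity) hH 3
  calc distortion D f ≤ 4 * √d * h * 2 ^ p := hdist'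
    _ ≤ 4 * √d * h * (40 * h ^ 2 * (a * b)) := mul_le_mul_of_nonneg_left h2p (by positivity)
    _ = 160 * √d * h ^ 3 * (a * b) := by ring
    _ ≤ 160 * √d * H ^ 3 * (a * b) :=
      mul_le_mul_of_nonneg_right (mul_le_mul_of_nonneg_left hH3 (by positivity)) (by positivity)

end NearestChain
end

namespace BitRAM

/-! ### Programming with variables and arrays -/

/-- The variable `k` is cell `0` of array `k`. -/
def Expr.var (k : ℕ) : Expr := .load k (.const 0)

/-- Assignment to the variable `k`. -/
def Program.assign (k : ℕ) (e : Expr) : Program := .store k (.const 0) e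

theorem Expr.eval_var (s : Store) (k : ℕ) : (Expr.var k).eval s = s k 0 := by
  simp [Expr.var, Expr.eval]

theorem Expr.eval_load {s : Store} {e : Expr} {a : ℕ} (k : ℕ) (h : e.eval s = a) :
    (Expr.load k e).eval s = s k a := by
  simp [Expr.eval, h]

theorem Store.set_apply (s : Store) (k a : ℕ) (q : ℚ) (k' a' : ℕ) :
    s.set k a q k' a' = if k' = k ∧ a' = a then q else s k' a' := rfl

theorem Store.set_of_ne (s : Store) {k k' : ℕ} (a : ℕ) (q : ℚ) (h : k' ≠ k) :
    s.set k a q k' = s k' := by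
  funext a'
  simp [Store.set_apply, h]

/-- The memories `s` and `s'` differ at most in the arrays in `M`. -/
def SameOff (M : List ℕ) (s s' : Store) : Prop := ∀ k, k ∉ M → s' k = s k

namespace SameOff

variable {M : List ℕ} {s s' s'' : Store}

theorem refl (M : List ℕ) (s : Store) : SameOff M s s := fun _ _ => rfl

theorem trans (h : SameOff M s s') (h' : SameOff M s' s'') : SameOff M s s'' :=
  fun k hk => (h' k hk).trans (h k hk)

theorem mono {M' : List ℕ} (h : SameOff M s s') (hM : M ⊆ M') : SameOff M' s s' :=
  fun k hk => h k fun hk' => hk (hM hk')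

theorem set (h : SameOff M s s') {k : ℕ} (hk : k ∈ M) (a : ℕ) (q : ℚ) :
    SameOff M s (s'.set k a q) := fun k' hk' => by
  rw [Store.set_of_ne _ _ _ (by rintro rfl; exact hk' hk), h k' hk']

end SameOff

namespace Exec

variable {B : ℕ} {s : Store} {Q : Store → Prop}

theorem assign (hB : 1 ≤ B) {k : ℕ} {e : Expr} (v : ℚ) (he : e.eval s = v) (hv : bitSize v ≤ B)
    (h : Q (s.set k 0 v)) : Exec B (.assign k e) s Q :=
  store hB (by simp [Expr.eval]) he hv h

theorem seq_assign (hB : 1 ≤ B) {k : ℕ} {e : Expr} {c : Program} (v : ℚ) (he : e.eval s = v)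
    (hv : bitSize v ≤ B) (h : Exec B c (s.set k 0 v) Q) : Exec B (.seq (.assign k e) c) s Q :=
  seq (assign hB v he hv h)

theorem seq_store (hB : 1 ≤ B) {k : ℕ} {i e : Expr} {c : Program} (a : ℕ) (v : ℚ)
    (hi : i.eval s = a) (he : e.eval s = v) (hv : bitSize v ≤ B)
    (h : Exec B c (s.set k a v) Q) : Exec B (.seq (.store k i e) c) s Q :=
  seq (store hB hi he hv h)

end Exec

/-! ### Enumerating the points by nearest neighbours -/

open BitRAM.Expr BitRAM.Program in
/-- Look at the point in variable 11 as the next point after the point in variable 10. -/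
def nearestStep : Program :=
  .seq (.ifLt (.load 3 (var 11)) (.const 1)
      (.ifLt (var 12) (var 0)
        (.ifLt (.load 1 (.add (.mul (.load 4 (var 10)) (var 0)) (var 11)))
            (.load 1 (.add (.mul (.load 4 (var 10)) (var 0)) (var 12)))
          (assign 12 (var 11)) .skip)
        (assign 12 (var 11)))
      .skip)
    (assign 11 (.add (var 11) (.const 1)))

open BitRAM.Expr BitRAM.Program in
/-- Put the unvisited point that is nearest to the current one into variable 12. -/
def findNearest : Program :=
  .seq (assign 11 (.const 0)) (.seq (assign 12 (var 0)) (.whileLt (var 11) (var 0) nearestStep))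

/-- The value `n` in variable 12 means that no candidate has been found yet. Memory layout from here
on: array 3 marks visited points, 4 holds the chain, 5 the cell lengths, 6 the places, 7 the
successive distances; variable 13 holds `δ`, 16 the top level and 18 the stretch factor. -/
theorem exec_findNearest {B n k c : ℕ} {s : Store} {used : ℕ → Prop} (hB : 1 ≤ B) (hnB : n ≤ B)
    (hn : bitSize n ≤ B) (h0 : s 0 0 = n) (hk : s 10 0 = k) (hc : s 4 k = c)
    (hused : ∀ y < n, s 3 y = 1 ∧ used y ∨ s 3 y = 0 ∧ ¬ used y) (hex : ∃ y < n, ¬ used y) :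
    Exec B findNearest s fun s' => SameOff [11, 12] s s' ∧ ∃ b < n, s' 12 0 = b ∧ ¬ used b ∧
      ∀ y < n, ¬ used y → s 1 (c * n + b) ≤ s 1 (c * n + y) := by
  have hsm : ∀ m ≤ n, bitSize (m : ℚ) ≤ B := fun m hm => bitSize_natCast_mono hm hn
  refine Exec.seq_assign hB ((0 : ℕ) : ℚ) (by simp [Expr.eval]) (hsm 0 (by omega)) ?_
  refine Exec.seq_assign hB (n : ℚ) (by simp [Expr.eval_var, Store.set_apply, h0]) hn ?_
  refine Exec.whileLt hB (fun m s' => SameOff [11, 12] s s' ∧ m ≤ n ∧ s' 11 0 = m ∧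
    (s' 12 0 = n ∧ (∀ y < m, used y) ∨ ∃ b < m, s' 12 0 = b ∧ ¬ used b ∧
      ∀ y < m, ¬ used y → s 1 (c * n + b) ≤ s 1 (c * n + y))) ?_ ?_ ?_
  · refine ⟨((SameOff.refl _ s).set (by simp) _ _).set (by simp) _ _, by omega, ?_, .inl ⟨?_, ?_⟩⟩
    · simp [Store.set_apply]
    · simp [Store.set_apply]
    · intro y hy
      omega
  · rintro m s' ⟨hfr, hm, h11, hinv⟩ hlt
    have f0 : s' 0 0 = n := by rw [hfr 0 (by simp), h0]
    have f10 : s' 10 0 = k := by rw [hfr 10 (by simp), hk]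
    have f4 : s' 4 k = c := by rw [hfr 4 (by simp), hc]
    rw [Expr.eval_var, Expr.eval_var, h11, f0] at hlt
    have hmn : m < n := by exact_mod_cast hlt
    have hx : ∀ b : ℕ, ∀ e : Expr, e.eval s' = b →
        (Expr.load 1 (.add (.mul (.load 4 (.var 10)) (.var 0)) e)).eval s' = s 1 (c * n + b) := by
      intro b e he
      rw [Expr.eval_load (a := c * n + b), hfr 1 (by simp)]
      simp only [Expr.eval, Expr.eval_var, he, f10, Nat.floor_natCast, f4, f0]
      push_cast
      rfl
    have hstep : ∀ s₁ : Store, SameOff [11, 12] s s₁ → s₁ 11 0 = m →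
        (s₁ 12 0 = n ∧ (∀ y < m + 1, used y) ∨ ∃ b < m + 1, s₁ 12 0 = b ∧ ¬ used b ∧
          ∀ y < m + 1, ¬ used y → s 1 (c * n + b) ≤ s 1 (c * n + y)) →
        Exec B (.assign 11 (.add (.var 11) (.const 1))) s₁ fun s' =>
          SameOff [11, 12] s s' ∧ m + 1 ≤ n ∧ s' 11 0 = (m + 1 : ℕ) ∧
          (s' 12 0 = n ∧ (∀ y < m + 1, used y) ∨ ∃ b < m + 1, s' 12 0 = b ∧ ¬ used b ∧
            ∀ y < m + 1, ¬ used y → s 1 (c * n + b) ≤ s 1 (c * n + y)) := by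
      intro s₁ g1 g2 g3
      refine Exec.assign hB ((m + 1 : ℕ) : ℚ) (by simp [Expr.eval, Expr.eval_var, g2])
        (hsm _ (by omega)) ⟨g1.set (by simp) _ _, hmn, by simp [Store.set_apply], ?_⟩
      simpa [Store.set_apply] using g3
    refine ⟨by omega, Exec.seq ?_⟩
    have e3 : (Expr.load 3 (.var 11)).eval s' = s 3 m := by
      rw [Expr.eval_load (a := m) 3 (by rw [Expr.eval_var, h11]), hfr 3 (by simp)]
    refine Exec.ifLt hB (fun hv => ?_) (fun hv => ?_)
    · rw [e3] at hv
      simp only [Expr.eval] at hv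
      have hun : ¬ used m := by
        rcases hused m hmn with h | h
        · rw [h.1] at hv
          exact absurd hv (lt_irrefl _)
        · exact h.2
      refine Exec.ifLt hB (fun hb => ?_) (fun hb => ?_)
      · rw [Expr.eval_var, Expr.eval_var, f0] at hb
        rcases hinv with ⟨g1, g2⟩ | ⟨b, hbm, g1, g2, g3⟩
        · rw [g1] at hb
          exact absurd hb (lt_irrefl _)
        refine Exec.ifLt hB (fun hd => ?_) (fun hd => ?_)
        · rw [hx m _ (by rw [Expr.eval_var, h11]), hx b _ (by rw [Expr.eval_var, g1])] at hd
          refine Exec.assign hB (m : ℚ) (by rw [Expr.eval_var, h11]) (hsm m hm) ?_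
          refine hstep _ (hfr.set (by simp) _ _) (by simp [Store.set_apply, h11])
            (.inr ⟨m, by omega, by simp [Store.set_apply], hun, fun y hy hyu => ?_⟩)
          rcases Nat.lt_succ_iff_lt_or_eq.1 hy with hlt' | rfl
          · exact hd.le.trans (g3 y hlt' hyu)
          · exact le_rfl
        · rw [hx b _ (by rw [Expr.eval_var, g1]), hx m _ (by rw [Expr.eval_var, h11])] at hd
          refine Exec.skip (hstep _ hfr h11 (.inr ⟨b, by omega, g1, g2, fun y hy hyu => ?_⟩))
          rcases Nat.lt_succ_iff_lt_or_eq.1 hy with hlt' | rfl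
          · exact g3 y hlt' hyu
          · exact hd
      · rw [Expr.eval_var, Expr.eval_var, f0] at hb
        rcases hinv with ⟨g1, g2⟩ | ⟨b, hbm, g1, g2, g3⟩
        · refine Exec.assign hB (m : ℚ) (by rw [Expr.eval_var, h11]) (hsm m hm) ?_
          refine hstep _ (hfr.set (by simp) _ _) (by simp [Store.set_apply, h11])
            (.inr ⟨m, by omega, by simp [Store.set_apply], hun, fun y hy hyu => ?_⟩)
          rcases Nat.lt_succ_iff_lt_or_eq.1 hy with hlt' | rfl
          · exact absurd (g2 y hlt') hyu
          · exact le_rfl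
        · rw [g1] at hb
          have : n ≤ b := by exact_mod_cast hb
          omega
    · rw [e3] at hv
      simp only [Expr.eval] at hv
      have hun : used m := by
        rcases hused m hmn with h | h
        · exact h.2
        · rw [h.1] at hv
          norm_num at hv
      refine Exec.skip (hstep _ hfr h11 ?_)
      rcases hinv with ⟨g1, g2⟩ | ⟨b, hbm, g1, g2, g3⟩
      · refine .inl ⟨g1, fun y hy => ?_⟩
        rcases Nat.lt_succ_iff_lt_or_eq.1 hy with hlt' | rfl
        exacts [g2 y hlt', hun]
      · refine .inr ⟨b, by omega, g1, g2, fun y hy hyu => ?_⟩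
        rcases Nat.lt_succ_iff_lt_or_eq.1 hy with hlt' | rfl
        exacts [g3 y hlt' hyu, absurd hun hyu]
  · rintro m s' ⟨hfr, hm, h11, hinv⟩ hle
    have f0 : s' 0 0 = n := by rw [hfr 0 (by simp), h0]
    rw [Expr.eval_var, Expr.eval_var, h11, f0] at hle
    have hmn : m = n := le_antisymm hm (by exact_mod_cast hle)
    subst hmn
    refine ⟨hfr, ?_⟩
    rcases hinv with ⟨g1, g2⟩ | ⟨b, hbm, g1, g2, g3⟩
    · obtain ⟨y, hy, hyu⟩ := hex
      exact absurd (g2 y hy) hyu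
    · exact ⟨b, hbm, g1, g2, g3⟩

open BitRAM.Expr BitRAM.Program in
/-- Enumerate the points in array 4, and put the distances of successive points into array 7. -/
def buildChain : Program :=
  .seq (.store 3 (.const 0) (.const 1)) <| .seq (assign 10 (.const 0)) <|
  .whileLt (.add (var 10) (.const 1)) (var 0) <|
    .seq findNearest <|
    .seq (.store 7 (var 10) (.load 1 (.add (.mul (.load 4 (var 10)) (var 0)) (var 12)))) <|
    .seq (.store 3 (var 12) (.const 1)) <|
    .seq (.store 4 (.add (var 10) (.const 1)) (var 12)) <|
    assign 10 (.add (var 10) (.const 1))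

theorem exec_buildChain {B n : ℕ} {s : Store} (hB : 4 ≤ B) (hnB : n ≤ B)
    (hn : bitSize n ≤ B) (h2 : 2 ≤ n) (h0 : s 0 0 = n) (h3 : ∀ a, s 3 a = 0) (h4 : s 4 0 = 0)
    (h1 : ∀ a, bitSize (s 1 a) ≤ B) :
    Exec B buildChain s fun s' => SameOff [3, 4, 7, 10, 11, 12] s s' ∧ ∃ x : ℕ → ℕ,
      (∀ k < n, x k < n ∧ s' 4 k = x k) ∧ (∀ k < n, ∀ l < n, x k = x l → k = l) ∧
      (∀ k, k + 1 < n → s' 7 k = s 1 (x k * n + x (k + 1))) ∧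
      ∀ k l, k < l → l < n → s 1 (x k * n + x (k + 1)) ≤ s 1 (x k * n + x l) := by
  have hB1 : 1 ≤ B := by omega
  have hsm : ∀ m ≤ n, bitSize (m : ℚ) ≤ B := fun m hm => bitSize_natCast_mono hm hn
  have hone : bitSize 1 ≤ B := by exact_mod_cast hsm 1 (by omega)
  refine Exec.seq_store hB1 0 1 (by simp [Expr.eval]) (by simp [Expr.eval]) hone ?_
  refine Exec.seq_assign hB1 ((0 : ℕ) : ℚ) (by simp [Expr.eval]) (hsm 0 (by omega)) ?_
  refine Exec.whileLt hB1 (fun k s' => SameOff [3, 4, 7, 10, 11, 12] s s' ∧ k < n ∧ s' 10 0 = k ∧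
    ∃ x : ℕ → ℕ, (∀ m ≤ k, x m < n ∧ s' 4 m = x m) ∧
      (∀ y < n, s' 3 y = 1 ∧ (∃ m ≤ k, x m = y) ∨ s' 3 y = 0 ∧ ¬ ∃ m ≤ k, x m = y) ∧
      (∀ l ≤ k, ∀ m ≤ k, x l = x m → l = m) ∧
      (∀ m < k, s' 7 m = s 1 (x m * n + x (m + 1))) ∧
      ∀ m < k, ∀ y < n, (¬ ∃ l ≤ m, x l = y) → s 1 (x m * n + x (m + 1)) ≤ s 1 (x m * n + y))
    ?_ ?_ ?_
  · refine ⟨((SameOff.refl _ s).set (by simp) _ _).set (by simp) _ _, by omega,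
      by simp [Store.set_apply], fun _ => 0, ?_, ?_, ?_, ?_, ?_⟩
    · intro m hm
      obtain rfl : m = 0 := by omega
      exact ⟨show 0 < n by omega, by simp [Store.set_apply, h4]⟩
    · intro y _
      rcases eq_or_ne y 0 with rfl | hy
      · exact .inl ⟨by simp [Store.set_apply], 0, le_rfl, rfl⟩
      · exact .inr ⟨by simp [Store.set_apply, h3, hy], fun ⟨_, _, h⟩ => hy h.symm⟩
    · intro l hl m hm _
      omega
    · intro m hm
      omega
    · intro m hm
      omega
  · rintro k s' ⟨hfr, hk, h10, x, hx, hvis, hinj, hdist, hnear⟩ hlt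
    have f0 : s' 0 0 = n := by rw [hfr 0 (by simp), h0]
    simp only [Expr.eval, Expr.eval_var, h10, f0] at hlt
    have hkn : k + 1 < n := by exact_mod_cast hlt
    refine ⟨by omega, Exec.seq ?_⟩
    -- Pigeonhole: only `k + 1 < n` points have been visited.
    have hex : ∃ y < n, ¬ ∃ m ≤ k, x m = y := by
      by_contra hcon
      push Not at hcon
      have hsub : Finset.range n ⊆ (Finset.range (k + 1)).image x := by
        intro y hy
        obtain ⟨m, hm, rfl⟩ := hcon y (Finset.mem_range.1 hy)
        exact Finset.mem_image_of_mem _ (Finset.mem_range.2 (by omega))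
      have := (Finset.card_le_card hsub).trans Finset.card_image_le
      simp at this
      omega
    refine (exec_findNearest hB1 hnB hn f0 h10 (hx k le_rfl).2 hvis hex).mono ?_
    rintro s₁ ⟨hfr₁, b, hb, h12, hbu, hbmin⟩
    rw [hfr 1 (by simp)] at hbmin
    have hfr₁' : SameOff [3, 4, 7, 10, 11, 12] s s₁ := hfr.trans (hfr₁.mono (by simp))
    have g0 : s₁ 0 0 = n := by rw [hfr₁' 0 (by simp), h0]
    have g10 : s₁ 10 0 = k := by rw [hfr₁ 10 (by simp), h10]
    have g4 : s₁ 4 = s' 4 := hfr₁ 4 (by simp)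
    have g3 : s₁ 3 = s' 3 := hfr₁ 3 (by simp)
    have g7 : s₁ 7 = s' 7 := hfr₁ 7 (by simp)
    refine Exec.seq_store hB1 k (s 1 (x k * n + b)) (by rw [Expr.eval_var, g10]) ?_ (h1 _) ?_
    · rw [Expr.eval_load (a := x k * n + b), hfr₁' 1 (by simp)]
      simp only [Expr.eval, Expr.eval_var, g10, Nat.floor_natCast, g4, (hx k le_rfl).2, g0, h12]
      push_cast
      rfl
    refine Exec.seq_store hB1 b 1 (by simp [Expr.eval_var, Store.set_apply, h12])
      (by simp [Expr.eval]) hone ?_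
    refine Exec.seq_store hB1 (k + 1) b
      (by simp [Expr.eval, Expr.eval_var, Store.set_apply, g10])
      (by simp [Expr.eval_var, Store.set_apply, h12]) (hsm b hb.le) ?_
    refine Exec.assign hB1 ((k + 1 : ℕ) : ℚ)
      (by simp [Expr.eval, Expr.eval_var, Store.set_apply, g10]) (hsm _ hkn.le) ?_
    have hne : ∀ m ≤ k, m ≠ k + 1 := fun m hm => by omega
    refine ⟨(((hfr₁'.set (by simp) _ _).set (by simp) _ _).set (by simp) _ _).set (by simp) _ _,
      hkn, by simp [Store.set_apply], Function.update x (k + 1) b, ?_, ?_, ?_, ?_, ?_⟩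
    · intro m hm
      rcases eq_or_ne m (k + 1) with rfl | hmk
      · simp [Store.set_apply, hb]
      · simp [Store.set_apply, hmk, g4, hx m (by omega)]
    · intro y hy
      rcases eq_or_ne y b with rfl | hyb
      · exact .inl ⟨by simp [Store.set_apply], k + 1, le_rfl, by simp⟩
      · have hiff : (∃ m ≤ k + 1, Function.update x (k + 1) b m = y) ↔ ∃ m ≤ k, x m = y := by
          constructor
          · rintro ⟨m, hm, hmy⟩
            rcases eq_or_ne m (k + 1) with rfl | hmk
            · exact absurd (by simpa using hmy.symm) hyb
            · exact ⟨m, by omega, by simpa [hmk] using hmy⟩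
          · rintro ⟨m, hm, hmy⟩
            exact ⟨m, by omega, by simpa [hne m hm] using hmy⟩
        rw [hiff]
        simpa [Store.set_apply, hyb, g3] using hvis y hy
    · intro l hl m hm hlm
      rcases eq_or_ne l (k + 1) with rfl | hlk <;> rcases eq_or_ne m (k + 1) with rfl | hmk
      · rfl
      · exact absurd ⟨m, by omega, by simpa [hmk] using hlm.symm⟩ hbu
      · exact absurd ⟨l, by omega, by simpa [hlk] using hlm⟩ hbu
      · exact hinj l (by omega) m (by omega) (by simpa [hlk, hmk] using hlm)
    · intro m hm
      rcases eq_or_ne m k with rfl | hmk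
      · simp [Store.set_apply]
      · have hm1 : m < k := by omega
        simp [Store.set_apply, hmk, hne m hm1.le, g7, hdist m hm1]
    · intro m hm y hy hyu
      have hyu' : ¬ ∃ l ≤ m, x l = y := by
        rintro ⟨l, hl, hly⟩
        exact hyu ⟨l, hl, by simpa [hne l (by omega)] using hly⟩
      rcases eq_or_ne m k with rfl | hmk
      · simpa using hbmin y hy hyu'
      · have hm1 : m < k := by omega
        simpa [hmk, hne m hm1.le] using hnear m hm1 y hy hyu'
  · rintro k s' ⟨hfr, hk, h10, x, hx, hvis, hinj, hdist, hnear⟩ hle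
    have f0 : s' 0 0 = n := by rw [hfr 0 (by simp), h0]
    simp only [Expr.eval, Expr.eval_var, h10, f0] at hle
    have hkn : n ≤ k + 1 := by exact_mod_cast hle
    refine ⟨hfr, x, fun m hm => hx m (by omega), fun l hl m hm => hinj l (by omega) m (by omega),
      fun m hm => hdist m (by omega), fun l m hlm hm => ?_⟩
    -- By injectivity, a later point of the chain was still unvisited when the successor of `x l`
    -- was chosen.
    refine hnear l (by omega) (x m) (hx m (by omega)).1 ?_
    rintro ⟨j, hj, hjm⟩
    have := hinj j (by omega) m (by omega) hjm
    omega

end BitRAM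

namespace BitRAM

theorem floor_natCast_div (a b : ℕ) : ((⌊(a : ℚ) / b⌋ : ℤ) : ℚ) = ((a / b : ℕ) : ℚ) := by
  rw [Rat.floor_natCast_div_natCast]
  norm_cast

/-! ### Orders of magnitude of the distances -/

open BitRAM.Expr BitRAM.Program in
/-- Put the least entry of array 7 into variable 13. -/
def findUnit : Program :=
  .seq (assign 13 (.load 7 (.const 0))) <| .seq (assign 10 (.const 0)) <|
  .whileLt (.add (var 10) (.const 1)) (var 0) <|
    .seq (.ifLt (.load 7 (var 10)) (var 13) (assign 13 (.load 7 (var 10))) .skip) <|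
    assign 10 (.add (var 10) (.const 1))

theorem exec_findUnit {B n : ℕ} {s : Store} {e : ℕ → ℚ} (hB : 1 ≤ B) (hnB : n ≤ B)
    (hn : bitSize n ≤ B) (h2 : 2 ≤ n) (h0 : s 0 0 = n) (h7 : ∀ k, k + 1 < n → s 7 k = e k)
    (he : ∀ k, k + 1 < n → bitSize (e k) ≤ B) :
    Exec B findUnit s fun s' => SameOff [10, 13] s s' ∧ ∃ k₀, k₀ + 1 < n ∧ s' 13 0 = e k₀ ∧
      ∀ k, k + 1 < n → e k₀ ≤ e k := by
  have hsm : ∀ m ≤ n, bitSize (m : ℚ) ≤ B := fun m hm => bitSize_natCast_mono hm hn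
  refine Exec.seq_assign hB (e 0) (by simp [Expr.eval, h7 0 (by omega)]) (he 0 (by omega)) ?_
  refine Exec.seq_assign hB ((0 : ℕ) : ℚ) (by simp [Expr.eval]) (hsm 0 (by omega)) ?_
  refine Exec.whileLt hB (fun k s' => SameOff [10, 13] s s' ∧ k < n ∧ s' 10 0 = k ∧
    ∃ k₀, k₀ + 1 < n ∧ s' 13 0 = e k₀ ∧ ∀ l < k, e k₀ ≤ e l) ?_ ?_ ?_
  · exact ⟨((SameOff.refl _ s).set (by simp) _ _).set (by simp) _ _, by omega,
      by simp [Store.set_apply], 0, by omega, by simp [Store.set_apply], by simp⟩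
  · rintro k s' ⟨hfr, hk, h10, k₀, hk₀, h13, hmin⟩ hlt
    have f0 : s' 0 0 = n := by rw [hfr 0 (by simp), h0]
    simp only [Expr.eval, Expr.eval_var, h10, f0] at hlt
    have hkn : k + 1 < n := by exact_mod_cast hlt
    have e7 : (Expr.load 7 (.var 10)).eval s' = e k := by
      rw [Expr.eval_load (a := k) 7 (by rw [Expr.eval_var, h10]), hfr 7 (by simp), h7 k hkn]
    refine ⟨by omega, Exec.seq (Exec.ifLt hB (fun hlt' => ?_) (fun hle => ?_))⟩
    · rw [e7, Expr.eval_var, h13] at hlt'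
      refine Exec.assign hB (e k) e7 (he k hkn) ?_
      refine Exec.assign hB ((k + 1 : ℕ) : ℚ)
        (by simp [Expr.eval, Expr.eval_var, Store.set_apply, h10]) (hsm _ hkn.le) ?_
      refine ⟨(hfr.set (by simp) _ _).set (by simp) _ _, hkn, by simp [Store.set_apply], k, hkn,
        by simp [Store.set_apply], fun l hl => ?_⟩
      rcases Nat.lt_succ_iff_lt_or_eq.1 hl with h | rfl
      exacts [hlt'.le.trans (hmin l h), le_rfl]
    · rw [e7, Expr.eval_var, h13] at hle
      refine Exec.skip (Exec.assign hB ((k + 1 : ℕ) : ℚ)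
        (by simp [Expr.eval, Expr.eval_var, h10]) (hsm _ hkn.le) ?_)
      refine ⟨hfr.set (by simp) _ _, hkn, by simp [Store.set_apply], k₀, hk₀,
        by simp [Store.set_apply, h13], fun l hl => ?_⟩
      rcases Nat.lt_succ_iff_lt_or_eq.1 hl with h | rfl
      exacts [hmin l h, hle]
  · rintro k s' ⟨hfr, hk, h10, k₀, hk₀, h13, hmin⟩ hle
    have f0 : s' 0 0 = n := by rw [hfr 0 (by simp), h0]
    simp only [Expr.eval, Expr.eval_var, h10, f0] at hle
    have hkn : n ≤ k + 1 := by exact_mod_cast hle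
    exact ⟨hfr, k₀, hk₀, h13, fun l hl => hmin l (by omega)⟩

open BitRAM.Expr BitRAM.Program in
/-- Compute the order of magnitude of the current entry of array 7. -/
def findLevel (β : ℕ) : Program :=
  .seq (assign 14 (.const 1)) <| .seq (assign 15 (.mul (.const 2) (var 13))) <|
  .seq (assign 17 (.const 1)) <|
  .whileLt (var 15) (.load 7 (var 10)) <|
    .seq (assign 14 (.mul (var 14) (.const β))) <|
    .seq (assign 15 (.mul (.const 2) (var 15))) <|
    assign 17 (.add (var 17) (.const 1))

/-- The unit is doubled until it reaches `e`; the bound `heW` stops the loop. The power `β ^ (i -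
1)` is built up alongside, so later programs need neither logarithms nor exponentiation. -/
theorem exec_findLevel {B β W Z k : ℕ} {s : Store} {δ e : ℚ} (hB : 1 ≤ B) (hWB : W ≤ B)
    (hZ : bitSize Z ≤ B) (hβ : 1 ≤ β) (hW1 : 1 ≤ W) (hWZ : W ≤ Z) (hβZ : β ^ W ≤ Z)
    (hδ : 0 < δ) (h13 : s 13 0 = δ) (h10 : s 10 0 = k) (h7 : s 7 k = e) (hδe : δ ≤ e)
    (heW : e ≤ 2 ^ W * δ) (hpow : ∀ j ≤ W, bitSize (2 ^ j * δ) ≤ B) :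
    Exec B (findLevel β) s fun s' => SameOff [14, 15, 17] s s' ∧ ∃ i, 1 ≤ i ∧ i ≤ W ∧
      s' 17 0 = i ∧ s' 14 0 = (β ^ (i - 1) : ℕ) ∧ 2 ^ (i - 1) * δ ≤ e ∧ e ≤ 2 ^ i * δ := by
  have hsm : ∀ m ≤ Z, bitSize (m : ℚ) ≤ B := fun m hm => bitSize_natCast_mono hm hZ
  refine Exec.seq_assign hB ((1 : ℕ) : ℚ) (by simp [Expr.eval]) (hsm 1 (by omega)) ?_
  refine Exec.seq_assign hB (2 ^ 1 * δ)
    (by simp [Expr.eval, Expr.eval_var, Store.set_apply, h13]) (hpow 1 hW1) ?_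
  refine Exec.seq_assign hB ((1 : ℕ) : ℚ) (by simp [Expr.eval]) (hsm 1 (by omega)) ?_
  refine Exec.whileLt hB (fun m s' => SameOff [14, 15, 17] s s' ∧ m + 1 ≤ W ∧
    s' 17 0 = (m + 1 : ℕ) ∧ s' 14 0 = (β ^ m : ℕ) ∧ s' 15 0 = 2 ^ (m + 1) * δ ∧
    2 ^ m * δ ≤ e) ?_ ?_ ?_
  · refine ⟨(((SameOff.refl _ s).set (by simp) _ _).set (by simp) _ _).set (by simp) _ _, by omega,
      ?_, ?_, ?_, by simpa using hδe⟩ <;> simp [Store.set_apply]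
  · rintro m s' ⟨hfr, hm, h17, h14, h15, hle⟩ hlt
    have f7 : (Expr.load 7 (.var 10)).eval s' = e := by
      rw [Expr.eval_load (a := k) 7 (by rw [Expr.eval_var, hfr 10 (by simp), h10]),
        hfr 7 (by simp), h7]
    rw [f7, Expr.eval_var, h15] at hlt
    have hmW : m + 1 < W := by
      by_contra hcon
      have : (2 : ℚ) ^ W ≤ 2 ^ (m + 1) := pow_le_pow_right₀ one_le_two (by omega)
      have := mul_le_mul_of_nonneg_right this hδ.le
      linarith
    refine ⟨by omega, ?_⟩
    refine Exec.seq_assign hB ((β ^ (m + 1) : ℕ) : ℚ)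
      (by simp [Expr.eval, Expr.eval_var, h14, pow_succ])
      (hsm _ ((Nat.pow_le_pow_right hβ hm).trans hβZ)) ?_
    refine Exec.seq_assign hB (2 ^ (m + 1 + 1) * δ) ?_ (hpow _ hmW) ?_
    · simp only [Expr.eval, Expr.eval_var, Store.set_apply]
      simp [h15]
      ring
    refine Exec.assign hB ((m + 1 + 1 : ℕ) : ℚ) ?_ (hsm _ (by omega)) ?_
    · simp [Expr.eval, Expr.eval_var, Store.set_apply, h17]
    exact ⟨((hfr.set (by simp) _ _).set (by simp) _ _).set (by simp) _ _, hmW,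
      by simp [Store.set_apply], by simp [Store.set_apply], by simp [Store.set_apply], hlt.le⟩
  · rintro m s' ⟨hfr, hm, h17, h14, h15, hle⟩ hge
    have f7 : (Expr.load 7 (.var 10)).eval s' = e := by
      rw [Expr.eval_load (a := k) 7 (by rw [Expr.eval_var, hfr 10 (by simp), h10]),
        hfr 7 (by simp), h7]
    rw [f7, Expr.eval_var, h15] at hge
    exact ⟨hfr, m + 1, by omega, hm, h17, h14, hle, hge⟩

open BitRAM.Expr BitRAM.Program in
/-- Compute the orders of magnitude of the entries of array 7. -/
def findLevels (β : ℕ) : Program :=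
  .seq (assign 16 (.const 0)) <| .seq (assign 10 (.const 0)) <|
  .whileLt (.add (var 10) (.const 1)) (var 0) <|
    .seq (findLevel β) <|
    .seq (.store 5 (var 10) (var 14)) <|
    .seq (.ifLt (var 16) (var 17) (assign 16 (var 17)) .skip) <|
    assign 10 (.add (var 10) (.const 1))

theorem exec_findLevels {B n β W Z : ℕ} {s : Store} {δ : ℚ} {e : ℕ → ℚ} (hB : 1 ≤ B)
    (hnB : n ≤ B) (hWB : W ≤ B) (hZ : bitSize Z ≤ B) (hnZ : n ≤ Z) (h2 : 2 ≤ n) (hβ : 1 ≤ β)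
    (hW1 : 1 ≤ W) (hWZ : W ≤ Z) (hβZ : β ^ W ≤ Z) (hδ : 0 < δ) (h0 : s 0 0 = n)
    (h13 : s 13 0 = δ) (h7 : ∀ k, k + 1 < n → s 7 k = e k) (hδe : ∀ k, k + 1 < n → δ ≤ e k)
    (heW : ∀ k, k + 1 < n → e k ≤ 2 ^ W * δ) (hpow : ∀ j ≤ W, bitSize (2 ^ j * δ) ≤ B) :
    Exec B (findLevels β) s fun s' => SameOff [5, 10, 14, 15, 16, 17] s s' ∧
      ∃ (i : ℕ → ℕ) (h : ℕ), s' 16 0 = h ∧ (∃ k, k + 1 < n ∧ i k = h) ∧ h ≤ W ∧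
      ∀ k, k + 1 < n → 1 ≤ i k ∧ i k ≤ h ∧ s' 5 k = (β ^ (i k - 1) : ℕ) ∧
        2 ^ (i k - 1) * δ ≤ e k ∧ e k ≤ 2 ^ i k * δ := by
  have hsm : ∀ m ≤ Z, bitSize (m : ℚ) ≤ B := fun m hm => bitSize_natCast_mono hm hZ
  refine Exec.seq_assign hB ((0 : ℕ) : ℚ) (by simp [Expr.eval]) (hsm 0 (by omega)) ?_
  refine Exec.seq_assign hB ((0 : ℕ) : ℚ) (by simp [Expr.eval]) (hsm 0 (by omega)) ?_
  -- Before the first round the maximum of the levels is over the empty set and has the default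
  -- value 0.
  refine Exec.whileLt hB (fun k s' => SameOff [5, 10, 14, 15, 16, 17] s s' ∧ k < n ∧ s' 10 0 = k ∧
    ∃ (i : ℕ → ℕ) (h : ℕ), s' 16 0 = h ∧ (k = 0 ∧ h = 0 ∨ ∃ l < k, i l = h) ∧ h ≤ W ∧
      ∀ l < k, 1 ≤ i l ∧ i l ≤ h ∧ s' 5 l = (β ^ (i l - 1) : ℕ) ∧
        2 ^ (i l - 1) * δ ≤ e l ∧ e l ≤ 2 ^ i l * δ) ?_ ?_ ?_
  · exact ⟨((SameOff.refl _ s).set (by simp) _ _).set (by simp) _ _, by omega,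
      by simp [Store.set_apply], fun _ => 0, 0, by simp [Store.set_apply], .inl ⟨rfl, rfl⟩,
      by omega, by simp⟩
  · rintro k s' ⟨hfr, hk, h10, i, h, h16, htop, hhW, hlev⟩ hlt
    have f0 : s' 0 0 = n := by rw [hfr 0 (by simp), h0]
    simp only [Expr.eval, Expr.eval_var, h10, f0] at hlt
    have hkn : k + 1 < n := by exact_mod_cast hlt
    refine ⟨by omega, Exec.seq ?_⟩
    refine (exec_findLevel hB hWB hZ hβ hW1 hWZ hβZ hδ (by rw [hfr 13 (by simp), h13]) h10
      (by rw [hfr 7 (by simp), h7 k hkn]) (hδe k hkn) (heW k hkn) hpow).mono ?_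
    rintro s₁ ⟨hfr₁, ik, g1, g2, g17, g14, g3, g4⟩
    have hfr₁' : SameOff [5, 10, 14, 15, 16, 17] s s₁ := hfr.trans (hfr₁.mono (by simp))
    have g10 : s₁ 10 0 = k := by rw [hfr₁ 10 (by simp), h10]
    have g16 : s₁ 16 0 = h := by rw [hfr₁ 16 (by simp), h16]
    have g5 : s₁ 5 = s' 5 := hfr₁ 5 (by simp)
    have hikZ : β ^ (ik - 1) ≤ Z := (Nat.pow_le_pow_right hβ (by omega)).trans hβZ
    refine Exec.seq_store hB k ((β ^ (ik - 1) : ℕ) : ℚ) (by rw [Expr.eval_var, g10])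
      (by rw [Expr.eval_var, g14]) (hsm _ hikZ) ?_
    have hfin : ∀ s₂ h', SameOff [5, 10, 14, 15, 16, 17] s s₂ → s₂ 10 0 = k → s₂ 16 0 = (h' : ℕ) →
        s₂ 5 = (s₁.set 5 k ((β ^ (ik - 1) : ℕ) : ℚ)) 5 → h' = max h ik →
        Exec B (.assign 10 (.add (.var 10) (.const 1))) s₂ fun s' =>
          SameOff [5, 10, 14, 15, 16, 17] s s' ∧ k + 1 < n ∧ s' 10 0 = (k + 1 : ℕ) ∧
          ∃ (i : ℕ → ℕ) (h : ℕ), s' 16 0 = h ∧ (k + 1 = 0 ∧ h = 0 ∨ ∃ l < k + 1, i l = h) ∧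
          h ≤ W ∧ ∀ l < k + 1, 1 ≤ i l ∧ i l ≤ h ∧ s' 5 l = (β ^ (i l - 1) : ℕ) ∧
          2 ^ (i l - 1) * δ ≤ e l ∧ e l ≤ 2 ^ i l * δ := by
      intro s₂ h' e1 e2 e3 e4 e5
      refine Exec.assign hB ((k + 1 : ℕ) : ℚ) (by simp [Expr.eval, Expr.eval_var, e2])
        (hsm _ (by omega)) ?_
      refine ⟨e1.set (by simp) _ _, hkn, by simp [Store.set_apply], Function.update i k ik, h',
        by simp [Store.set_apply, e3], .inr ?_, by omega, fun l hl => ?_⟩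
      · rcases le_total h ik with hle | hle
        · exact ⟨k, by omega, by simp [e5, hle]⟩
        · rcases htop with ⟨_, rfl⟩ | ⟨l, hl, rfl⟩
          · omega
          · exact ⟨l, by omega, by simp [hl.ne, e5, hle]⟩
      · rcases Nat.lt_succ_iff_lt_or_eq.1 hl with hlk | rfl
        · obtain ⟨c1, c2, c3, c4⟩ := hlev l hlk
          simp only [Function.update_of_ne hlk.ne]
          refine ⟨c1, by omega, ?_, c4⟩
          simp only [Store.set_apply, e4, g5, hlk.ne, and_false, if_false]
          simpa using c3
        · simp only [Function.update_self]
          refine ⟨g1, by omega, ?_, g3, g4⟩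
          simp [Store.set_apply, e4]
    have hfr₂ : SameOff [5, 10, 14, 15, 16, 17] s (s₁.set 5 k ((β ^ (ik - 1) : ℕ) : ℚ)) :=
      hfr₁'.set (by simp) _ _
    refine Exec.seq (Exec.ifLt hB (fun hlt' => ?_) (fun hle => ?_))
    · simp only [Expr.eval_var, Store.set_of_ne _ _ _ (show 16 ≠ 5 by simp),
        Store.set_of_ne _ _ _ (show 17 ≠ 5 by simp), g16, g17] at hlt'
      have : h < ik := by exact_mod_cast hlt'
      refine Exec.assign hB (ik : ℚ) (by simp [Expr.eval_var, Store.set_apply, g17])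
        (hsm _ (by omega)) (hfin _ ik (hfr₂.set (by simp) _ _) (by simp [Store.set_apply, g10])
          (by simp [Store.set_apply]) (Store.set_of_ne _ _ _ (by simp)) (by omega))
    · simp only [Expr.eval_var, Store.set_of_ne _ _ _ (show 16 ≠ 5 by simp),
        Store.set_of_ne _ _ _ (show 17 ≠ 5 by simp), g16, g17] at hle
      have : ik ≤ h := by exact_mod_cast hle
      exact Exec.skip (hfin _ h hfr₂ (by simp [Store.set_apply, g10])
        (by simp [Store.set_apply, g16]) rfl (by omega))
  · rintro k s' ⟨hfr, hk, h10, i, h, h16, htop, hhW, hlev⟩ hle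
    have f0 : s' 0 0 = n := by rw [hfr 0 (by simp), h0]
    simp only [Expr.eval, Expr.eval_var, h10, f0] at hle
    have hkn : n ≤ k + 1 := by exact_mod_cast hle
    refine ⟨hfr, i, h, h16, ?_, hhW, fun l hl => hlev l (by omega)⟩
    rcases htop with ⟨rfl, _⟩ | ⟨l, hl, h⟩
    · omega
    · exact ⟨l, by omega, h⟩

end BitRAM

namespace BitRAM

/-! ### The stretch factor -/

open BitRAM.Expr BitRAM.Program in
/-- Enlarge the stretch factor in variable 18 for the sake of one stretch of points. -/
def enlargeStretch (β : ℕ) : Program :=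
  .whileLt (.mul (var 18) (var 20)) (.mul (.mul (.const 4) (var 16)) (var 19)) <|
    assign 18 (.mul (var 18) (.const β))

open NearestChain in
-- As `M` is the longest cell of the stretch, a true guard shows that no step of the stretch
-- satisfies the condition of `Spacious`, so the exponent is raised only when it has to be and stays
-- minimal. A true guard also forces `(2 ^ d) ^ (p + m) < 4 * h * n`, which bounds both the number
-- of rounds and the size of the factor.
theorem exec_enlargeStretch {B d n h Z k l p : ℕ} {i : ℕ → ℕ} {s : Store} {M : ℕ} (hd : 1 ≤ d)
    (hB : 1 ≤ B) (hZ : bitSize Z ≤ B) (hBn : 4 * h * n ≤ B) (hZn : 2 ^ d * (4 * h * n) ≤ Z)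
    (h18 : s 18 0 = ((2 ^ d) ^ p : ℕ)) (h20 : s 20 0 = M) (h16 : s 16 0 = h)
    (h19 : s 19 0 = (∑ m ∈ Finset.Ico k l, (2 ^ d) ^ (i m - 1) : ℕ)) (hkl : k < l) (hl : l < n)
    (hMmax : ∀ m, k ≤ m → m < l → (2 ^ d) ^ (i m - 1) ≤ M)
    (hMmem : ∃ m, k ≤ m ∧ m < l ∧ M = (2 ^ d) ^ (i m - 1))
    (hp : ∀ q, p = q + 1 → ¬ Spacious d h q n i) :
    Exec B (enlargeStretch (2 ^ d)) s fun s' => SameOff [18] s s' ∧ ∃ p', p ≤ p' ∧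
      s' 18 0 = ((2 ^ d) ^ p' : ℕ) ∧ (∀ q, p' = q + 1 → ¬ Spacious d h q n i) ∧
      4 * h * ∑ m ∈ Finset.Ico k l, (2 ^ d) ^ (i m - 1) ≤ (2 ^ d) ^ p' * M := by
  have hguard : ∀ s' p', SameOff [18] s s' → s' 18 0 = ((2 ^ d) ^ p' : ℕ) →
      (Expr.mul (.var 18) (.var 20)).eval s' = ((2 ^ d) ^ p' * M : ℕ) ∧
      (Expr.mul (.mul (.const 4) (.var 16)) (.var 19)).eval s' =
        (4 * h * ∑ m ∈ Finset.Ico k l, (2 ^ d) ^ (i m - 1) : ℕ) := by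
    intro s' p' hfr h18'
    simp only [Expr.eval, Expr.eval_var, h18', hfr 20 (by simp), hfr 16 (by simp),
      hfr 19 (by simp), h20, h16, h19]
    push_cast
    exact ⟨rfl, rfl⟩
  refine Exec.whileLt hB (fun m s' => SameOff [18] s s' ∧ s' 18 0 = ((2 ^ d) ^ (p + m) : ℕ) ∧
    ∀ q, p + m = q + 1 → ¬ Spacious d h q n i) ?_ ?_ ?_
  · exact ⟨SameOff.refl _ s, h18, hp⟩
  · rintro m s' ⟨hfr, h18', hp'⟩ hlt
    obtain ⟨e1, e2⟩ := hguard s' _ hfr h18'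
    rw [e1, e2] at hlt
    have hlt' : (2 ^ d) ^ (p + m) * M < 4 * h * ∑ m ∈ Finset.Ico k l, (2 ^ d) ^ (i m - 1) := by
      exact_mod_cast hlt
    have hM : 0 < M := by
      obtain ⟨m, _, _, rfl⟩ := hMmem
      positivity
    have hsum : ∑ m ∈ Finset.Ico k l, (2 ^ d) ^ (i m - 1) ≤ n * M := by
      refine (Finset.sum_le_card_nsmul _ _ M fun m hm => ?_).trans ?_
      · rw [Finset.mem_Ico] at hm
        exact hMmax m hm.1 hm.2
      · rw [Nat.card_Ico, smul_eq_mul]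
        exact Nat.mul_le_mul_right _ (by omega)
    have hβp : (2 ^ d) ^ (p + m) < 4 * h * n := by
      refine Nat.lt_of_mul_lt_mul_right (a := M) (hlt'.trans_le ?_)
      rw [mul_assoc (4 * h)]
      exact Nat.mul_le_mul_left _ hsum
    have hpm : p + m < (2 ^ d) ^ (p + m) := Nat.lt_pow_self (Nat.one_lt_two_pow (by omega))
    refine ⟨by omega, Exec.assign hB (((2 ^ d) ^ (p + (m + 1)) : ℕ) : ℚ) ?_ ?_ ?_⟩
    · simp only [Expr.eval, Expr.eval_var, h18']
      push_cast
      ring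
    · refine bitSize_natCast_mono (le_trans ?_ hZn) hZ
      rw [← add_assoc, pow_succ']
      exact Nat.mul_le_mul_left _ hβp.le
    · refine ⟨hfr.set (by simp) _ _, by simp [Store.set_apply], fun q hq hsp => ?_⟩
      obtain rfl : q = p + m := by omega
      obtain ⟨m', c1, c2, c3⟩ := hsp k l hkl hl
      exact absurd (c3.trans (Nat.mul_le_mul_left _ (hMmax m' c1 c2))) (not_le.2 hlt')
  · rintro m s' ⟨hfr, h18', hp'⟩ hle
    obtain ⟨e1, e2⟩ := hguard s' _ hfr h18'
    rw [e1, e2] at hle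
    exact ⟨hfr, p + m, by omega, h18', hp', by exact_mod_cast hle⟩

open BitRAM.Expr BitRAM.Program in
/-- Enlarge the stretch factor in variable 18 for the sake of the stretches of points that begin
with the point in variable 10. -/
def enlargeStretchFrom (β : ℕ) : Program :=
  .seq (assign 19 (.const 0)) <| .seq (assign 20 (.const 0)) <| .seq (assign 11 (var 10)) <|
  .whileLt (.add (var 11) (.const 1)) (var 0) <|
    .seq (assign 19 (.add (var 19) (.load 5 (var 11)))) <|
    .seq (.ifLt (var 20) (.load 5 (var 11)) (assign 20 (.load 5 (var 11))) .skip) <|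
    .seq (enlargeStretch β) <|
    assign 11 (.add (var 11) (.const 1))

/-- The stretch factor `(2 ^ d) ^ p` is enough for the stretch of the points from `k` to `l`. -/
def StretchFits (d h p : ℕ) (i : ℕ → ℕ) (k l : ℕ) : Prop := ∃ m, k ≤ m ∧ m < l ∧
  4 * h * ∑ m ∈ Finset.Ico k l, (2 ^ d) ^ (i m - 1) ≤ (2 ^ d) ^ p * (2 ^ d) ^ (i m - 1)

theorem StretchFits.mono {d h p p' k l : ℕ} {i : ℕ → ℕ} (hpp : p ≤ p')
    (hf : StretchFits d h p i k l) : StretchFits d h p' i k l := by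
  obtain ⟨m, h1, h2, h3⟩ := hf
  exact ⟨m, h1, h2, h3.trans (Nat.mul_le_mul_right _ (Nat.pow_le_pow_right (by positivity) hpp))⟩

open NearestChain in
-- The sum and the maximum of the cell lengths are updated as the stretch grows. Stretches dealt
-- with earlier keep fitting, because the exponent never decreases.
theorem exec_enlargeStretchFrom {B d n h Z k p : ℕ} {i : ℕ → ℕ} {s : Store} (hd : 1 ≤ d)
    (hB : 1 ≤ B) (hZ : bitSize Z ≤ B) (hnB : n ≤ B) (hnZ : n ≤ Z) (hBn : 4 * h * n ≤ B)
    (hZn : 2 ^ d * (4 * h * n) ≤ Z) (hZs : n * (2 ^ d) ^ h ≤ Z) (hi : ∀ m, m + 1 < n → i m ≤ h)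
    (h0 : s 0 0 = n) (h5 : ∀ m, m + 1 < n → s 5 m = ((2 ^ d) ^ (i m - 1) : ℕ))
    (h18 : s 18 0 = ((2 ^ d) ^ p : ℕ)) (h16 : s 16 0 = h) (h10 : s 10 0 = k) (hk : k < n)
    (hp : ∀ q, p = q + 1 → ¬ Spacious d h q n i) :
    Exec B (enlargeStretchFrom (2 ^ d)) s fun s' => SameOff [11, 18, 19, 20] s s' ∧ ∃ p', p ≤ p' ∧
      s' 18 0 = ((2 ^ d) ^ p' : ℕ) ∧ (∀ q, p' = q + 1 → ¬ Spacious d h q n i) ∧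
      ∀ l, k < l → l < n → StretchFits d h p' i k l := by
  have hsm : ∀ m ≤ Z, bitSize (m : ℚ) ≤ B := fun m hm => bitSize_natCast_mono hm hZ
  have hr : ∀ m, m + 1 < n → (2 ^ d) ^ (i m - 1) ≤ (2 ^ d) ^ h := fun m hm =>
    Nat.pow_le_pow_right (by positivity) (by have := hi m hm; omega)
  have hrZ : (2 ^ d) ^ h ≤ Z := le_trans (Nat.le_mul_of_pos_left _ (by omega)) hZs
  refine Exec.seq_assign hB ((0 : ℕ) : ℚ) (by simp [Expr.eval]) (hsm 0 (by omega)) ?_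
  refine Exec.seq_assign hB ((0 : ℕ) : ℚ) (by simp [Expr.eval]) (hsm 0 (by omega)) ?_
  refine Exec.seq_assign hB (k : ℚ) (by simp [Expr.eval_var, Store.set_apply, h10])
    (hsm k (by omega)) ?_
  refine Exec.whileLt hB (fun c s' => SameOff [11, 18, 19, 20] s s' ∧ k + c < n ∧
    s' 11 0 = (k + c : ℕ) ∧ s' 19 0 = (∑ m ∈ Finset.Ico k (k + c), (2 ^ d) ^ (i m - 1) : ℕ) ∧
    (∃ M : ℕ, s' 20 0 = M ∧ (∀ m, k ≤ m → m < k + c → (2 ^ d) ^ (i m - 1) ≤ M) ∧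
      (c = 0 ∧ M = 0 ∨ ∃ m, k ≤ m ∧ m < k + c ∧ M = (2 ^ d) ^ (i m - 1))) ∧ ∃ p', p ≤ p' ∧
      s' 18 0 = ((2 ^ d) ^ p' : ℕ) ∧ (∀ q, p' = q + 1 → ¬ Spacious d h q n i) ∧
      ∀ l, k < l → l ≤ k + c → StretchFits d h p' i k l) ?_ ?_ ?_
  · refine ⟨(((SameOff.refl _ s).set (by simp) _ _).set (by simp) _ _).set (by simp) _ _, hk,
      by simp [Store.set_apply], by simp [Store.set_apply], ⟨0, by simp [Store.set_apply],
        fun m _ _ => by omega, .inl ⟨rfl, rfl⟩⟩, p, le_rfl, by simp [Store.set_apply, h18], hp,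
      fun l _ _ => by omega⟩
  · rintro c s' ⟨hfr, hkc, h11, h19, ⟨M, h20, hMmax, hMmem⟩, p', hpp, h18', hp', hfit⟩ hlt
    have f0 : s' 0 0 = n := by rw [hfr 0 (by simp), h0]
    simp only [Expr.eval, Expr.eval_var, h11, f0] at hlt
    have hkn : k + c + 1 < n := by exact_mod_cast hlt
    refine ⟨by omega, ?_⟩
    have e5 : ∀ s₁ : Store, s₁ 11 0 = (k + c : ℕ) → s₁ 5 = s' 5 →
        (Expr.load 5 (.var 11)).eval s₁ = ((2 ^ d) ^ (i (k + c) - 1) : ℕ) := by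
      intro s₁ g1 g2
      rw [Expr.eval_load (a := k + c) 5 (by rw [Expr.eval_var, g1]), g2, hfr 5 (by simp),
        h5 _ hkn]
    have hsumZ : ∑ m ∈ Finset.Ico k (k + (c + 1)), (2 ^ d) ^ (i m - 1) ≤ Z := by
      refine (Finset.sum_le_card_nsmul _ _ ((2 ^ d) ^ h) fun m hm => ?_).trans (le_trans ?_ hZs)
      · rw [Finset.mem_Ico] at hm
        exact hr m (by omega)
      · rw [Nat.card_Ico, smul_eq_mul]
        exact Nat.mul_le_mul_right _ (by omega)
    refine Exec.seq_assign hB ((∑ m ∈ Finset.Ico k (k + (c + 1)), (2 ^ d) ^ (i m - 1) : ℕ) : ℚ)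
      ?_ (hsm _ hsumZ) ?_
    · rw [← add_assoc, Finset.sum_Ico_succ_top (by omega : k ≤ k + c), Nat.cast_add, ← h19,
        ← e5 s' h11 rfl]
      simp [Expr.eval, Expr.eval_var]
    set s₁ := s'.set 19 0 ((∑ m ∈ Finset.Ico k (k + (c + 1)), (2 ^ d) ^ (i m - 1) : ℕ) : ℚ)
      with hs₁
    have hfr₁ : SameOff [11, 18, 19, 20] s s₁ := hfr.set (by simp) _ _
    have g11 : s₁ 11 0 = (k + c : ℕ) := by simp [hs₁, Store.set_apply, h11]
    have g5 : s₁ 5 = s' 5 := Store.set_of_ne _ _ _ (by simp)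
    have g20 : s₁ 20 0 = M := by simp [hs₁, Store.set_apply, h20]
    have g18 : s₁ 18 0 = ((2 ^ d) ^ p' : ℕ) := by
      rw [hs₁, Store.set_of_ne _ _ _ (by simp), h18']
    have g19 : s₁ 19 0 = (∑ m ∈ Finset.Ico k (k + (c + 1)), (2 ^ d) ^ (i m - 1) : ℕ) := by
      simp [hs₁, Store.set_apply]
    have hfin : ∀ s₂ (M' : ℕ), SameOff [11, 18, 19, 20] s s₂ → s₂ 11 0 = (k + c : ℕ) →
        s₂ 20 0 = M' → s₂ 18 0 = ((2 ^ d) ^ p' : ℕ) →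
        s₂ 19 0 = (∑ m ∈ Finset.Ico k (k + (c + 1)), (2 ^ d) ^ (i m - 1) : ℕ) →
        (∀ m, k ≤ m → m < k + (c + 1) → (2 ^ d) ^ (i m - 1) ≤ M') →
        (∃ m, k ≤ m ∧ m < k + (c + 1) ∧ M' = (2 ^ d) ^ (i m - 1)) →
        Exec B (.seq (enlargeStretch (2 ^ d)) (.assign 11 (.add (.var 11) (.const 1)))) s₂
          fun s' => SameOff [11, 18, 19, 20] s s' ∧ k + (c + 1) < n ∧
          s' 11 0 = (k + (c + 1) : ℕ) ∧
          s' 19 0 = (∑ m ∈ Finset.Ico k (k + (c + 1)), (2 ^ d) ^ (i m - 1) : ℕ) ∧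
          (∃ M : ℕ, s' 20 0 = M ∧ (∀ m, k ≤ m → m < k + (c + 1) → (2 ^ d) ^ (i m - 1) ≤ M) ∧
            (c + 1 = 0 ∧ M = 0 ∨ ∃ m, k ≤ m ∧ m < k + (c + 1) ∧ M = (2 ^ d) ^ (i m - 1))) ∧
          ∃ p', p ≤ p' ∧ s' 18 0 = ((2 ^ d) ^ p' : ℕ) ∧
            (∀ q, p' = q + 1 → ¬ Spacious d h q n i) ∧
            ∀ l, k < l → l ≤ k + (c + 1) → StretchFits d h p' i k l := by
      intro s₂ M' e1 e2 e3 e4 e6 e7 e8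
      refine Exec.seq ((exec_enlargeStretch hd hB hZ hBn hZn e4 e3
        (by rw [e1 16 (by simp), h16]) e6 (by omega) (by omega) e7 e8 hp').mono ?_)
      rintro s₃ ⟨hfr₃, p'', hp1, hp2, hp3, hp4⟩
      refine Exec.assign hB ((k + (c + 1) : ℕ) : ℚ) ?_ (hsm _ (by omega)) ?_
      · simp only [Expr.eval, Expr.eval_var, hfr₃ 11 (by simp), e2]
        push_cast
        ring
      have n18 : (s₃.set 11 0 ((k + (c + 1) : ℕ) : ℚ)) 18 0 = ((2 ^ d) ^ p'' : ℕ) := by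
        rw [Store.set_of_ne _ _ _ (by simp), hp2]
      have n19 : (s₃.set 11 0 ((k + (c + 1) : ℕ) : ℚ)) 19 = s₂ 19 := by
        rw [Store.set_of_ne _ _ _ (by simp), hfr₃ 19 (by simp)]
      have n20 : (s₃.set 11 0 ((k + (c + 1) : ℕ) : ℚ)) 20 = s₂ 20 := by
        rw [Store.set_of_ne _ _ _ (by simp), hfr₃ 20 (by simp)]
      refine ⟨(e1.trans (hfr₃.mono (by simp))).set (by simp) _ _, by omega,
        by simp [Store.set_apply], by rw [n19, e6], ⟨M', by rw [n20, e3], e7, .inr e8⟩,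
        p'', hpp.trans hp1, n18, hp3, fun l h1 h2 => ?_⟩
      rcases eq_or_lt_of_le h2 with rfl | h2
      · obtain ⟨m, c1, c2, rfl⟩ := e8
        exact ⟨m, c1, c2, hp4⟩
      · exact (hfit l h1 (by omega)).mono hp1
    refine Exec.seq (Exec.ifLt hB (fun hlt' => ?_) (fun hle => ?_))
    · rw [Expr.eval_var, g20, e5 s₁ g11 g5] at hlt'
      have hlt'' : M < (2 ^ d) ^ (i (k + c) - 1) := by exact_mod_cast hlt'
      refine Exec.assign hB (((2 ^ d) ^ (i (k + c) - 1) : ℕ) : ℚ) (e5 s₁ g11 g5)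
        (hsm _ ((hr _ hkn).trans hrZ)) ?_
      refine hfin _ ((2 ^ d) ^ (i (k + c) - 1)) (hfr₁.set (by simp) _ _)
        (by rw [Store.set_of_ne _ _ _ (by simp), g11]) (by simp [Store.set_apply])
        (by rw [Store.set_of_ne _ _ _ (by simp), g18])
        (by rw [Store.set_of_ne _ _ _ (by simp), g19]) (fun m h1 h2 => ?_)
        ⟨k + c, by omega, by omega, rfl⟩
      rcases lt_or_ge m (k + c) with h | h
      · exact (hMmax m h1 h).trans hlt''.le
      · obtain rfl : m = k + c := by omega
        exact le_rfl
    · rw [Expr.eval_var, g20, e5 s₁ g11 g5] at hle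
      have hle' : (2 ^ d) ^ (i (k + c) - 1) ≤ M := by exact_mod_cast hle
      refine Exec.skip (hfin _ M hfr₁ g11 g20 g18 g19 (fun m h1 h2 => ?_) ?_)
      · rcases lt_or_ge m (k + c) with h | h
        · exact hMmax m h1 h
        · obtain rfl : m = k + c := by omega
          exact hle'
      · rcases hMmem with ⟨_, rfl⟩ | ⟨m, c1, c2, c3⟩
        · have : 0 < (2 ^ d) ^ (i (k + c) - 1) := by positivity
          omega
        · exact ⟨m, c1, by omega, c3⟩
  · rintro c s' ⟨hfr, hkc, h11, h19, _, p', hpp, h18', hp', hfit⟩ hle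
    have f0 : s' 0 0 = n := by rw [hfr 0 (by simp), h0]
    simp only [Expr.eval, Expr.eval_var, h11, f0] at hle
    have hkn : n ≤ k + c + 1 := by exact_mod_cast hle
    exact ⟨hfr, p', hpp, h18', hp', fun l h1 h2 => hfit l h1 (by omega)⟩

open BitRAM.Expr BitRAM.Program in
/-- Compute the stretch factor. -/
def findStretch (β : ℕ) : Program :=
  .seq (assign 18 (.const 1)) <| .seq (assign 10 (.const 0)) <|
  .whileLt (.add (var 10) (.const 1)) (var 0) <|
    .seq (enlargeStretchFrom β) <|
    assign 10 (.add (var 10) (.const 1))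

open NearestChain in
theorem exec_findStretch {B d n h Z : ℕ} {i : ℕ → ℕ} {s : Store} (hd : 1 ≤ d)
    (hB : 1 ≤ B) (hZ : bitSize Z ≤ B) (hnB : n ≤ B) (hnZ : n ≤ Z) (hn : 1 ≤ n)
    (hBn : 4 * h * n ≤ B)
    (hZn : 2 ^ d * (4 * h * n) ≤ Z) (hZs : n * (2 ^ d) ^ h ≤ Z) (hi : ∀ m, m + 1 < n → i m ≤ h)
    (h0 : s 0 0 = n) (h5 : ∀ m, m + 1 < n → s 5 m = ((2 ^ d) ^ (i m - 1) : ℕ))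
    (h16 : s 16 0 = h) :
    Exec B (findStretch (2 ^ d)) s fun s' => SameOff [10, 11, 18, 19, 20] s s' ∧ ∃ p,
      s' 18 0 = ((2 ^ d) ^ p : ℕ) ∧ (∀ q, p = q + 1 → ¬ Spacious d h q n i) ∧
      Spacious d h p n i := by
  have hsm : ∀ m ≤ Z, bitSize (m : ℚ) ≤ B := fun m hm => bitSize_natCast_mono hm hZ
  refine Exec.seq_assign hB ((1 : ℕ) : ℚ) (by simp [Expr.eval]) (hsm 1 (by omega)) ?_
  refine Exec.seq_assign hB ((0 : ℕ) : ℚ) (by simp [Expr.eval]) (hsm 0 (by omega)) ?_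
  refine Exec.whileLt hB (fun k s' => SameOff [10, 11, 18, 19, 20] s s' ∧ k < n ∧ s' 10 0 = k ∧
    ∃ p, s' 18 0 = ((2 ^ d) ^ p : ℕ) ∧ (∀ q, p = q + 1 → ¬ Spacious d h q n i) ∧
      ∀ k' < k, ∀ l, k' < l → l < n → StretchFits d h p i k' l) ?_ ?_ ?_
  -- The exponent starts at 0, where minimality is vacuous.
  · exact ⟨((SameOff.refl _ s).set (by simp) _ _).set (by simp) _ _, by omega,
      by simp [Store.set_apply], 0, by simp [Store.set_apply], fun q hq => by omega, by simp⟩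
  · rintro k s' ⟨hfr, hk, h10, p, h18, hp, hfit⟩ hlt
    have f0 : s' 0 0 = n := by rw [hfr 0 (by simp), h0]
    simp only [Expr.eval, Expr.eval_var, h10, f0] at hlt
    have hkn : k + 1 < n := by exact_mod_cast hlt
    refine ⟨by omega, Exec.seq ((exec_enlargeStretchFrom hd hB hZ hnB hnZ hBn hZn hZs hi f0
      (fun m hm => by rw [hfr 5 (by simp), h5 m hm]) h18 (by rw [hfr 16 (by simp), h16]) h10 hk
      hp).mono ?_)⟩
    rintro s₁ ⟨hfr₁, p', hpp, h18', hp', hfit'⟩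
    refine Exec.assign hB ((k + 1 : ℕ) : ℚ)
      (by simp [Expr.eval, Expr.eval_var, hfr₁ 10 (by simp), h10]) (hsm _ (by omega)) ?_
    refine ⟨(hfr.trans (hfr₁.mono (by simp))).set (by simp) _ _, hkn, by simp [Store.set_apply],
      p', by rw [Store.set_of_ne _ _ _ (by simp), h18'], hp', fun k' hk' l h1 h2 => ?_⟩
    rcases Nat.lt_succ_iff_lt_or_eq.1 hk' with h | rfl
    exacts [(hfit k' h l h1 h2).mono hpp, hfit' l h1 h2]
  · rintro k s' ⟨hfr, hk, h10, p, h18, hp, hfit⟩ hle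
    have f0 : s' 0 0 = n := by rw [hfr 0 (by simp), h0]
    simp only [Expr.eval, Expr.eval_var, h10, f0] at hle
    have hkn : n ≤ k + 1 := by exact_mod_cast hle
    exact ⟨hfr, p, h18, hp, fun k' l h1 h2 => hfit k' (by omega) l h1 h2⟩

end BitRAM

namespace BitRAM

/-! ### Placing the points along a line -/

open BitRAM.Expr BitRAM.Program in
/-- Advance variable 21 to the place of the point after the one in variable 10. -/
def nextPlace (β : ℕ) : Program :=
  .seq (assign 21 (.mul (.add (.floor (.div (var 21) (.load 5 (var 10)))) (.const 1))
    (.load 5 (var 10)))) <|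
  .seq (assign 22 (var 18)) <|
  .whileLt (var 22) (.mul (.mul (var 18) (.load 5 (var 10))) (.const β)) <|
    .seq (assign 23 (.mul (var 22) (.floor (.div
      (.add (.mul (.mul (.const 4) (var 16)) (var 21)) (var 22))
      (.mul (.mul (.const 4) (var 16)) (var 22)))))) <|
    .seq (.ifLt (var 21) (var 23) (assign 21 (var 23)) .skip) <|
    assign 22 (.mul (var 22) (.const β))

/-- Bounds all intermediate places in `exec_nextPlace` by the final one. -/
theorem skipBoundaries_mono_left (β h P t : ℕ) : Monotone fun i => skipBoundaries β h P i t :=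
  monotone_nat_of_le_succ fun _ => le_skipBoundary _ _ _

theorem exec_nextPlace {B β h P Z k i t : ℕ} {s : Store} (hB : 1 ≤ B) (hZ : bitSize Z ≤ B)
    (hβ : 2 ≤ β) (hP : 1 ≤ P) (hiB : i ≤ B) (h1i : 1 ≤ i) (h5 : s 5 k = (β ^ (i - 1) : ℕ))
    (h10 : s 10 0 = k) (h16 : s 16 0 = h) (h18 : s 18 0 = P) (h21 : s 21 0 = t)
    (hLZ : P * β ^ i ≤ Z)
    (htZ : skipBoundaries β h P i ((t / β ^ (i - 1) + 1) * β ^ (i - 1)) ≤ Z) :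
    Exec B (nextPlace β) s fun s' => SameOff [21, 22, 23] s s' ∧
      s' 21 0 = (skipBoundaries β h P i ((t / β ^ (i - 1) + 1) * β ^ (i - 1)) : ℕ) := by
  have hsm : ∀ m ≤ Z, bitSize (m : ℚ) ≤ B := fun m hm => bitSize_natCast_mono hm hZ
  set t₀ := (t / β ^ (i - 1) + 1) * β ^ (i - 1) with ht₀
  have hsk : ∀ j ≤ i, skipBoundaries β h P j t₀ ≤ Z := fun j hj =>
    (skipBoundaries_mono_left β h P t₀ hj).trans htZ
  have hLj : ∀ j ≤ i, P * β ^ j ≤ Z := fun j hj =>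
    (Nat.mul_le_mul_left _ (Nat.pow_le_pow_right (by omega) hj)).trans hLZ
  have e5 : ∀ s' : Store, SameOff [21, 22, 23] s s' →
      (Expr.load 5 (.var 10)).eval s' = (β ^ (i - 1) : ℕ) := fun s' hfr => by
    rw [Expr.eval_load (a := k) 5 (by rw [Expr.eval_var, hfr 10 (by simp), h10]),
      hfr 5 (by simp), h5]
  refine Exec.seq_assign hB (t₀ : ℚ) ?_ (hsm _ (hsk 0 (by omega))) ?_
  · have := e5 s (SameOff.refl _ s)
    rw [ht₀, Nat.cast_mul, Nat.cast_add, ← floor_natCast_div, ← this, ← h21]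
    simp [Expr.eval, Expr.eval_var]
  refine Exec.seq_assign hB (P : ℚ) (by simp [Expr.eval_var, Store.set_apply, h18])
    (hsm P (by simpa using hLj 0 (by omega))) ?_
  refine Exec.whileLt hB (fun j s' => SameOff [21, 22, 23] s s' ∧ j ≤ i ∧
    s' 22 0 = (P * β ^ j : ℕ) ∧ s' 21 0 = (skipBoundaries β h P j t₀ : ℕ)) ?_ ?_ ?_
  · refine ⟨((SameOff.refl _ s).set (by simp) _ _).set (by simp) _ _, by omega, ?_, ?_⟩
    · simp [Store.set_apply]
    · simp [Store.set_apply, skipBoundaries]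
  · rintro j s' ⟨hfr, hj, h22, h21'⟩ hlt
    -- The level is not in memory: the loop recognizes `j = i` by comparing block lengths, with `β ^
    -- i` recovered from the stored `β ^ (i - 1)`.
    have hguard : (Expr.mul (.mul (.var 18) (.load 5 (.var 10))) (.const β)).eval s' =
        (P * β ^ i : ℕ) := by
      have h1 := e5 s' hfr
      simp only [Expr.eval] at h1 ⊢
      rw [h1, Expr.eval_var, hfr 18 (by simp), h18]
      obtain ⟨i', rfl⟩ := Nat.exists_eq_add_of_le' h1i
      simp [pow_succ, mul_assoc]
    rw [hguard, Expr.eval_var, h22] at hlt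
    have hji : j < i := by
      by_contra hcon
      have : P * β ^ j < P * β ^ i := by exact_mod_cast hlt
      exact absurd (Nat.mul_le_mul_left P (Nat.pow_le_pow_right (by omega : 0 < β)
        (not_lt.1 hcon))) (by omega)
    refine ⟨by omega, ?_⟩
    set T := skipBoundaries β h P j t₀ with hT
    set L := P * β ^ j with hL
    have hmax : skipBoundaries β h P (j + 1) t₀ = max T (L * ((4 * h * T + L) / (4 * h * L))) := rfl
    have hTZ := hsk (j + 1) hji
    rw [hmax] at hTZ
    refine Exec.seq_assign hB ((L * ((4 * h * T + L) / (4 * h * L)) : ℕ) : ℚ) ?_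
      (hsm _ ((le_max_right _ _).trans hTZ)) ?_
    · rw [Nat.cast_mul, ← floor_natCast_div]
      simp only [Expr.eval, Expr.eval_var, hfr 16 (by simp), h16, h22, h21']
      push_cast
      rfl
    have hfin : ∀ s₁ : Store, SameOff [21, 22, 23] s s₁ → s₁ 22 0 = L →
        s₁ 21 0 = (skipBoundaries β h P (j + 1) t₀ : ℕ) →
        Exec B (.assign 22 (.mul (.var 22) (.const β))) s₁ fun s' =>
          SameOff [21, 22, 23] s s' ∧ j + 1 ≤ i ∧ s' 22 0 = (P * β ^ (j + 1) : ℕ) ∧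
          s' 21 0 = (skipBoundaries β h P (j + 1) t₀ : ℕ) := by
      intro s₁ g1 g2 g3
      refine Exec.assign hB ((P * β ^ (j + 1) : ℕ) : ℚ) ?_ (hsm _ (hLj _ hji)) ?_
      · simp only [Expr.eval, Expr.eval_var, g2, hL]
        push_cast
        ring
      · exact ⟨g1.set (by simp) _ _, hji, by simp [Store.set_apply],
          by rw [Store.set_of_ne _ _ _ (by simp), g3]⟩
    refine Exec.seq (Exec.ifLt hB (fun hlt' => ?_) (fun hle => ?_))
    · rw [Expr.eval_var, Expr.eval_var, Store.set_of_ne _ _ _ (show 21 ≠ 23 by simp), h21',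
        Store.set_apply, if_pos ⟨rfl, rfl⟩] at hlt'
      have hlt'' : T < L * ((4 * h * T + L) / (4 * h * L)) := by exact_mod_cast hlt'
      refine Exec.assign hB ((L * ((4 * h * T + L) / (4 * h * L)) : ℕ) : ℚ)
        (by rw [Expr.eval_var, Store.set_apply, if_pos ⟨rfl, rfl⟩])
        (hsm _ ((le_max_right _ _).trans hTZ)) ?_
      refine hfin _ ((hfr.set (by simp) _ _).set (by simp) _ _) ?_ ?_
      · rw [Store.set_of_ne _ _ _ (by simp), Store.set_of_ne _ _ _ (by simp), h22]
      · rw [Store.set_apply, if_pos ⟨rfl, rfl⟩, hmax, max_eq_right hlt''.le]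
    · rw [Expr.eval_var, Expr.eval_var, Store.set_of_ne _ _ _ (show 21 ≠ 23 by simp), h21',
        Store.set_apply, if_pos ⟨rfl, rfl⟩] at hle
      have hle' : L * ((4 * h * T + L) / (4 * h * L)) ≤ T := by exact_mod_cast hle
      refine Exec.skip (hfin _ (hfr.set (by simp) _ _) ?_ ?_)
      · rw [Store.set_of_ne _ _ _ (by simp), h22]
      · rw [Store.set_of_ne _ _ _ (by simp), h21', hmax, max_eq_left hle']
  · rintro j s' ⟨hfr, hj, h22, h21'⟩ hle
    have hguard : (Expr.mul (.mul (.var 18) (.load 5 (.var 10))) (.const β)).eval s' =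
        (P * β ^ i : ℕ) := by
      have h1 := e5 s' hfr
      simp only [Expr.eval] at h1 ⊢
      rw [h1, Expr.eval_var, hfr 18 (by simp), h18]
      obtain ⟨i', rfl⟩ := Nat.exists_eq_add_of_le' h1i
      simp [pow_succ, mul_assoc]
    rw [hguard, Expr.eval_var, h22] at hle
    have hij : j = i := by
      by_contra hcon
      have h1 : P * β ^ i ≤ P * β ^ j := by exact_mod_cast hle
      have h2 : P * β ^ j < P * β ^ i :=
        Nat.mul_lt_mul_of_pos_left (Nat.pow_lt_pow_right (by omega) (by omega)) hP
      omega
    rw [hij] at h21'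
    exact ⟨hfr, h21'⟩

open BitRAM.Expr BitRAM.Program in
/-- Put the places of the points into array 6. -/
def findPlaces (β : ℕ) : Program :=
  .seq (assign 21 (.const 0)) <| .seq (.store 6 (.const 0) (.const 0)) <|
  .seq (assign 10 (.const 0)) <|
  .whileLt (.add (var 10) (.const 1)) (var 0) <|
    .seq (nextPlace β) <|
    .seq (.store 6 (.add (var 10) (.const 1)) (var 21)) <|
    assign 10 (.add (var 10) (.const 1))

theorem exec_findPlaces {B n β h P Z : ℕ} {i : ℕ → ℕ} {s : Store} (hB : 1 ≤ B)
    (hZ : bitSize Z ≤ B) (hnB : n ≤ B) (hnZ : n ≤ Z) (hn : 1 ≤ n) (hhB : h ≤ B) (hβ : 2 ≤ β)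
    (hP : 1 ≤ P) (hi : ∀ k, k + 1 < n → 1 ≤ i k ∧ i k ≤ h) (h0 : s 0 0 = n)
    (h5 : ∀ k, k + 1 < n → s 5 k = (β ^ (i k - 1) : ℕ)) (h16 : s 16 0 = h) (h18 : s 18 0 = P)
    (hLZ : P * β ^ h ≤ Z) (htZ : ∀ k < n, sweep β h P i k ≤ Z) :
    Exec B (findPlaces β) s fun s' => SameOff [6, 10, 21, 22, 23] s s' ∧
      ∀ k < n, s' 6 k = (sweep β h P i k : ℕ) := by
  have hsm : ∀ m ≤ Z, bitSize (m : ℚ) ≤ B := fun m hm => bitSize_natCast_mono hm hZ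
  refine Exec.seq_assign hB ((0 : ℕ) : ℚ) (by simp [Expr.eval]) (hsm 0 (by omega)) ?_
  refine Exec.seq_store hB 0 ((0 : ℕ) : ℚ) (by simp [Expr.eval]) (by simp [Expr.eval])
    (hsm 0 (by omega)) ?_
  refine Exec.seq_assign hB ((0 : ℕ) : ℚ) (by simp [Expr.eval]) (hsm 0 (by omega)) ?_
  refine Exec.whileLt hB (fun k s' => SameOff [6, 10, 21, 22, 23] s s' ∧ k < n ∧ s' 10 0 = k ∧
    s' 21 0 = (sweep β h P i k : ℕ) ∧ ∀ l ≤ k, s' 6 l = (sweep β h P i l : ℕ)) ?_ ?_ ?_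
  · refine ⟨(((SameOff.refl _ s).set (by simp) _ _).set (by simp) _ _).set (by simp) _ _,
      by omega, by simp [Store.set_apply], by simp [Store.set_apply, sweep], fun l hl => ?_⟩
    obtain rfl : l = 0 := by omega
    simp [Store.set_apply, sweep]
  · rintro k s' ⟨hfr, hk, h10, h21, h6⟩ hlt
    have f0 : s' 0 0 = n := by rw [hfr 0 (by simp), h0]
    simp only [Expr.eval, Expr.eval_var, h10, f0] at hlt
    have hkn : k + 1 < n := by exact_mod_cast hlt
    obtain ⟨h1i, hih⟩ := hi k hkn
    refine ⟨by omega, Exec.seq ((exec_nextPlace hB hZ hβ hP (by omega) h1i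
      (by rw [hfr 5 (by simp), h5 k hkn]) h10 (by rw [hfr 16 (by simp), h16])
      (by rw [hfr 18 (by simp), h18]) h21
      ((Nat.mul_le_mul_left _ (Nat.pow_le_pow_right (by omega) hih)).trans hLZ)
      (htZ (k + 1) hkn)).mono ?_)⟩
    rintro s₁ ⟨hfr₁, g21⟩
    have g10 : s₁ 10 0 = k := by rw [hfr₁ 10 (by simp), h10]
    have hfr₁' := hfr.trans (hfr₁.mono (M' := [6, 10, 21, 22, 23]) (by simp))
    refine Exec.seq_store hB (k + 1) ((sweep β h P i (k + 1) : ℕ) : ℚ)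
      (by simp [Expr.eval, Expr.eval_var, g10]) (by rw [Expr.eval_var, g21]; rfl)
      (hsm _ (htZ _ hkn)) ?_
    refine Exec.assign hB ((k + 1 : ℕ) : ℚ)
      (by simp [Expr.eval, Expr.eval_var, Store.set_apply, g10]) (hsm _ (by omega)) ?_
    refine ⟨(hfr₁'.set (by simp) _ _).set (by simp) _ _, hkn, by simp [Store.set_apply], ?_,
      fun l hl => ?_⟩
    · rw [Store.set_of_ne _ _ _ (by simp), Store.set_of_ne _ _ _ (by simp), g21]
      rfl
    · rw [Store.set_of_ne _ _ _ (by simp), Store.set_apply]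
      rcases eq_or_ne l (k + 1) with rfl | hlk
      · simp
      · rw [if_neg (by simp [hlk]), hfr₁ 6 (by simp), h6 l (by omega)]
  · rintro k s' ⟨hfr, hk, h10, h21, h6⟩ hle
    have f0 : s' 0 0 = n := by rw [hfr 0 (by simp), h0]
    simp only [Expr.eval, Expr.eval_var, h10, f0] at hle
    have hkn : n ≤ k + 1 := by exact_mod_cast hle
    exact ⟨hfr, fun l hl => h6 l (by omega)⟩

/-! ### Computing the coordinates -/

open BitRAM.Expr BitRAM.Program in
/-- Put every `d`-th binary digit of variable 23 into variable 24. -/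
def gatherBitsProgram (d : ℕ) : Program :=
  .seq (assign 24 (.const 0)) <| .seq (assign 25 (.const 1)) <|
  .whileLt (.const 0) (var 23) <|
    .seq (assign 24 (.add (var 24) (.mul (var 25)
      (.sub (var 23) (.mul (.const 2) (.floor (.div (var 23) (.const 2)))))))) <|
    .seq (assign 25 (.mul (.const 2) (var 25))) <|
    assign 23 (.floor (.div (var 23) (.const (2 ^ d : ℕ))))

theorem exec_gatherBitsProgram {B d u Z : ℕ} {s : Store} (hd : 1 ≤ d) (hB : 1 ≤ B)
    (hZ : bitSize Z ≤ B) (h2u : 2 * u + 1 ≤ Z) (h23 : s 23 0 = u) :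
    Exec B (gatherBitsProgram d) s fun s' => SameOff [23, 24, 25] s s' ∧
      s' 24 0 = (gatherBits d u : ℕ) := by
  have hsm : ∀ m ≤ Z, bitSize (m : ℚ) ≤ B := fun m hm => bitSize_natCast_mono hm hZ
  have hd0 : d ≠ 0 := by omega
  have huB : u < 2 ^ B := by
    rw [bitSize_natCast] at hZ
    have h1 := Nat.lt_size_self Z
    have h2 : 2 ^ Z.size ≤ 2 ^ B := Nat.pow_le_pow_right (by norm_num) (by omega)
    omega
  refine Exec.seq_assign hB ((0 : ℕ) : ℚ) (by simp [Expr.eval]) (hsm 0 (by omega)) ?_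
  refine Exec.seq_assign hB ((1 : ℕ) : ℚ) (by simp [Expr.eval]) (hsm 1 (by omega)) ?_
  -- Here `v` is the unread part of `u` and `c` the digits collected so far. The last clause gives
  -- `2 ^ m ≤ u < 2 ^ B` while `v` is nonzero, hence at most `B` rounds.
  refine Exec.whileLt hB (fun m s' => SameOff [23, 24, 25] s s' ∧ ∃ v c : ℕ, s' 23 0 = v ∧
    s' 24 0 = c ∧ s' 25 0 = (2 ^ m : ℕ) ∧ c + 2 ^ m * gatherBits d v = gatherBits d u ∧
    2 ^ m * v ≤ u) ?_ ?_ ?_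
  · refine ⟨((SameOff.refl _ s).set (by simp) _ _).set (by simp) _ _, u, 0, ?_, ?_, ?_, ?_, ?_⟩
    · simp [Store.set_apply, h23]
    · simp [Store.set_apply]
    · simp [Store.set_apply]
    · simp
    · simp
  · rintro m s' ⟨hfr, v, c, g23, g24, g25, hsum, hle⟩ hlt
    simp only [Expr.eval, Expr.eval_var, g23] at hlt
    have hv : 0 < v := by exact_mod_cast hlt
    have hmu : 2 ^ m ≤ u := le_trans (Nat.le_mul_of_pos_right _ hv) hle
    have hsum' : c + 2 ^ m * (v % 2) + 2 ^ (m + 1) * gatherBits d (v / 2 ^ d) =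
        gatherBits d u := by
      rw [← hsum, gatherBits_eq hd0 v]
      ring
    have hcZ : c + 2 ^ m * (v % 2) ≤ Z := by
      have := gatherBits_le hd0 u
      omega
    refine ⟨(Nat.pow_lt_pow_iff_right (by norm_num : 1 < 2)).1 (hmu.trans_lt huB), ?_⟩
    refine Exec.seq_assign hB ((c + 2 ^ m * (v % 2) : ℕ) : ℚ) ?_ (hsm _ hcZ) ?_
    · have h1 : ((⌊(v : ℚ) / 2⌋ : ℤ) : ℚ) = ((v / 2 : ℕ) : ℚ) := by
        exact_mod_cast floor_natCast_div v 2
      have h2 : ((v % 2 : ℕ) : ℚ) = v - 2 * ((v / 2 : ℕ) : ℚ) := by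
        have : ((2 * (v / 2) + v % 2 : ℕ) : ℚ) = v := by rw [Nat.div_add_mod]
        push_cast at this ⊢
        linarith
      simp only [Expr.eval, Expr.eval_var, g23, g24, g25, h1]
      rw [Nat.cast_add, Nat.cast_mul, h2]
    refine Exec.seq_assign hB ((2 ^ (m + 1) : ℕ) : ℚ) ?_ (hsm _ ?_) ?_
    · simp [Expr.eval, Expr.eval_var, Store.set_apply, g25, pow_succ']
    · rw [pow_succ]
      omega
    have h3 : v / 2 ^ d ≤ v / 2 :=
      Nat.div_le_div_left (Nat.le_self_pow hd0 2) (by norm_num)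
    have hvu : v ≤ u := le_trans (Nat.le_mul_of_pos_left _ (Nat.two_pow_pos m)) hle
    refine Exec.assign hB ((v / 2 ^ d : ℕ) : ℚ) ?_ (hsm _ (by omega)) ?_
    · rw [← floor_natCast_div]
      simp [Expr.eval, Expr.eval_var, Store.set_apply, g23]
    refine ⟨((hfr.set (by simp) _ _).set (by simp) _ _).set (by simp) _ _, v / 2 ^ d,
      c + 2 ^ m * (v % 2), ?_, ?_, ?_, hsum', ?_⟩
    · simp [Store.set_apply]
    · simp [Store.set_apply]
    · simp [Store.set_apply]
    · rw [pow_succ, mul_assoc]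
      exact (Nat.mul_le_mul_left _ (by omega)).trans hle
  · rintro m s' ⟨hfr, v, c, g23, g24, g25, hsum, hle⟩ hge
    simp only [Expr.eval, Expr.eval_var, g23] at hge
    have hv : v = 0 := by
      have : v ≤ 0 := by exact_mod_cast hge
      omega
    rw [hv, gatherBits_zero, mul_zero, add_zero] at hsum
    exact ⟨hfr, by rw [g24, hsum]⟩

open BitRAM.Expr BitRAM.Program in
/-- Put the spaced position of the cell in variable 24 into variable 26. -/
def spacedPositionProgram : Program :=
  .seq (assign 26 (.const 0)) <| .seq (assign 25 (.const 1)) <| .seq (assign 28 (.const 0)) <|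
  .whileLt (var 28) (var 16) <|
    .seq (assign 26 (.add (var 26) (.mul (var 25) (.floor (.div (var 24) (var 25)))))) <|
    .seq (assign 25 (.mul (.const 2) (var 25))) <|
    assign 28 (.add (var 28) (.const 1))

theorem exec_spacedPositionProgram {B h c Z : ℕ} {s : Store} (hB : 1 ≤ B) (hZ : bitSize Z ≤ B)
    (hhB : h ≤ B) (hcZ : h * c ≤ Z) (hhZ : 2 ^ h ≤ Z) (h24 : s 24 0 = c) (h16 : s 16 0 = h) :
    Exec B spacedPositionProgram s fun s' => SameOff [25, 26, 28] s s' ∧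
      s' 26 0 = (spacedPosition h c : ℕ) := by
  have hsm : ∀ m ≤ Z, bitSize (m : ℚ) ≤ B := fun m hm => bitSize_natCast_mono hm hZ
  have hh2 : h < 2 ^ h := Nat.lt_two_pow_self
  refine Exec.seq_assign hB ((0 : ℕ) : ℚ) (by simp [Expr.eval]) (hsm 0 (by omega)) ?_
  refine Exec.seq_assign hB ((1 : ℕ) : ℚ) (by simp [Expr.eval]) (hsm 1 (by omega)) ?_
  refine Exec.seq_assign hB ((0 : ℕ) : ℚ) (by simp [Expr.eval]) (hsm 0 (by omega)) ?_
  refine Exec.whileLt hB (fun m s' => SameOff [25, 26, 28] s s' ∧ m ≤ h ∧ s' 28 0 = m ∧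
    s' 26 0 = (spacedPosition m c : ℕ) ∧ s' 25 0 = (2 ^ m : ℕ)) ?_ ?_ ?_
  · refine ⟨(((SameOff.refl _ s).set (by simp) _ _).set (by simp) _ _).set (by simp) _ _,
      by omega, ?_, ?_, ?_⟩ <;> simp [Store.set_apply, spacedPosition]
  · rintro m s' ⟨hfr, hm, g28, g26, g25⟩ hlt
    have f16 : s' 16 0 = h := by rw [hfr 16 (by simp), h16]
    simp only [Expr.eval_var, g28, f16] at hlt
    have hmh : m < h := by exact_mod_cast hlt
    have hsum : spacedPosition (m + 1) c = spacedPosition m c + 2 ^ m * (c / 2 ^ m) :=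
      Finset.sum_range_succ _ _
    refine ⟨by omega, ?_⟩
    refine Exec.seq_assign hB ((spacedPosition (m + 1) c : ℕ) : ℚ) ?_
      (hsm _ ((spacedPosition_le _ _).trans ((Nat.mul_le_mul_right _ hmh).trans hcZ))) ?_
    · rw [hsum, Nat.cast_add, Nat.cast_mul, ← floor_natCast_div]
      simp only [Expr.eval, Expr.eval_var, g26, g25, hfr 24 (by simp), h24]
    refine Exec.seq_assign hB ((2 ^ (m + 1) : ℕ) : ℚ) ?_
      (hsm _ ((Nat.pow_le_pow_right (by norm_num) hmh).trans hhZ)) ?_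
    · simp [Expr.eval, Expr.eval_var, Store.set_apply, g25, pow_succ']
    refine Exec.assign hB ((m + 1 : ℕ) : ℚ) ?_ (hsm _ (by omega)) ?_
    · simp [Expr.eval, Expr.eval_var, Store.set_apply, g28]
    refine ⟨((hfr.set (by simp) _ _).set (by simp) _ _).set (by simp) _ _, hmh, ?_, ?_, ?_⟩ <;>
      simp [Store.set_apply]
  · rintro m s' ⟨hfr, hm, g28, g26, g25⟩ hle
    have f16 : s' 16 0 = h := by rw [hfr 16 (by simp), h16]
    simp only [Expr.eval_var, g28, f16] at hle
    have hmh : m = h := le_antisymm hm (by exact_mod_cast hle)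
    exact ⟨hfr, hmh ▸ g26⟩

open BitRAM.Expr BitRAM.Program in
/-- Write the coordinates of the point in variable 10. -/
def writePoint (d : ℕ) : Program :=
  .seq (assign 27 (.const 1)) <| .seq (assign 11 (.const 0)) <|
  .whileLt (var 11) (.const d) <|
    .seq (assign 23 (.floor (.div (.load 6 (var 10)) (var 27)))) <|
    .seq (gatherBitsProgram d) <|
    .seq spacedPositionProgram <|
    .seq (.store 2 (.add (.mul (.load 4 (var 10)) (.const d)) (var 11)) (var 26)) <|
    .seq (assign 27 (.mul (.const 2) (var 27))) <|
    assign 11 (.add (var 11) (.const 1))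

/-- The last clause protects the coordinates of the points written earlier. -/
theorem exec_writePoint {B d h k t x Z : ℕ} {s : Store} (hd : 1 ≤ d) (hB : 1 ≤ B)
    (hZ : bitSize Z ≤ B) (hdB : d ≤ B) (hhB : h ≤ B) (hdZ : 2 ^ d ≤ Z) (hhZ : 2 ^ h ≤ Z)
    (htZ : 2 * t + 1 ≤ Z) (hhtZ : h * t ≤ Z) (h10 : s 10 0 = k) (h6 : s 6 k = t)
    (h4 : s 4 k = x) (h16 : s 16 0 = h) :
    Exec B (writePoint d) s fun s' => SameOff [2, 11, 23, 24, 25, 26, 27, 28] s s' ∧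
      (∀ a < d, s' 2 (x * d + a) = (spacedPosition h (gatherBits d (t / 2 ^ a)) : ℕ)) ∧
      ∀ b, (∀ a < d, b ≠ x * d + a) → s' 2 b = s 2 b := by
  have hsm : ∀ m ≤ Z, bitSize (m : ℚ) ≤ B := fun m hm => bitSize_natCast_mono hm hZ
  have hd2 : d < 2 ^ d := Nat.lt_two_pow_self
  refine Exec.seq_assign hB ((1 : ℕ) : ℚ) (by simp [Expr.eval]) (hsm 1 (by omega)) ?_
  refine Exec.seq_assign hB ((0 : ℕ) : ℚ) (by simp [Expr.eval]) (hsm 0 (by omega)) ?_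
  refine Exec.whileLt hB (fun m s' => SameOff [2, 11, 23, 24, 25, 26, 27, 28] s s' ∧ m ≤ d ∧
    s' 11 0 = m ∧ s' 27 0 = (2 ^ m : ℕ) ∧
    (∀ a < m, s' 2 (x * d + a) = (spacedPosition h (gatherBits d (t / 2 ^ a)) : ℕ)) ∧
    ∀ b, (∀ a < d, b ≠ x * d + a) → s' 2 b = s 2 b) ?_ ?_ ?_
  · refine ⟨((SameOff.refl _ s).set (by simp) _ _).set (by simp) _ _,
      by omega, ?_, ?_, by simp, ?_⟩ <;> simp [Store.set_apply]
  · rintro m s' ⟨hfr, hm, g11, g27, hout, hrest⟩ hlt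
    simp only [Expr.eval, Expr.eval_var, g11] at hlt
    have hmd : m < d := by exact_mod_cast hlt
    refine ⟨by omega, ?_⟩
    have htm : t / 2 ^ m ≤ t := Nat.div_le_self _ _
    refine Exec.seq_assign hB ((t / 2 ^ m : ℕ) : ℚ) ?_ (hsm _ (by omega)) ?_
    · rw [← floor_natCast_div]
      simp only [Expr.eval, Expr.eval_var, hfr 10 (by simp), h10, Nat.floor_natCast,
        hfr 6 (by simp), h6, g27]
    refine Exec.seq ((exec_gatherBitsProgram (u := t / 2 ^ m) hd hB hZ (by omega)
      (by simp [Store.set_apply])).mono ?_)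
    rintro s₁ ⟨hfr₁, e24⟩
    have hg : gatherBits d (t / 2 ^ m) ≤ t := (gatherBits_le (by omega) _).trans htm
    refine Exec.seq ((exec_spacedPositionProgram hB hZ hhB ((Nat.mul_le_mul_left _ hg).trans hhtZ)
      hhZ e24 (by rw [hfr₁ 16 (by simp), Store.set_of_ne _ _ _ (by simp), hfr 16 (by simp),
        h16])).mono ?_)
    rintro s₂ ⟨hfr₂, e26⟩
    have hsame : ∀ j, j ∉ [23, 24, 25, 26, 28] → s₂ j = s' j := by
      intro j hj
      simp only [List.mem_cons, List.not_mem_nil, or_false, not_or] at hj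
      rw [hfr₂ j (by simp [hj]), hfr₁ j (by simp [hj]), Store.set_of_ne _ _ _ hj.1]
    have hfr₂' : SameOff [2, 11, 23, 24, 25, 26, 27, 28] s s₂ := hfr.trans
      (SameOff.mono (M := [23, 24, 25, 26, 28]) hsame (by simp))
    have e11 : s₂ 11 0 = m := by rw [hsame 11 (by simp), g11]
    have e27 : s₂ 27 0 = (2 ^ m : ℕ) := by rw [hsame 27 (by simp), g27]
    refine Exec.seq_store hB (x * d + m)
      ((spacedPosition h (gatherBits d (t / 2 ^ m)) : ℕ) : ℚ) ?_ (by rw [Expr.eval_var, e26])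
      (hsm _ ((spacedPosition_le _ _).trans ((Nat.mul_le_mul_left _ hg).trans hhtZ))) ?_
    · simp only [Expr.eval, Expr.eval_var, hfr₂' 10 (by simp), h10, Nat.floor_natCast,
        hfr₂' 4 (by simp), h4, e11]
      push_cast
      rfl
    refine Exec.seq_assign hB ((2 ^ (m + 1) : ℕ) : ℚ) ?_
      (hsm _ ((Nat.pow_le_pow_right (by norm_num) hmd).trans hdZ)) ?_
    · simp [Expr.eval, Expr.eval_var, Store.set_apply, e27, pow_succ']
    refine Exec.assign hB ((m + 1 : ℕ) : ℚ) ?_ (hsm _ (by omega)) ?_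
    · simp [Expr.eval, Expr.eval_var, Store.set_apply, e11]
    refine ⟨((hfr₂'.set (by simp) _ _).set (by simp) _ _).set (by simp) _ _, hmd, ?_, ?_,
      fun a ha => ?_, fun b hb => ?_⟩
    · simp [Store.set_apply]
    · simp [Store.set_apply]
    · rw [Store.set_of_ne _ _ _ (by simp), Store.set_of_ne _ _ _ (by simp), Store.set_apply]
      rcases Nat.lt_succ_iff_lt_or_eq.1 ha with h' | rfl
      · rw [if_neg (by omega), hsame 2 (by simp), hout a h']
      · simp
    · rw [Store.set_of_ne _ _ _ (by simp), Store.set_of_ne _ _ _ (by simp), Store.set_apply,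
        if_neg (by simpa using hb m hmd), hsame 2 (by simp), hrest b hb]
  · rintro m s' ⟨hfr, hm, g11, g27, hout, hrest⟩ hle
    simp only [Expr.eval, Expr.eval_var, g11] at hle
    have hmd : m = d := le_antisymm hm (by exact_mod_cast hle)
    exact ⟨hfr, hmd ▸ hout, hrest⟩

open BitRAM.Expr BitRAM.Program in
/-- Write the coordinates of all points. -/
def writePoints (d : ℕ) : Program :=
  .seq (assign 10 (.const 0)) <|
  .whileLt (var 10) (var 0) <|
    .seq (writePoint d) <|
    assign 10 (.add (var 10) (.const 1))

theorem exec_writePoints {B d n h Z : ℕ} {t x : ℕ → ℕ} {s : Store} (hd : 1 ≤ d) (hB : 1 ≤ B)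
    (hZ : bitSize Z ≤ B) (hnB : n ≤ B) (hnZ : n ≤ Z) (hdB : d ≤ B) (hhB : h ≤ B) (hdZ : 2 ^ d ≤ Z)
    (hhZ : 2 ^ h ≤ Z) (htZ : ∀ k < n, 2 * t k + 1 ≤ Z) (hhtZ : ∀ k < n, h * t k ≤ Z)
    (h0 : s 0 0 = n) (h6 : ∀ k < n, s 6 k = t k) (h4 : ∀ k < n, s 4 k = x k)
    (hx : ∀ k < n, ∀ l < n, x k = x l → k = l) (h16 : s 16 0 = h) :
    Exec B (writePoints d) s fun s' => ∀ k < n, ∀ a < d,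
      s' 2 (x k * d + a) = (spacedPosition h (gatherBits d (t k / 2 ^ a)) : ℕ) := by
  have hsm : ∀ m ≤ Z, bitSize (m : ℚ) ≤ B := fun m hm => bitSize_natCast_mono hm hZ
  refine Exec.seq_assign hB ((0 : ℕ) : ℚ) (by simp [Expr.eval]) (hsm 0 (by omega)) ?_
  refine Exec.whileLt hB (fun k s' => SameOff [2, 10, 11, 23, 24, 25, 26, 27, 28] s s' ∧ k ≤ n ∧
    s' 10 0 = k ∧ ∀ l < k, ∀ a < d,
      s' 2 (x l * d + a) = (spacedPosition h (gatherBits d (t l / 2 ^ a)) : ℕ)) ?_ ?_ ?_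
  · exact ⟨(SameOff.refl _ s).set (by simp) _ _, by omega, by simp [Store.set_apply], by simp⟩
  · rintro k s' ⟨hfr, hk, g10, hout⟩ hlt
    have f0 : s' 0 0 = n := by rw [hfr 0 (by simp), h0]
    simp only [Expr.eval_var, g10, f0] at hlt
    have hkn : k < n := by exact_mod_cast hlt
    refine ⟨by omega, Exec.seq ((exec_writePoint hd hB hZ hdB hhB hdZ hhZ (htZ k hkn) (hhtZ k hkn)
      g10 (by rw [hfr 6 (by simp), h6 k hkn]) (by rw [hfr 4 (by simp), h4 k hkn])
      (by rw [hfr 16 (by simp), h16])).mono ?_)⟩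
    rintro s₁ ⟨hfr₁, hpt, hrest⟩
    refine Exec.assign hB ((k + 1 : ℕ) : ℚ)
      (by simp [Expr.eval, Expr.eval_var, hfr₁ 10 (by simp), g10]) (hsm _ (by omega)) ?_
    refine ⟨(hfr.trans (hfr₁.mono (by simp))).set (by simp) _ _, hkn, by simp [Store.set_apply],
      fun l hl a ha => ?_⟩
    rw [Store.set_of_ne _ _ _ (by simp)]
    rcases Nat.lt_succ_iff_lt_or_eq.1 hl with hlk | rfl
    · rw [hrest _ fun a' ha' heq => ?_, hout l hlk a ha]
      -- Division by `d` recovers the point from the index of an output cell.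
      have h1 : (x l * d + a) / d = (x k * d + a') / d := by rw [heq]
      rw [mul_comm, Nat.mul_add_div (by omega), mul_comm (x k), Nat.mul_add_div (by omega),
        Nat.div_eq_of_lt ha, Nat.div_eq_of_lt ha'] at h1
      have := hx l (by omega) k hkn (by omega)
      omega
    · exact hpt a ha
  · rintro k s' ⟨hfr, hk, g10, hout⟩ hle
    have f0 : s' 0 0 = n := by rw [hfr 0 (by simp), h0]
    simp only [Expr.eval_var, g10, f0] at hle
    have hkn : n ≤ k := by exact_mod_cast hle
    exact fun l hl => hout l (by omega)

end BitRAM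

/-! ### The whole program and its resource bounds -/

/-- A crude bound without any embedding: a stretch has at most `n` cells, none longer than its
longest. It serves only to keep the numbers short. -/
theorem NearestChain.pow_lt_of_not_spacious {d h n q : ℕ} {i : ℕ → ℕ}
    (hq : ¬ NearestChain.Spacious d h q n i) : (2 ^ d) ^ q < 4 * h * n := by
  unfold NearestChain.Spacious at hq
  push Not at hq
  obtain ⟨k, l, hkl, hl, hlt⟩ := hq
  obtain ⟨m, hkm, hml, hmax⟩ := NearestChain.exists_level i hkl
  have hsum : ∑ m ∈ Finset.Ico k l, (2 ^ d) ^ (i m - 1) ≤ n * (2 ^ d) ^ (i m - 1) := by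
    refine (Finset.sum_le_card_nsmul _ _ ((2 ^ d) ^ (i m - 1)) fun m' hm' => ?_).trans ?_
    · rw [Finset.mem_Ico] at hm'
      have := hmax m' hm'.1 hm'.2
      exact Nat.pow_le_pow_right (by positivity) (by omega)
    · rw [Nat.card_Ico, smul_eq_mul]
      exact Nat.mul_le_mul_right _ (by omega)
  refine Nat.lt_of_mul_lt_mul_right (a := (2 ^ d) ^ (i m - 1)) ((hlt m hkm hml).trans_le ?_)
  rw [mul_assoc (4 * h)]
  exact Nat.mul_le_mul_left _ hsum

namespace BitRAM

section
variable {n : ℕ} (D : Fin n → Fin n → ℚ)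

theorem inputStore_table (x y : Fin n) : inputStore D 1 (x * n + y) = D x y := by
  have hlt : (x : ℕ) * n + y < n * n := by
    have h1 : ((x : ℕ) + 1) * n ≤ n * n := Nat.mul_le_mul_right _ x.2
    have := y.2
    linarith
  have h1 : ((x : ℕ) * n + y) / n = x := by
    rw [mul_comm, Nat.mul_add_div (by have := x.2; omega), Nat.div_eq_of_lt y.2, add_zero]
  have h2 : ((x : ℕ) * n + y) % n = y := by
    rw [mul_comm, Nat.mul_add_mod, Nat.mod_eq_of_lt y.2]
  simp [inputStore, hlt, h1, h2]

theorem bitSize_pos (q : ℚ) : 1 ≤ bitSize q := by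
  unfold bitSize
  omega

theorem bitSize_le_inputSize (x y : Fin n) : bitSize (D x y) ≤ inputSize D := by
  unfold inputSize
  have h1 : bitSize (D x y) ≤ ∑ j, bitSize (D x j) :=
    Finset.single_le_sum (f := fun j => bitSize (D x j)) (fun _ _ => Nat.zero_le _)
      (Finset.mem_univ y)
  have h2 : ∑ j, bitSize (D x j) ≤ ∑ i, ∑ j, bitSize (D i j) :=
    Finset.single_le_sum (f := fun i => ∑ j, bitSize (D i j)) (fun _ _ => Nat.zero_le _)
      (Finset.mem_univ x)
  omega

theorem le_inputSize : n ≤ inputSize D := by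
  have h1 : ∑ _i : Fin n, ∑ _j : Fin n, 1 ≤ ∑ i, ∑ j, bitSize (D i j) :=
    Finset.sum_le_sum fun i _ => Finset.sum_le_sum fun j _ => bitSize_pos _
  simp only [Finset.sum_const, Finset.card_univ, Fintype.card_fin, smul_eq_mul, mul_one] at h1
  have h2 : n ≤ n * n := by nlinarith
  unfold inputSize
  omega

theorem small_inputStore {B : ℕ} (hB : 2 ≤ B) (hS : inputSize D ≤ B) :
    Small B (inputStore D) := by
  have h0 : bitSize 0 ≤ B := by simpa [bitSize] using hB
  intro k a
  unfold inputStore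
  split_ifs
  · exact le_trans (by unfold inputSize; omega) hS
  · exact (bitSize_le_inputSize D _ _).trans hS
  · exact h0
  · exact h0

end

/-- The embedding algorithm. -/
def embedProgram (d : ℕ) : Program :=
  .seq buildChain <| .seq findUnit <| .seq (findLevels (2 ^ d)) <| .seq (findStretch (2 ^ d)) <|
  .seq (findPlaces (2 ^ d)) <| writePoints d

open NearestChain in
-- Three bounds govern the run: `W` for the levels, `Z` for all natural numbers computed, and `B`
-- for bit lengths and rounds. The left side of `hZt` bounds twice the number of levels times the
-- length of the line, with the stretch factor at most `2 ^ d * (4 * W * n)`.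
theorem exec_embedProgram {d n B Z W : ℕ} {D : Fin n → Fin n → ℚ} (hD : IsUltrametric D)
    (hd : 2 ≤ d) (h2 : 2 ≤ n) (hS : inputSize D ≤ B) (hW : W = 2 * inputSize D + 1)
    (hB4 : 4 ≤ B) (hdB : d ≤ B) (hWB : W ≤ B) (hBn : 4 * W * n ≤ B) (hZ : bitSize Z ≤ B)
    (hWS : W + 3 + inputSize D ≤ B)
    (hZt : 2 * W * (2 ^ d * (4 * W * n) * (2 ^ d) ^ W) ≤ Z) :
    Exec B (embedProgram d) (inputStore D) fun s => ∃ (x : ℕ → Fin n) (i : ℕ → ℕ) (δ : ℚ)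
      (h p : ℕ), NearestChain D x i δ h ∧ Spacious d h p n i ∧
      (∀ q, p = q + 1 → ¬ Spacious d h q n i) ∧ ∀ k < n, ∀ a < d,
      s 2 (x k * d + a) =
        (spacedPosition h (gatherBits d (sweep (2 ^ d) h ((2 ^ d) ^ p) i k / 2 ^ a)) : ℕ) := by
  set s₀ := inputStore D with hs₀
  have hB : 1 ≤ B := by omega
  have hnS := le_inputSize D
  have hnB : n ≤ B := by omega
  have hW1 : 1 ≤ W := by omega
  have hβ1 : 1 ≤ 2 ^ d := Nat.one_le_two_pow
  have hβ4 : 4 ≤ 2 ^ d := by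
    calc 4 = 2 ^ 2 := by norm_num
      _ ≤ 2 ^ d := Nat.pow_le_pow_right (by norm_num) hd
  have hnbit : bitSize n ≤ B := le_trans (by unfold inputSize; omega) hS
  have hn0 : s₀ 0 0 = n := by simp [hs₀, inputStore]
  have hZbig : ∀ a b c e : ℕ, a ≤ 2 * W → b ≤ 2 ^ d → c ≤ 4 * W * n → e ≤ (2 ^ d) ^ W →
      a * (b * c * e) ≤ Z := fun a b c e h1 h2 h3 h4 =>
    (Nat.mul_le_mul h1 (Nat.mul_le_mul (Nat.mul_le_mul h2 h3) h4)).trans hZt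
  have hβW1 : 1 ≤ (2 ^ d) ^ W := Nat.one_le_pow _ _ hβ1
  have hWn1 : n ≤ 4 * W * n := Nat.le_mul_of_pos_left _ (by omega)
  have hnZ : n ≤ Z := by simpa using hZbig 1 1 n 1 (by omega) hβ1 hWn1 hβW1
  have hWZ : W ≤ Z := by simpa using hZbig W 1 1 1 (by omega) hβ1 (by omega) hβW1
  have hβZ : (2 ^ d) ^ W ≤ Z := by
    simpa using hZbig 1 1 1 ((2 ^ d) ^ W) (by omega) hβ1 (by omega) le_rfl
  have hdZ : 2 ^ d ≤ Z := by simpa using hZbig 1 (2 ^ d) 1 1 (by omega) le_rfl (by omega) hβW1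
  have hs3 : ∀ a, s₀ 3 a = 0 := by simp [hs₀, inputStore]
  have hs4 : s₀ 4 0 = 0 := by simp [hs₀, inputStore]
  refine Exec.seq ((exec_buildChain hB4 hnB hnbit h2 hn0 hs3 hs4 fun a =>
    small_inputStore D (by omega) hS 1 a).mono ?_)
  rintro s₁ ⟨hfr₁, x, hx, hinj, hdist, hnear⟩
  -- The value for `k ≥ n` is arbitrary; the chain is used only below `n`.
  set y : ℕ → Fin n := fun k => if h : x k < n then ⟨x k, h⟩ else ⟨0, by omega⟩ with hy
  have hyx : ∀ k < n, ((y k : Fin n) : ℕ) = x k := fun k hk => by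
    simp [hy, (hx k hk).1]
  have htab : ∀ k < n, ∀ l < n, s₀ 1 (x k * n + x l) = D (y k) (y l) := fun k hk l hl => by
    rw [← hyx k hk, ← hyx l hl, hs₀, inputStore_table]
  have hyne : ∀ k, k + 1 < n → y k ≠ y (k + 1) := fun k hk heq => by
    have h1 := congrArg Fin.val heq
    rw [hyx k (by omega), hyx _ hk] at h1
    have := hinj k (by omega) (k + 1) hk h1
    omega
  set e : ℕ → ℚ := fun k => D (y k) (y (k + 1)) with he
  have hebit : ∀ k, bitSize (e k) ≤ inputSize D := fun k => bitSize_le_inputSize D _ _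
  have hs7 : ∀ k, k + 1 < n → s₁ 7 k = e k := fun k hk => by
    rw [hdist k hk, htab k (by omega) _ hk]
  have hf₁ : ∀ k, k ∉ [3, 4, 7, 10, 11, 12] → s₁ k = s₀ k := hfr₁
  refine Exec.seq ((exec_findUnit hB hnB hnbit h2 (by rw [hf₁ 0 (by simp), hn0]) hs7
    fun k _ => (hebit k).trans hS).mono ?_)
  rintro s₂ ⟨hf₂, k₀, hk₀, h13, hmin⟩
  have hδpos : 0 < e k₀ := hD.pos (hyne k₀ hk₀)
  -- A quotient of two input distances has at most `2 * inputSize D` bits, hence is below `2 ^ W`.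
  have heW : ∀ k, k + 1 < n → e k ≤ 2 ^ W * e k₀ := fun k hk => by
    rw [← div_le_iff₀ hδpos]
    refine (lt_two_pow_bitSize _).le.trans (pow_le_pow_right₀ one_le_two ?_)
    have := bitSize_div_le (e k) (e k₀)
    have := hebit k
    have := hebit k₀
    omega
  have hpow : ∀ j ≤ W, bitSize (2 ^ j * e k₀) ≤ B := fun j hj => by
    have h1 := bitSize_mul_le (2 ^ j) (e k₀)
    have h2 : bitSize (2 ^ j : ℚ) ≤ (j + 1) + 2 := by
      have := bitSize_natCast_le (m := 2 ^ j) (b := j + 1)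
        (Nat.pow_lt_pow_right (by norm_num) (by omega))
      simpa using this
    have := hebit k₀
    omega
  refine Exec.seq ((exec_findLevels hB hnB hWB hZ hnZ h2 hβ1 hW1 hWZ hβZ hδpos
    (by rw [hf₂ 0 (by simp), hf₁ 0 (by simp), hn0]) h13
    (fun k hk => by rw [hf₂ 7 (by simp), hs7 k hk]) hmin heW hpow).mono ?_)
  rintro s₃ ⟨hf₃, i, h, h16, htop, hhW, hlev⟩
  have hchain : NearestChain D y i (e k₀) h := by
    refine ⟨fun k l hk hl hkl => ?_, fun k l hkl hl => ?_, hδpos, ⟨k₀, hk₀, rfl⟩,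
      fun k hk => (hlev k hk).1, fun k hk => (hlev k hk).2.1, htop,
      fun k hk => (hlev k hk).2.2.2.1, fun k hk => (hlev k hk).2.2.2.2⟩
    · have h1 := congrArg Fin.val hkl
      rw [hyx k hk, hyx l hl] at h1
      exact hinj k hk l hl h1
    · have := hnear k l hkl hl
      rwa [htab k (by omega) _ (by omega), htab k (by omega) _ hl] at this
  have hβh : (2 ^ d) ^ h ≤ (2 ^ d) ^ W := Nat.pow_le_pow_right hβ1 hhW
  have hhn : 4 * h * n ≤ 4 * W * n := Nat.mul_le_mul_right _ (by omega)
  have hn3 : s₃ 0 0 = n := by rw [hf₃ 0 (by simp), hf₂ 0 (by simp), hf₁ 0 (by simp), hn0]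
  refine Exec.seq ((exec_findStretch (d := d) (i := i) (by omega) hB hZ hnB hnZ (by omega)
    (hhn.trans hBn) (by simpa using hZbig 1 _ _ 1 (by omega) le_rfl hhn hβW1)
    (by simpa using hZbig 1 1 n _ (by omega) hβ1 hWn1 hβh) (fun m hm => (hlev m hm).2.1) hn3
    (fun m hm => (hlev m hm).2.2.1) h16).mono ?_)
  rintro s₄ ⟨hf₄, p, h18, hp, hsp⟩
  have hP1 : 1 ≤ (2 ^ d) ^ p := Nat.one_le_pow _ _ hβ1
  have h1h := hchain.one_le_top
  -- By minimality the preceding exponent is not spacious, so the last enlargement overshoots by at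
  -- most one factor `2 ^ d`.
  have hPle : (2 ^ d) ^ p ≤ 2 ^ d * (4 * W * n) := by
    cases p with
    | zero => exact Nat.mul_pos hβ1 (by omega)
    | succ q =>
      rw [pow_succ']
      exact Nat.mul_le_mul_left _ ((pow_lt_of_not_spacious (hp q rfl)).le.trans hhn)
  set t := sweep (2 ^ d) h ((2 ^ d) ^ p) i with ht
  have htlt : ∀ k < n, t k < (2 ^ d) ^ p * (2 ^ d) ^ h := fun k hk =>
    sweep_lt hβ4 h1h hP1 (N := n - 1) (by omega) (fun k l h1 h2 => hsp k l h1 (by omega))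
      fun m hm => (hlev m (by omega)).2.1
  have hLle : (2 ^ d) ^ p * (2 ^ d) ^ h ≤ 2 ^ d * (4 * W * n) * (2 ^ d) ^ W :=
    Nat.mul_le_mul hPle hβh
  have hLZ : ∀ a ≤ 2 * W, a * ((2 ^ d) ^ p * (2 ^ d) ^ h) ≤ Z := fun a ha =>
    (Nat.mul_le_mul ha hLle).trans hZt
  have hL1 : (2 ^ d) ^ p * (2 ^ d) ^ h ≤ Z := by simpa using hLZ 1 (by omega)
  have hn4 : s₄ 0 0 = n := by rw [hf₄ 0 (by simp), hn3]
  have h16' : s₄ 16 0 = h := by rw [hf₄ 16 (by simp), h16]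
  refine Exec.seq ((exec_findPlaces (i := i) hB hZ hnB hnZ (by omega) (by omega) (by omega) hP1
    (fun k hk => ⟨(hlev k hk).1, (hlev k hk).2.1⟩) hn4
    (fun k hk => by rw [hf₄ 5 (by simp), (hlev k hk).2.2.1]) h16' h18 hL1
    fun k hk => (htlt k hk).le.trans hL1).mono ?_)
  rintro s₅ ⟨hf₅, h6⟩
  have h4 : ∀ k < n, s₅ 4 k = x k := fun k hk => by
    rw [hf₅ 4 (by simp), hf₄ 4 (by simp), hf₃ 4 (by simp), hf₂ 4 (by simp), (hx k hk).2]
  have hhZ : 2 ^ h ≤ Z :=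
    (Nat.pow_le_pow_left (Nat.le_self_pow (by omega) 2) h).trans (hβh.trans hβZ)
  refine (exec_writePoints (by omega) hB hZ hnB hnZ hdB (by omega) hdZ hhZ (fun k hk => ?_)
    (fun k hk => ?_) (by rw [hf₅ 0 (by simp), hn4]) h6 h4 hinj
    (by rw [hf₅ 16 (by simp), h16'])).mono ?_
  · have h3 := hLZ 2 (by omega)
    have h4 := htlt k hk
    show 2 * t k + 1 ≤ Z
    omega
  · exact (Nat.mul_le_mul_left _ (htlt k hk).le).trans (hLZ h (by omega))
  · intro s' hout
    refine ⟨y, i, e k₀, h, p, hchain, hsp, hp, fun k hk a ha => ?_⟩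
    rw [hyx k hk]
    exact hout k hk a ha

end BitRAM

theorem mainTheorem5 :
    ∃ C : ℝ, 0 < C ∧ ∀ d : ℕ, 2 ≤ d →
      ∃ (prog : BitRAM.Program) (p : Polynomial ℕ),
        ∀ (n : ℕ), 2 ≤ n → ∀ D : Fin n → Fin n → ℚ, IsUltrametric D →
          ∃ (t : ℕ) (s : BitRAM.Store),
            BitRAM.Runs prog (BitRAM.inputStore D) t s ∧
            t ≤ p.eval (BitRAM.inputSize D) ∧
            Function.Injective (BitRAM.outputMap n d s) ∧
            distortion D (BitRAM.outputMap n d s) ≤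
              C * Real.sqrt d * (1 + Real.logb 2 (spread D)) ^ 3 * optDistortion d D := by
  refine ⟨160, by norm_num, fun d hd => ?_⟩
  obtain ⟨q, hq⟩ := (BitRAM.embedProgram d).exists_polynomial_timeBound
  refine ⟨BitRAM.embedProgram d,
    q.comp (Polynomial.C (20 * (d + 1)) * (Polynomial.X + 1) ^ 2), fun n hn D hD => ?_⟩
  set S := BitRAM.inputSize D with hS
  -- Quadratic in the input length because of `4 * W * n` rounds and linear in `d` because of the
  -- bits of `(2 ^ d) ^ W`; the constant 20 leaves room.
  set B := 20 * (d + 1) * (S + 1) ^ 2 with hBdef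
  have hnS : n ≤ S := BitRAM.le_inputSize D
  have hB : 20 * (S + 1) ^ 2 + 20 * (d * (S + 1)) ≤ B := by
    rw [hBdef]
    nlinarith [Nat.zero_le (d * S), Nat.zero_le (d * S * S)]
  have hSB : (S + 1) ^ 2 = S * S + 2 * S + 1 := by ring
  have hdS : d * (S + 1) = d * S + d := by ring
  -- The exponent in `Z` replaces each factor of the required bound by a power of two, with `2 * S +
  -- 1 ≤ 2 ^ (2 * S + 1)` used twice and `n ≤ 2 ^ S`.
  have hexec := BitRAM.exec_embedProgram (d := d) (n := n) (B := B) (W := 2 * S + 1)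
    (Z := 2 ^ (d + 2 + (2 * S + 1) + S + d * (2 * S + 1) + (2 * S + 1) + 1)) hD hd hn
    (by omega) rfl (by omega) (by omega) (by omega)
    (by
      have : 4 * (2 * S + 1) * n ≤ 4 * (2 * S + 1) * S := Nat.mul_le_mul_left _ hnS
      have e : 4 * (2 * S + 1) * S = 8 * (S * S) + 4 * S := by ring
      omega)
    (by
      refine (BitRAM.bitSize_natCast_le (Nat.pow_lt_pow_right (by norm_num)
        (Nat.lt_succ_self _))).trans ?_
      have e : d * (2 * S + 1) = 2 * (d * S) + d := by ring
      omega)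
    (by omega)
    (by
      have h1 : 2 * S + 1 ≤ 2 ^ (2 * S + 1) := Nat.lt_two_pow_self.le
      have h2 : n ≤ 2 ^ S := hnS.trans Nat.lt_two_pow_self.le
      calc 2 * (2 * S + 1) * (2 ^ d * (4 * (2 * S + 1) * n) * (2 ^ d) ^ (2 * S + 1))
          ≤ 2 * 2 ^ (2 * S + 1) *
              (2 ^ d * (4 * 2 ^ (2 * S + 1) * 2 ^ S) * (2 ^ d) ^ (2 * S + 1)) := by gcongr
        _ = 2 ^ (d + 2 + (2 * S + 1) + S + d * (2 * S + 1) + (2 * S + 1) + 1) := by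
          rw [← pow_mul]
          simp only [pow_add]
          ring)
  obtain ⟨t, s, hrun, ht, -, x, i, δ, h, p, hchain, hsp, hp, hout⟩ :=
    hexec (BitRAM.small_inputStore D (by omega) (by omega))
  refine ⟨t, s, hrun, ?_, hchain.embedding hD hd hn hsp hp fun k hk a => ?_⟩
  · rw [Polynomial.eval_comp]
    simpa [hBdef, hq] using ht
  · rw [BitRAM.outputMap]
    simp only [hout k hk a a.2]
    norm_cast
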